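/- **Definitions.** $\cong$ denotes isomorphism of topological groups. A *Polish ultrametric space* is a (nonempty) ultrametric space whose metric is complete and induces a second-countable topology; it is *uniformly discrete* if for some $r>0$ all open balls of radius $r$ are singletons. $\operatorname{Iso}(U)$ carries the topology of pointwise convergence. "Countable" means finite or countably infinite. For a set $X$, $\operatorname{Sym}(X)$ carries the topology of pointwise convergence with respect to the discrete topology on $X$, and subgroups carry the relative topology. *Trees.* Let $L$ be a linear order. A *weak $L$-tree* $\mathcal T=(T,\le_T,\lambda_T)$ is a partial order $(T,\le_T)$ with a surjection $\lambda_T\colon T\to L$ such that: $t<_Tt'$ implies $\lambda_T(t)<\lambda_T(t')$; for each $t\in T$ and $\ell\ge\lambda_T(t)$ there is a unique $t|_\ell\ge_T t$ with $\lambda_T(t|_\ell)=\ell$; for all $t,t'\in T$ there is $\ell\ge\max\{\lambda_T(t),\lambda_T(t')\}$ with $t|_\ell=t'|_\ell$. It is an *$L$-tree* if moreover for all $\le_T$-incomparable $t,t'$ the set $\{\ell\ge\max\{\lambda_T(t),\lambda_T(t')\} : t|_\ell\ne t'|_\ell\}$ has a maximum. It is *countable* if $T$ is, and *pruned* if for every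 $t\in T$ there is $b\colon L\to T$ with $\lambda_T(b(\ell))=\ell$ for all $\ell$, $b(\ell)\le_T b(\ell')$ whenever $\ell\le\ell'$, and $b(\lambda_T(t))=t$. $\operatorname{Aut}(\mathcal T)\le\operatorname{Sym}(T)$ is the group of order-automorphisms of $T$ preserving $\lambda_T$. The *condensed tree* $\Delta(\mathcal T)$ is the weak $L$-tree of all $\operatorname{Aut}(\mathcal T)$-orbits $[t]$, with level $\lambda_T(t)$ and with $\delta\le\delta'$ iff $t\le_T t'$ for some $t\in\delta$, $t'\in\delta'$. An $L$-tree $\mathcal T$ is *special* if $\Delta(\mathcal T)$ is an $L$-tree. *Skeletons.* A *countable skeleton* $\langle\Delta,N\rangle$ is a nonempty countable partial order $\Delta$ with cardinals $1\le N_\delta\le\omega$ ($\delta\in\Delta$), where $N_\delta$ is identified with the set of natural numbers less than $N_\delta$. It is *treeable* if for some linear order $L$ and some map $\lambda\colon\Delta\to L$, $(\Delta,\le,\lambda)$ is a pruned $L$-tree. For $z\in\prod_{\gamma\ge\delta}N_\gamma$, $\gamma\ge\delta$ and $i\in N_\delta$ let $z|_\gamma$ be the restriction of $z$ to $\{\beta:\beta\ge\gamma\}$,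 and let $z^\delta_i$ be $z$ with its value at $\delta$ changed to $i$. For $\mathbf S\subseteq\bigcup_{\delta}\prod_{\gamma\ge\delta}N_\gamma$ put $\mathbf S_\delta=\mathbf S\cap\prod_{\gamma\ge\delta}N_\gamma$. For $x\in\prod_{\delta\in\Delta}N_\delta$ put $\operatorname{supp}(x)=\{\delta : x(\delta)\neq0\}$. Let $\mathbf S^{\rm LF}$ (respectively $\mathbf S^{\rm Max}$) be the set of all $x|_\delta$ with $\delta\in\Delta$ and $x\in\prod_{\delta\in\Delta} N_\delta$ such that $\operatorname{supp}(x)\cap\{\gamma:\gamma\ge\beta\}$ is finite for every $\beta\in\Delta$ (respectively such that every nonempty subset of $\operatorname{supp}(x)$ has a maximal element). *Wreath products.* A *system of projections* $\langle\mathbf S,\boldsymbol\pi\rangle$ over $\langle\Delta,N\rangle$ consists of $\mathbf S$ as above with all $\mathbf S_\delta\neq\emptyset$ and with $z^\delta_i\in\mathbf S_\delta$ for all $z\in\mathbf S_\delta$ and $i\in N_\delta$, together with surjections $\pi_{\delta\gamma}\colon\mathbf S_\delta\to\mathbf S_\gamma$ ($\gamma\ge\delta$) such that $\pi_{\delta\gamma}(z)=\pi_{\delta\gamma}(z')\iff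 z|_\gamma=z'|_\gamma$, and $\pi_{\gamma\beta}\circ\pi_{\delta\gamma}=\pi_{\delta\beta}$ for $\beta\ge\gamma\ge\delta$. It is *countable* if $\mathbf S$ is. The *projective wreath product* $\operatorname{Wr}^{\mathbf S,\boldsymbol\pi}_{\delta\in\Delta}\operatorname{Sym}(N_\delta)$ is the group of all $g\in\operatorname{Sym}(\mathbf S)$ such that, for all $\gamma\ge\delta$ and $z\in\mathbf S_\delta$, $g(\mathbf S_\delta)=\mathbf S_\delta$, $g(\pi_{\delta\gamma}(z))=\pi_{\delta\gamma}(g(z))$, and $i\mapsto g(z^\delta_i)(\delta)$ is a permutation of $N_\delta$. The system is *locally homogeneous* if this group acts transitively on each $\mathbf S_\delta$; it has *finite character* if every cone $\{\gamma:\gamma\ge\delta\}$ can be partitioned into finitely many convex sets $C_0,\dots,C_n$ such that $\pi_{\gamma\beta}(z)=z|_\beta$ whenever $\gamma\le\beta$ lie in the same $C_i$ and $z\in\mathbf S_\gamma$. A *family of local domains* is a set $\mathbf S$ which together with the restriction maps $\pi_{\delta\gamma}(z)=z|_\gamma$ is a system of projections; its projective wreath product is then denoted $\operatorname{Wr}^{\mathbf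 S}_{\delta\in\Delta}\operatorname{Sym}(N_\delta)$. **Theorem.** For every topological group $G$ the following are equivalent: 1. $G\cong\operatorname{Iso}(U)$ for some Polish ultrametric space $U$; 2. $G\cong\operatorname{Iso}(U)$ for some perfect locally compact Polish ultrametric space $U$; 3. $G\cong\operatorname{Iso}(U)$ for some uniformly discrete Polish ultrametric space $U$; 4. $G\cong\operatorname{Aut}(\mathcal T)$ for some linear order $L$ and some countable pruned $L$-tree $\mathcal T$; 5. $G\cong\operatorname{Aut}(\mathcal T)$ for some linear order $L$ with a minimum and some countable pruned special $L$-tree $\mathcal T$; 6. $G\cong\operatorname{Aut}(\mathcal T)$ for some countable pruned special $\mathbb Q$-tree $\mathcal T$; 7. $G\cong\operatorname{Wr}^{\mathbf S^{\rm LF},\boldsymbol\pi}_{\delta\in\Delta}\operatorname{Sym}(N_\delta)$ for some countable treeable skeleton $\langle\Delta,N\rangle$ and some locally homogeneous system of projections $\langle\mathbf S^{\rm LF},\boldsymbol\pi\rangle$ of finite character; 8. $G\cong\operatorname{Wr}^{\mathbf S}_{\delta\in\Delta}\operatorname{Sym}(N_\delta)$ for some countable treeable skeleton $\langle\Delta,N\rangle$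 and some countable family of local domains $\mathbf S\subseteq\mathbf S^{\rm Max}$; 9. $G\cong\operatorname{Wr}^{\mathbf S,\boldsymbol\pi}_{\delta\in\Delta}\operatorname{Sym}(N_\delta)$ for some countable treeable skeleton $\langle\Delta,N\rangle$ and some countable system of projections $\langle\mathbf S,\boldsymbol\pi\rangle$ with $\mathbf S\subseteq\mathbf S^{\rm Max}$. -/

import Mathlib

/-! ## Topologies of pointwise convergence -/

/-- `Sym(X)` with the topology of pointwise convergence with respect to the discrete topology
on `X`. -/
instance permPointwiseTopology (X : Type*) : TopologicalSpace (Equiv.Perm X) :=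
  TopologicalSpace.induced (fun (f : Equiv.Perm X) (x : X) => f x)
    (@Pi.topologicalSpace X (fun _ => X) (fun _ => ⊥))

/-- `Iso(U)` with the topology of pointwise convergence (with respect to the metric topology
of `U`). -/
instance isoPointwiseTopology (U : Type*) [MetricSpace U] : TopologicalSpace (U ≃ᵢ U) :=
  TopologicalSpace.induced (fun (f : U ≃ᵢ U) (x : U) => f x) inferInstance

/-! ## Ultrametric spaces -/

/-- A (nonempty) Polish ultrametric space: the given metric is a complete ultrametric and induces
a second-countable topology. -/
structure IsPolishUltrametric (U : Type*) [MetricSpace U] : Prop where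
  nonempty : Nonempty U
  ultrametric : IsUltrametricDist U
  complete : CompleteSpace U
  secondCountable : SecondCountableTopology U

/-- Some fixed radius `r > 0` isolates every point. -/
def IsUniformlyDiscrete (U : Type*) [MetricSpace U] : Prop :=
  ∃ r : ℝ, 0 < r ∧ ∀ x : U, Metric.ball x r = {x}

/-! ## Weak `L`-trees and `L`-trees -/

/-- A weak `L`-tree structure on the partial order `T`. Nodes `t` with `t ≤ s` and `lam s = ℓ`
determine `s = t|_ℓ`, so `t|_ℓ = u|_ℓ` is expressed by a common upper bound of level `ℓ`. -/
structure WeakLTree (L T : Type*) [LinearOrder L] [PartialOrder T] where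
  lam : T → L
  lam_surjective : Function.Surjective lam
  lam_lt : ∀ t u : T, t < u → lam t < lam u
  existsUnique_above : ∀ (t : T) (ℓ : L), lam t ≤ ℓ → ∃! s : T, t ≤ s ∧ lam s = ℓ
  exists_common : ∀ t u : T, ∃ ℓ : L, lam t ≤ ℓ ∧ lam u ≤ ℓ ∧ ∃ s : T, t ≤ s ∧ u ≤ s ∧ lam s = ℓ

namespace WeakLTree

variable {L T : Type*} [LinearOrder L] [PartialOrder T]

/-- `t|_ℓ = u|_ℓ` (for `ℓ` above the levels of `t` and `u`). -/
def AgreeAt (𝒯 : WeakLTree L T) (t u : T) (ℓ : L) : Prop :=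
  ∃ s : T, t ≤ s ∧ u ≤ s ∧ 𝒯.lam s = ℓ

/-- A weak `L`-tree is an `L`-tree if for incomparable `t, u` the set of levels at which
`t|_ℓ ≠ u|_ℓ` has a maximum. -/
def IsLTree (𝒯 : WeakLTree L T) : Prop :=
  ∀ t u : T, ¬ t ≤ u → ¬ u ≤ t →
    ∃ m : L, IsGreatest {ℓ : L | 𝒯.lam t ≤ ℓ ∧ 𝒯.lam u ≤ ℓ ∧ ¬ 𝒯.AgreeAt t u ℓ} m

/-- Branches of a weak `L`-tree. -/
def IsBranch (𝒯 : WeakLTree L T) (b : L → T) : Prop :=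
  (∀ ℓ, 𝒯.lam (b ℓ) = ℓ) ∧ ∀ ℓ ℓ', ℓ ≤ ℓ' → b ℓ ≤ b ℓ'

/-- Every node lies on a branch. -/
def IsPruned (𝒯 : WeakLTree L T) : Prop :=
  ∀ t : T, ∃ b : L → T, 𝒯.IsBranch b ∧ b (𝒯.lam t) = t

/-- The automorphism group `Aut(𝒯)`, with the topology inherited from `Sym(T)`. -/
def aut (𝒯 : WeakLTree L T) : Subgroup (Equiv.Perm T) where
  carrier := {f | (∀ t, 𝒯.lam (f t) = 𝒯.lam t) ∧ ∀ t u, t ≤ u ↔ f t ≤ f u}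
  mul_mem' := by
    rintro f g ⟨hf, hf'⟩ ⟨hg, hg'⟩
    exact ⟨fun t => by rw [Equiv.Perm.mul_apply, hf, hg],
      fun t u => by rw [Equiv.Perm.mul_apply, Equiv.Perm.mul_apply, ← hf', ← hg']⟩
  one_mem' := ⟨fun _ => rfl, fun _ _ => Iff.rfl⟩
  inv_mem' := by
    rintro f ⟨hf, hf'⟩
    exact ⟨fun t => by simpa using (hf (f⁻¹ t)).symm,
      fun t u => by simpa using (hf' (f⁻¹ t) (f⁻¹ u)).symm⟩

/-- `t ∼ u` iff some automorphism sends `t` to `u`. -/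
def orbitSetoid (𝒯 : WeakLTree L T) : Setoid T where
  r t u := ∃ f ∈ 𝒯.aut, f t = u
  iseqv :=
    { refl := fun _ => ⟨1, 𝒯.aut.one_mem, rfl⟩
      symm := by
        rintro t u ⟨f, hf, rfl⟩
        exact ⟨f⁻¹, 𝒯.aut.inv_mem hf, by simp⟩
      trans := by
        rintro t u v ⟨f, hf, rfl⟩ ⟨g, hg, rfl⟩
        exact ⟨g * f, 𝒯.aut.mul_mem hg hf, rfl⟩ }

/-- The set of orbits. -/
def Condensed (𝒯 : WeakLTree L T) : Type _ := Quotient 𝒯.orbitSetoid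

/-- The orbit `[t]`. -/
def orb (𝒯 : WeakLTree L T) (t : T) : 𝒯.Condensed := Quotient.mk 𝒯.orbitSetoid t

theorem orb_eq_iff (𝒯 : WeakLTree L T) {t u : T} :
    𝒯.orb t = 𝒯.orb u ↔ ∃ f ∈ 𝒯.aut, f t = u :=
  ⟨fun h => Quotient.exact h, fun h => Quotient.sound h⟩

theorem exists_orb (𝒯 : WeakLTree L T) (δ : 𝒯.Condensed) : ∃ t, 𝒯.orb t = δ :=
  Quotient.exists_rep δ

/-- The level of an orbit. -/
def condensedLam (𝒯 : WeakLTree L T) : 𝒯.Condensed → L :=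
  Quotient.lift 𝒯.lam (by
    rintro t u ⟨f, hf, rfl⟩
    exact (hf.1 t).symm)

theorem condensedLam_orb (𝒯 : WeakLTree L T) (t : T) : 𝒯.condensedLam (𝒯.orb t) = 𝒯.lam t := rfl

theorem lam_mono (𝒯 : WeakLTree L T) {t u : T} (h : t ≤ u) : 𝒯.lam t ≤ 𝒯.lam u := by
  rcases h.eq_or_lt with rfl | h
  · exact le_rfl
  · exact (𝒯.lam_lt _ _ h).le

/-- `δ ≤ ε` iff `t ≤ u` for some `t ∈ δ` and `u ∈ ε`. -/
def condensedLE (𝒯 : WeakLTree L T) (δ ε : 𝒯.Condensed) : Prop :=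
  ∃ t u : T, 𝒯.orb t = δ ∧ 𝒯.orb u = ε ∧ t ≤ u

/-- In the definition of the order between orbits the lower representative is arbitrary. -/
theorem condensedLE_orb (𝒯 : WeakLTree L T) {t : T} {ε : 𝒯.Condensed} :
    𝒯.condensedLE (𝒯.orb t) ε ↔ ∃ u : T, 𝒯.orb u = ε ∧ t ≤ u := by
  constructor
  · rintro ⟨t₁, u, ht, rfl, htu⟩
    obtain ⟨f, hf, rfl⟩ := 𝒯.orb_eq_iff.1 ht
    exact ⟨f u, (𝒯.orb_eq_iff.2 ⟨f, hf, rfl⟩).symm, (hf.2 _ _).1 htu⟩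
  · rintro ⟨u, hu, htu⟩
    exact ⟨t, u, rfl, hu, htu⟩

instance condensedOrder (𝒯 : WeakLTree L T) : PartialOrder 𝒯.Condensed where
  le := 𝒯.condensedLE
  le_refl δ := by
    obtain ⟨t, rfl⟩ := 𝒯.exists_orb δ
    exact ⟨t, t, rfl, rfl, le_rfl⟩
  le_trans δ ε ζ h₁ h₂ := by
    obtain ⟨t, rfl⟩ := 𝒯.exists_orb δ
    obtain ⟨u, rfl, htu⟩ := 𝒯.condensedLE_orb.1 h₁
    obtain ⟨v, hv, huv⟩ := 𝒯.condensedLE_orb.1 h₂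
    exact ⟨t, v, rfl, hv, htu.trans huv⟩
  le_antisymm δ ε h₁ h₂ := by
    obtain ⟨t, rfl⟩ := 𝒯.exists_orb δ
    obtain ⟨u, rfl, htu⟩ := 𝒯.condensedLE_orb.1 h₁
    obtain ⟨v, hv, huv⟩ := 𝒯.condensedLE_orb.1 h₂
    rcases htu.eq_or_lt with rfl | htu
    · rfl
    · have h := (𝒯.lam_lt _ _ htu).trans_le (𝒯.lam_mono huv)
      rw [← 𝒯.condensedLam_orb v, hv, 𝒯.condensedLam_orb t] at h
      exact absurd h (lt_irrefl _)

/-- The condensed tree `Δ(𝒯)`. -/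
def condensed (𝒯 : WeakLTree L T) : WeakLTree L 𝒯.Condensed where
  lam := 𝒯.condensedLam
  lam_surjective ℓ := by
    obtain ⟨t, rfl⟩ := 𝒯.lam_surjective ℓ
    exact ⟨𝒯.orb t, rfl⟩
  lam_lt δ ε h := by
    obtain ⟨t, rfl⟩ := 𝒯.exists_orb δ
    obtain ⟨u, rfl, htu⟩ := 𝒯.condensedLE_orb.1 h.le
    rcases htu.eq_or_lt with rfl | htu
    · exact absurd h (lt_irrefl _)
    · exact 𝒯.lam_lt _ _ htu
  existsUnique_above δ ℓ hℓ := by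
    obtain ⟨t, rfl⟩ := 𝒯.exists_orb δ
    obtain ⟨s, ⟨hs, rfl⟩, hu⟩ := 𝒯.existsUnique_above t ℓ hℓ
    refine ⟨𝒯.orb s, ⟨𝒯.condensedLE_orb.2 ⟨s, rfl, hs⟩, rfl⟩, ?_⟩
    rintro ε ⟨h, hε⟩
    obtain ⟨v, rfl, htv⟩ := 𝒯.condensedLE_orb.1 h
    rw [hu v ⟨htv, hε⟩]
  exists_common δ ε := by
    obtain ⟨t, rfl⟩ := 𝒯.exists_orb δ
    obtain ⟨u, rfl⟩ := 𝒯.exists_orb ε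
    obtain ⟨ℓ, h₁, h₂, s, hts, hus, hs⟩ := 𝒯.exists_common t u
    exact ⟨ℓ, h₁, h₂, 𝒯.orb s, 𝒯.condensedLE_orb.2 ⟨s, rfl, hts⟩,
      𝒯.condensedLE_orb.2 ⟨s, rfl, hus⟩, hs⟩

/-- An `L`-tree is special if its condensed tree is still an `L`-tree. -/
def IsSpecial (𝒯 : WeakLTree L T) : Prop := 𝒯.condensed.IsLTree

end WeakLTree

/-! ## Skeletons and generalized sequences -/

/-- The cardinal `n ≤ ω` as the set `{i | i < n}` of smaller natural numbers. -/
abbrev Label (n : ℕ∞) : Type := {i : ℕ // (i : ℕ∞) < n}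

/-- `⟨Δ, N⟩` is a countable treeable skeleton: `Δ` is a nonempty countable partial order, the labels
`N δ ≤ ω` are nonzero, and `Δ` carries the structure of a pruned `L`-tree for some linear
order `L`. (Since `Δ` is countable and maps onto `L`, it is enough to consider `L : Type`.) -/
structure IsCountableTreeableSkeleton (Δ : Type*) [PartialOrder Δ] (N : Δ → ℕ∞) : Prop where
  nonempty : Nonempty Δ
  countable : Countable Δ
  label_ne_zero : ∀ δ, N δ ≠ 0
  treeable : ∃ (L : Type) (_ : LinearOrder L) (𝒯 : WeakLTree L Δ), 𝒯.IsLTree ∧ 𝒯.IsPruned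

section Sequences

variable {Δ : Type*} [PartialOrder Δ]

/-- The product of the `N γ` over all `γ ≥ δ`. -/
abbrev LocSeq (N : Δ → ℕ∞) (δ : Δ) : Type _ := (γ : {γ : Δ // δ ≤ γ}) → Label (N γ.1)

/-- The restriction `z|_γ`, for `γ ≥ δ`. -/
def LocSeq.restrict {N : Δ → ℕ∞} {δ γ : Δ} (h : δ ≤ γ) (z : LocSeq N δ) : LocSeq N γ :=
  fun β => z ⟨β.1, h.trans β.2⟩

open Classical in
/-- `z^δ_i`: the sequence `z` with its value at `δ` replaced by `i`. -/
noncomputable def LocSeq.perturb {N : Δ → ℕ∞} {δ : Δ} (z : LocSeq N δ) (i : Label (N δ)) :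
    LocSeq N δ :=
  Function.update z ⟨δ, le_rfl⟩ i

/-- The support of a global sequence. -/
def seqSupport {N : Δ → ℕ∞} (x : (γ : Δ) → Label (N γ)) : Set Δ := {γ | (x γ).1 ≠ 0}

/-- For a family `A` of admissible supports, the set of all `x|_δ` with `supp x ∈ A`. -/
def admissibleLocal (N : Δ → ℕ∞) (A : Set (Set Δ)) (δ : Δ) : Set (LocSeq N δ) :=
  {z | ∃ x : (γ : Δ) → Label (N γ), seqSupport x ∈ A ∧ ∀ γ, z γ = x γ.1}

/-- Locally finite supports. -/
def suppLF (Δ : Type*) [PartialOrder Δ] : Set (Set Δ) :=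
  {A | ∀ δ : Δ, (A ∩ Set.Ici δ).Finite}

/-- Supports with the maximum condition: every nonempty subset has a maximal element. -/
def suppMax (Δ : Type*) [PartialOrder Δ] : Set (Set Δ) :=
  {A | ∀ B ⊆ A, B.Nonempty → ∃ m, Maximal (· ∈ B) m}

end Sequences

/-! ## Projective wreath products -/

/-- A system of projections over `⟨Δ, N⟩`. A set of generalized sequences is given by its
parts `S δ`, consisting of the members with domain `{γ | γ ≥ δ}`. -/
structure ProjSystem {Δ : Type*} [PartialOrder Δ] (N : Δ → ℕ∞) where
  S : (δ : Δ) → Set (LocSeq N δ)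
  nonempty : ∀ δ, (S δ).Nonempty
  perturb_mem : ∀ (δ : Δ) (z : LocSeq N δ), z ∈ S δ → ∀ i : Label (N δ), z.perturb i ∈ S δ
  proj : ∀ {δ γ : Δ}, δ ≤ γ → S δ → S γ
  proj_surjective : ∀ {δ γ : Δ} (h : δ ≤ γ), Function.Surjective (proj h)
  proj_eq_iff : ∀ {δ γ : Δ} (h : δ ≤ γ) (z w : S δ),
    proj h z = proj h w ↔ z.1.restrict h = w.1.restrict h
  proj_comp : ∀ {δ γ β : Δ} (h₁ : δ ≤ γ) (h₂ : γ ≤ β) (z : S δ),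
    proj h₂ (proj h₁ z) = proj (h₁.trans h₂) z

namespace ProjSystem

variable {Δ : Type*} [PartialOrder Δ] {N : Δ → ℕ∞}

/-- The (disjoint) union of all `S δ`. -/
abbrev Point (P : ProjSystem N) : Type _ := (δ : Δ) × P.S δ

/-- `π_{δγ}(z)`, as an element of the union, where `z ∈ S δ`. -/
def up (P : ProjSystem N) (p : P.Point) {γ : Δ} (h : p.1 ≤ γ) : P.Point := ⟨γ, P.proj h p.2⟩

/-- `z^δ_i`, as an element of the union, where `z ∈ S δ`. -/
noncomputable def pert (P : ProjSystem N) (p : P.Point) (i : Label (N p.1)) : P.Point :=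
  ⟨p.1, p.2.1.perturb i, P.perturb_mem _ _ p.2.2 i⟩

/-- First condition on the elements of the wreath product: `g` maps each `S δ` to itself and
commutes with the projections. -/
def PreservesProj (P : ProjSystem N) (g : Equiv.Perm P.Point) : Prop :=
  (∀ p, (g p).1 = p.1) ∧
    ∀ (p : P.Point) (γ : Δ) (h : p.1 ≤ γ) (h' : (g p).1 ≤ γ), g (P.up p h) = P.up (g p) h'

/-- Second condition on the elements of the wreath product: for `z ∈ S δ` the map
`i ↦ g(z^δ_i)(δ)` is a permutation of `N δ` that belongs to `H δ`. (The hypothesis `h` only serves to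
form the value at `δ`; it holds for all `g` that map each `S δ` to itself.) -/
def ActsThrough (P : ProjSystem N) (H : (δ : Δ) → Subgroup (Equiv.Perm (Label (N δ))))
    (g : Equiv.Perm P.Point) : Prop :=
  ∀ p : P.Point, ∃ σ ∈ H p.1, ∀ (i : Label (N p.1)) (h : (g (P.pert p i)).1 ≤ p.1),
    (g (P.pert p i)).2.1 ⟨p.1, h⟩ = σ i

theorem point_ext (P : ProjSystem N) {δ : Δ} {z w : P.S δ} (h₀ : z.1 ⟨δ, le_rfl⟩ = w.1 ⟨δ, le_rfl⟩)
    (h : ∀ γ, ∀ h : δ < γ, z.1.restrict h.le = w.1.restrict h.le) : z = w := by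
  apply Subtype.ext
  funext γ
  obtain ⟨γ, hγ⟩ := γ
  rcases (show δ ≤ γ from hγ).eq_or_lt with rfl | hlt
  · exact h₀
  · exact congrFun (h γ hlt) ⟨γ, le_rfl⟩

open Classical in
theorem pert_restrict {δ γ : Δ} (z : LocSeq N δ) (i : Label (N δ)) (h : δ < γ) :
    (z.perturb i).restrict h.le = z.restrict h.le := by
  funext β
  refine Function.update_of_ne ?_ _ _
  intro hb
  have hb' : β.1 = δ := congrArg Subtype.val hb
  exact absurd (h.trans_le β.2) (by rw [hb']; exact lt_irrefl _)

open Classical in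
theorem pert_self {δ : Δ} (z : LocSeq N δ) (i : Label (N δ)) :
    z.perturb i ⟨δ, le_rfl⟩ = i := Function.update_self ..

theorem exists_map_eq (P : ProjSystem N) {g : Equiv.Perm P.Point} (hg : P.PreservesProj g)
    {δ : Δ} (z : P.S δ) : ∃ w : P.S δ, g ⟨δ, z⟩ = ⟨δ, w⟩ := by
  have h := hg.1 ⟨δ, z⟩
  rcases hq : g ⟨δ, z⟩ with ⟨ε, v⟩
  rw [hq] at h
  obtain rfl : ε = δ := h
  exact ⟨v, rfl⟩

theorem PreservesProj.mul {P : ProjSystem N} {g k : Equiv.Perm P.Point} (hg : P.PreservesProj g)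
    (hk : P.PreservesProj k) : P.PreservesProj (g * k) := by
  refine ⟨fun p => (hg.1 (k p)).trans (hk.1 p), fun p γ h h' => ?_⟩
  have h₁ : (k p).1 ≤ γ := (hk.1 p).trans_le h
  rw [Equiv.Perm.mul_apply, hk.2 p γ h h₁]
  exact hg.2 (k p) γ h₁ h'

theorem PreservesProj.inv {P : ProjSystem N} {g : Equiv.Perm P.Point} (hg : P.PreservesProj g) :
    P.PreservesProj g⁻¹ := by
  constructor
  · intro p
    obtain ⟨q, rfl⟩ := g.surjective p
    simpa using (hg.1 q).symm
  · intro p γ h h'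
    obtain ⟨q, rfl⟩ := g.surjective p
    have hq : q.1 ≤ γ := (hg.1 q).symm.trans_le h
    rw [← hg.2 q γ hq h]
    simp

/-- An element of the wreath product sends `z^δ_i` to `g(z)^δ_j`, where `j` is its value at `δ`. -/
theorem map_pert (P : ProjSystem N) {g : Equiv.Perm P.Point} (hg : P.PreservesProj g)
    {δ : Δ} {z w : P.S δ} (hzw : g ⟨δ, z⟩ = ⟨δ, w⟩) (i j : Label (N δ))
    (hj : ∀ h : (g (P.pert ⟨δ, z⟩ i)).1 ≤ δ, (g (P.pert ⟨δ, z⟩ i)).2.1 ⟨δ, h⟩ = j) :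
    g (P.pert ⟨δ, z⟩ i) = P.pert ⟨δ, w⟩ j := by
  obtain ⟨v, hv⟩ := P.exists_map_eq hg (P.pert ⟨δ, z⟩ i).2
  change g (P.pert ⟨δ, z⟩ i) = ⟨δ, v⟩ at hv
  rw [hv] at hj ⊢
  have hj' := hj le_rfl
  have : v = ⟨w.1.perturb j, P.perturb_mem _ _ w.2 j⟩ := by
    refine P.point_ext (hj'.trans (pert_self w.1 j).symm) fun γ h => ?_
    have e₁ := hg.2 (P.pert ⟨δ, z⟩ i) γ h.le (by rw [hv]; exact h.le)
    have e₂ := hg.2 ⟨δ, z⟩ γ h.le (by rw [hzw]; exact h.le)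
    have e₃ : P.up (P.pert ⟨δ, z⟩ i) (γ := γ) h.le = P.up ⟨δ, z⟩ (γ := γ) h.le :=
      congrArg (Sigma.mk γ) ((P.proj_eq_iff h.le _ _).2 (pert_restrict z.1 i h))
    have e₄ : P.proj h.le v = P.proj h.le w := by
      have e₅ : P.up ⟨δ, v⟩ (γ := γ) h.le = P.up ⟨δ, w⟩ (γ := γ) h.le := by
        rw [e₃, e₂] at e₁
        simp only [hv, hzw] at e₁
        exact e₁.symm
      exact eq_of_heq (Sigma.mk.inj e₅).2
    rw [(P.proj_eq_iff h.le v w).1 e₄]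
    exact (pert_restrict w.1 j h).symm
  rw [this]
  rfl

/-- The projective wreath product of the permutation groups `H δ`, with the topology inherited from
the symmetric group of the union of all `S δ`. -/
def wr (P : ProjSystem N) (H : (δ : Δ) → Subgroup (Equiv.Perm (Label (N δ)))) :
    Subgroup (Equiv.Perm P.Point) where
  carrier := {g | P.PreservesProj g ∧ P.ActsThrough H g}
  mul_mem' := by
    rintro g k ⟨hg, hg'⟩ ⟨hk, hk'⟩
    refine ⟨hg.mul hk, ?_⟩
    rintro ⟨δ, z⟩
    obtain ⟨w, hw⟩ := P.exists_map_eq hk z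
    obtain ⟨σ, hσ, hσ'⟩ := hk' ⟨δ, z⟩
    obtain ⟨τ, hτ, hτ'⟩ := hg' ⟨δ, w⟩
    refine ⟨τ * σ, mul_mem hτ hσ, fun i => ?_⟩
    rw [Equiv.Perm.mul_apply, P.map_pert hk hw i (σ i) (hσ' i)]
    exact hτ' (σ i)
  one_mem' :=
    ⟨⟨fun _ => rfl, fun _ _ _ _ => rfl⟩,
      fun p => ⟨1, one_mem _, fun i _ => pert_self p.2.1 i⟩⟩
  inv_mem' := by
    rintro g ⟨hg, hg'⟩
    refine ⟨hg.inv, ?_⟩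
    rintro ⟨δ, z⟩
    obtain ⟨w, hw⟩ := P.exists_map_eq hg.inv z
    obtain ⟨σ, hσ, hσ'⟩ := hg' ⟨δ, w⟩
    have hw' : g ⟨δ, w⟩ = ⟨δ, z⟩ := by rw [← hw]; simp
    refine ⟨σ⁻¹, inv_mem hσ, fun i => ?_⟩
    have e := P.map_pert hg hw' (σ⁻¹ i) (σ (σ⁻¹ i)) (hσ' (σ⁻¹ i))
    have e' : g⁻¹ (P.pert ⟨δ, z⟩ i) = P.pert ⟨δ, w⟩ (σ⁻¹ i) := by
      rw [Equiv.Perm.inv_eq_iff_eq, e]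
      simp
    rw [e']
    exact fun _ => pert_self w.1 (σ⁻¹ i)

/-- The projective wreath product of the full symmetric groups `Sym(N δ)`. -/
abbrev wrSym (P : ProjSystem N) : Subgroup (Equiv.Perm P.Point) := P.wr fun _ => ⊤

/-- The projective wreath product of the groups `Sym(N δ)` acts transitively on each `S δ`. -/
def IsLocallyHomogeneous (P : ProjSystem N) : Prop :=
  ∀ (δ : Δ) (z w : P.S δ), ∃ g ∈ P.wrSym, g ⟨δ, z⟩ = ⟨δ, w⟩

/-- Every cone `{γ | γ ≥ δ}` can be partitioned into finitely many convex sets on each of which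
all projections are restrictions. -/
def HasFiniteCharacter (P : ProjSystem N) : Prop :=
  ∀ δ : Δ, ∃ (n : ℕ) (C : Fin n → Set Δ),
    (⋃ k, C k) = Set.Ici δ ∧ Pairwise (Function.onFun Disjoint C) ∧
      ∀ k, (C k).OrdConnected ∧
        ∀ γ ∈ C k, ∀ β ∈ C k, ∀ (h : γ ≤ β) (z : P.S γ), (P.proj h z).1 = z.1.restrict h

end ProjSystem

/-! ## Generalized wreath products over local domains -/

/-- A family of local domains over `⟨Δ, N⟩`. -/
structure LocalDomains {Δ : Type*} [PartialOrder Δ] (N : Δ → ℕ∞) where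
  S : (δ : Δ) → Set (LocSeq N δ)
  nonempty : ∀ δ, (S δ).Nonempty
  restrict_image : ∀ {δ γ : Δ} (h : δ ≤ γ), S γ = LocSeq.restrict h '' S δ
  perturb_mem : ∀ (δ : Δ) (z : LocSeq N δ), z ∈ S δ → ∀ i : Label (N δ), z.perturb i ∈ S δ

namespace LocalDomains

variable {Δ : Type*} [PartialOrder Δ] {N : Δ → ℕ∞}

/-- A family of local domains together with the trivial projections (restrictions). -/
def toProjSystem (D : LocalDomains N) : ProjSystem N where
  S := D.S
  nonempty := D.nonempty
  perturb_mem := D.perturb_mem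
  proj h z := ⟨z.1.restrict h, by rw [D.restrict_image h]; exact ⟨z.1, z.2, rfl⟩⟩
  proj_surjective h w := by
    obtain ⟨w, hw⟩ := w
    have hw' := hw
    rw [D.restrict_image h] at hw'
    obtain ⟨z, hz, rfl⟩ := hw'
    exact ⟨⟨z, hz⟩, rfl⟩
  proj_eq_iff h z w := Subtype.ext_iff
  proj_comp h₁ h₂ z := rfl

/-- The generalized wreath product over a family of local domains: all permutations `g` of the union
of the `S δ` that map each `S δ` to itself, satisfy `g(z|_γ) = g(z)|_γ`, and act through `H δ` on
the coordinate `δ`. -/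
abbrev wr (D : LocalDomains N) (H : (δ : Δ) → Subgroup (Equiv.Perm (Label (N δ)))) :
    Subgroup (Equiv.Perm D.toProjSystem.Point) := D.toProjSystem.wr H

/-- The generalized wreath product of the full symmetric groups `Sym(N δ)`. -/
abbrev wrSym (D : LocalDomains N) : Subgroup (Equiv.Perm D.toProjSystem.Point) :=
  D.wr fun _ => ⊤

end LocalDomains


/-!
Uniformly discrete spaces: a tree is turned into a metric space by hanging infinitely many leaves
on each node and by measuring how high up the branches of two leaves merge; the permutations of the
leaves that preserve these distances are those induced by automorphisms of the tree. Only the order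
of the distances matters, so that countably many of them fit into the interval `(1, 2)`. A
projective wreath product acts on the union of the `S δ`, ordered by the projections, which is such
a tree except that points may lack a common upper bound; colours of the nodes record the index `δ`
of a point, which the tree need not determine.

Perfect spaces: in a uniformly discrete space, replace each point by a small copy of the Cantor
space with an ultrametric whose only isometry is the identity.

Trees: the open balls of a Polish ultrametric space with radii in a countable set `C` form a tree.
If `C` contains all distances between points and between orbits, then the tree and its condensed
tree are `L`-trees; by completeness, the automorphisms of the tree come from isometries.

Wreath products: label each node of a special tree `𝒯` among its siblings, the nodes of its orbit
with the same strict upper bounds. A node is determined within its orbit `δ` by the labels of the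
nodes above it, a sequence on the cone above `δ` in `Δ(𝒯)`, and all sequences of labels that are
changed in one place occur. Hence `Aut(𝒯)` is a wreath product over `Δ(𝒯)`. A back and forth
argument identifies each orbit with the set of all finitely supported sequences, at the cost of
projections that are no longer restrictions. Finite character is achieved by letting nodes inherit
their sequence from a node below, whose orbit has the least index in an enumeration of `Δ(𝒯)`.
-/
/-! ## Permutation groups and isometry groups as topological groups -/

theorem continuous_perm_subgroup_iff {X Z : Type*} [TopologicalSpace Z]
    {H : Subgroup (Equiv.Perm X)} {φ : Z → H} :
    Continuous φ ↔ ∀ x y, IsOpen {z | (φ z : Equiv.Perm X) x = y} := by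
  let _ : TopologicalSpace X := ⊥
  have : DiscreteTopology X := ⟨rfl⟩
  rw [continuous_induced_rng, continuous_induced_rng, continuous_pi_iff]
  exact forall_congr' fun x => continuous_discrete_rng

theorem isOpen_setOf_perm_apply_eq {X : Type*} (H : Subgroup (Equiv.Perm X)) (x y : X) :
    IsOpen {f : H | (f : Equiv.Perm X) x = y} :=
  continuous_perm_subgroup_iff.1 (continuous_id (X := H)) x y

theorem isOpen_setOf_isometryEquiv_apply_mem {U : Type*} [MetricSpace U] (x : U) {B : Set U}
    (hB : IsOpen B) : IsOpen {f : U ≃ᵢ U | f x ∈ B} :=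
  hB.preimage ((continuous_apply x).comp continuous_induced_dom)

theorem continuous_isometryEquiv_iff_of_discrete {U Z : Type*} [MetricSpace U] [DiscreteTopology U]
    [TopologicalSpace Z] {φ : Z → U ≃ᵢ U} : Continuous φ ↔ ∀ x y, IsOpen {z | φ z x = y} := by
  rw [continuous_induced_rng, continuous_pi_iff]
  exact forall_congr' fun x => continuous_discrete_rng

theorem nonempty_continuousMulEquiv_of_permCongr {X Y : Type*} {H : Subgroup (Equiv.Perm X)}
    {K : Subgroup (Equiv.Perm Y)} (e : X ≃ Y) (h : ∀ f, e.permCongr f ∈ K ↔ f ∈ H) :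
    Nonempty (H ≃ₜ* K) := by
  have hsymm (g : Equiv.Perm Y) (hg : g ∈ K) : e.symm.permCongr g ∈ H :=
    (h _).1 (by rwa [← Equiv.permCongr_symm, Equiv.apply_symm_apply])
  refine ⟨{ toFun := fun f => ⟨e.permCongr f, (h f).2 f.2⟩
            invFun := fun g => ⟨e.symm.permCongr g, hsymm g g.2⟩
            left_inv := fun f => by ext; simp
            right_inv := fun f => by ext; simp
            map_mul' := fun f g => by ext; simp
            continuous_toFun := continuous_perm_subgroup_iff.2 fun x y => ?_
            continuous_invFun := continuous_perm_subgroup_iff.2 fun x y => ?_ }⟩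
  · convert isOpen_setOf_perm_apply_eq H (e.symm x) (e.symm y) using 3
    simp [Equiv.eq_symm_apply]
  · convert isOpen_setOf_perm_apply_eq K (e x) (e y) using 3
    simp [Equiv.symm_apply_eq]

theorem isUniformlyDiscrete_iff_exists_pairwise_le_dist {U : Type*} [MetricSpace U] :
    IsUniformlyDiscrete U ↔ ∃ r : ℝ, 0 < r ∧ Pairwise fun x y : U => r ≤ dist x y := by
  refine exists_congr fun r => and_congr_right fun hr => ⟨fun h x y hxy => ?_, fun h x => ?_⟩
  · by_contra! hlt
    exact hxy ((h y).subset hlt)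
  · refine Set.Subset.antisymm (fun y hy => ?_) (by simpa using hr)
    by_contra! hne
    exact (h hne).not_gt hy
/-! ## Agreement scales -/

/-- A scale of agreement relations between the points of `U`, indexed by levels `g : Γ`: agreement
at a level implies agreement at all higher ones, and two different points have a greatest level of
disagreement. A scale is an ultrametric stripped of the numerical values of its distances. -/
structure AgreementScale (Γ U : Type*) [LinearOrder Γ] where
  agree : Γ → Setoid U
  monotone_agree : Monotone agree
  exists_isGreatest_disagree : ∀ p q, p ≠ q → ∃ g, IsGreatest {g | ¬ agree g p q} g

namespace AgreementScale

variable {Γ U : Type*} [LinearOrder Γ] (A : AgreementScale Γ U)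

/-- The automorphism group of a scale: all permutations of the points that preserve agreement at
every level. -/
def aut : Subgroup (Equiv.Perm U) where
  carrier := {f | ∀ g p q, A.agree g (f p) (f q) ↔ A.agree g p q}
  mul_mem' hf hg _ _ _ := (hf _ _ _).trans (hg _ _ _)
  one_mem' _ _ _ := Iff.rfl
  inv_mem' {f} hf g p q := by simpa using (hf g (f⁻¹ p) (f⁻¹ q)).symm

open Classical in
/-- The ultrametric of a scale whose levels have been assigned real values by `e`. -/
noncomputable def dist (e : Γ → ℝ) (p q : U) : ℝ :=
  if h : p = q then 0 else e (A.exists_isGreatest_disagree p q h).choose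

variable {A} {e : Γ → ℝ}

theorem dist_self (p : U) : A.dist e p p = 0 := dif_pos rfl

theorem exists_dist_eq {p q : U} (h : p ≠ q) :
    ∃ g, IsGreatest {g | ¬ A.agree g p q} g ∧ A.dist e p q = e g :=
  ⟨_, (A.exists_isGreatest_disagree p q h).choose_spec, dif_neg h⟩

theorem dist_lt_iff_agree (he : StrictMono e) (hpos : ∀ g, 0 < e g) {g : Γ} {p q : U} :
    A.dist e p q < e g ↔ A.agree g p q := by
  rcases eq_or_ne p q with rfl | hpq
  · exact iff_of_true ((dist_self p).trans_lt (hpos g)) ((A.agree g).refl p)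
  obtain ⟨m, hm, hd⟩ := exists_dist_eq (A := A) (e := e) hpq
  rw [hd, he.lt_iff_lt]
  refine ⟨fun hlt => ?_, fun hg => lt_of_not_ge fun hle => hm.1 (A.monotone_agree hle hg)⟩
  by_contra hg
  exact (hm.2 hg).not_gt hlt

theorem dist_le_iff (he : StrictMono e) (hpos : ∀ g, 0 < e g) {p q p' q' : U} :
    A.dist e p q ≤ A.dist e p' q' ↔ ∀ g, A.agree g p' q' → A.agree g p q := by
  simp only [← dist_lt_iff_agree he hpos]
  refine ⟨fun h g => h.trans_lt, fun h => ?_⟩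
  rcases eq_or_ne p q with rfl | hpq
  · rw [dist_self]
    rcases eq_or_ne p' q' with rfl | hpq'
    · rw [dist_self]
    · obtain ⟨g, -, hd⟩ := exists_dist_eq (A := A) (e := e) hpq'
      exact hd ▸ (hpos g).le
  · obtain ⟨g, -, hd⟩ := exists_dist_eq (A := A) (e := e) hpq
    exact le_of_not_gt fun hlt => (h g (hd ▸ hlt)).ne hd

theorem dist_comm (he : StrictMono e) (hpos : ∀ g, 0 < e g) (p q : U) :
    A.dist e p q = A.dist e q p :=
  le_antisymm ((dist_le_iff he hpos).2 fun g => (A.agree g).symm)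
    ((dist_le_iff he hpos).2 fun g => (A.agree g).symm)

theorem dist_triangle_max (he : StrictMono e) (hpos : ∀ g, 0 < e g) (p q r : U) :
    A.dist e p r ≤ max (A.dist e p q) (A.dist e q r) := by
  rcases le_total (A.dist e p q) (A.dist e q r) with h | h
  · exact le_max_of_le_right ((dist_le_iff he hpos).2 fun g hg =>
      (A.agree g).trans ((dist_le_iff he hpos).1 h g hg) hg)
  · exact le_max_of_le_left ((dist_le_iff he hpos).2 fun g hg =>
      (A.agree g).trans hg ((dist_le_iff he hpos).1 h g hg))

theorem dist_pos (hpos : ∀ g, 0 < e g) {p q : U} (h : p ≠ q) : 0 < A.dist e p q := by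
  obtain ⟨g, -, hd⟩ := exists_dist_eq (A := A) (e := e) h
  exact hd ▸ hpos g

variable (A)

/-- The metric space on the points of a scale given by real values of the levels. -/
@[reducible]
noncomputable def metricSpace (he : StrictMono e) (hpos : ∀ g, 0 < e g) : MetricSpace U where
  dist := A.dist e
  dist_self := dist_self
  dist_comm := dist_comm he hpos
  dist_triangle p q r := by
    have hnonneg (p q : U) : 0 ≤ A.dist e p q := by
      rcases eq_or_ne p q with rfl | h
      exacts [(dist_self p).ge, (dist_pos hpos h).le]
    exact (dist_triangle_max he hpos p q r).trans
      (max_le_add_of_nonneg (hnonneg p q) (hnonneg q r))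
  eq_of_dist_eq_zero h := by
    by_contra hne
    exact (dist_pos hpos hne).ne' h

theorem nonempty_continuousMulEquiv_isometryEquiv [MetricSpace U] [DiscreteTopology U]
    (hdist : ∀ p q p' q' : U,
      Dist.dist p q = Dist.dist p' q' ↔ ∀ g, A.agree g p q ↔ A.agree g p' q') :
    Nonempty (A.aut ≃ₜ* (U ≃ᵢ U)) := by
  refine ⟨{ toFun := fun f =>
              ⟨f.1, Isometry.of_dist_eq fun p q => (hdist _ _ _ _).2 fun g => f.2 g p q⟩
            invFun := fun f => ⟨f.toEquiv, fun g p q => (hdist _ _ _ _).1 (f.dist_eq p q) g⟩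
            left_inv := fun f => rfl
            right_inv := fun f => rfl
            map_mul' := fun f g => rfl
            continuous_toFun := continuous_isometryEquiv_iff_of_discrete.2 fun x y =>
              isOpen_setOf_perm_apply_eq A.aut x y
            continuous_invFun := continuous_perm_subgroup_iff.2 fun x y =>
              isOpen_setOf_isometryEquiv_apply_mem x (isOpen_discrete {y}) }⟩

/-- Level values in the interval `(1, 2)` keep all nonzero distances above `1`. -/
theorem exists_uniformlyDiscrete_metricSpace [Countable Γ] [Countable U] [Nonempty U] :
    ∃ _ : MetricSpace U, IsPolishUltrametric U ∧ IsUniformlyDiscrete U ∧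
      Nonempty (A.aut ≃ₜ* (U ≃ᵢ U)) := by
  have : Nontrivial (Set.Ioo (1 : ℝ) 2) :=
    (Set.Ioo_infinite one_lt_two).nontrivial.coe_sort
  obtain ⟨e⟩ := Order.embedding_from_countable_to_dense Γ (Set.Ioo (1 : ℝ) 2)
  have he : StrictMono fun g => (e g : ℝ) := fun _ _ h => e.strictMono h
  have hpos (g : Γ) : (0 : ℝ) < e g := one_pos.trans (e g).2.1
  let _ : MetricSpace U := A.metricSpace he hpos
  have hgap : Pairwise fun p q : U => 1 ≤ Dist.dist p q := fun p q hpq => by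
    obtain ⟨g, -, hd⟩ := exists_dist_eq (A := A) (e := fun g => (e g : ℝ)) hpq
    exact (e g).2.1.le.trans_eq hd.symm
  have : DiscreteUniformity U :=
    (discreteUniformity_iff_eq_bot U).2 (Metric.uniformSpace_eq_bot.2 ⟨1, one_pos, hgap⟩)
  refine ⟨inferInstance, ⟨inferInstance, ⟨dist_triangle_max he hpos⟩, inferInstance, inferInstance⟩,
    isUniformlyDiscrete_iff_exists_pairwise_le_dist.2 ⟨1, one_pos, hgap⟩,
    A.nonempty_continuousMulEquiv_isometryEquiv fun p q p' q' => ?_⟩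
  rw [le_antisymm_iff]
  refine (and_congr (dist_le_iff he hpos) (dist_le_iff he hpos)).trans ?_
  exact ⟨fun h g => ⟨h.2 g, h.1 g⟩, fun h => ⟨fun g => (h g).2, fun g => (h g).1⟩⟩

end AgreementScale

/-! ## Coloured forests as agreement scales -/

/-- A relation levelled by `L` in which every node has a unique upper bound on each higher level and
any two incomparable nodes have a greatest level of disagreement. These are the `L`-trees, except
that nodes without a common upper bound are allowed; antisymmetry follows from the uniqueness. -/
structure LevelledForest (L T : Type*) [LinearOrder L] where
  rel : T → T → Prop
  lam : T → L
  rel_refl : ∀ t, rel t t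
  rel_trans : ∀ t u v, rel t u → rel u v → rel t v
  lam_mono : ∀ t u, rel t u → lam t ≤ lam u
  existsUnique_above : ∀ t ℓ, lam t ≤ ℓ → ∃! s, rel t s ∧ lam s = ℓ
  exists_isGreatest_disagree : ∀ t u, ¬ rel t u → ¬ rel u t →
    ∃ m, IsGreatest {ℓ | lam t ≤ ℓ ∧ lam u ≤ ℓ ∧ ¬ ∃ s, rel t s ∧ rel u s ∧ lam s = ℓ} m

namespace LevelledForest

open OrderDual (toDual)

universe u

variable {L : Type*} {T : Type u} [LinearOrder L] (F : LevelledForest L T) (κ : T → ℕ)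

/-- The group of the automorphisms that preserve the levels and the colouring `κ`. -/
def colouredAut : Subgroup (Equiv.Perm T) where
  carrier := {f | (∀ t, F.lam (f t) = F.lam t ∧ κ (f t) = κ t) ∧
    ∀ t u, F.rel t u ↔ F.rel (f t) (f u)}
  mul_mem' := by
    rintro f g ⟨hf, hf'⟩ ⟨hg, hg'⟩
    exact ⟨fun t => ⟨(hf _).1.trans (hg _).1, (hf _).2.trans (hg _).2⟩,
      fun t u => (hg' _ _).trans (hf' _ _)⟩
  one_mem' := ⟨fun _ => ⟨rfl, rfl⟩, fun _ _ => Iff.rfl⟩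
  inv_mem' := by
    rintro f ⟨hf, hf'⟩
    exact ⟨fun t => ⟨by simpa using (hf (f⁻¹ t)).1.symm, by simpa using (hf (f⁻¹ t)).2.symm⟩,
      fun t u => by simpa using (hf' (f⁻¹ t) (f⁻¹ u)).symm⟩

/-- Each level `ℓ` is split into sublevels `(ℓ, 0) > (ℓ, 1) > …`, and infinitely many leaves
`(t, n)` are hung on each node `t`; the leaf `(t, n)` joins the forest at the sublevel that encodes
`n` and the colour of `t`. -/
def leafLevel (p : T × ℕ) : L ×ₗ ℕᵒᵈ := toLex (F.lam p.1, toDual (Nat.pair (κ p.1) p.2))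

/-- At the sublevel `g`, the leaf `p` has joined the forest and lies below the node `s`. -/
def Joins (g : L ×ₗ ℕᵒᵈ) (p : T × ℕ) (s : T) : Prop :=
  F.rel p.1 s ∧ F.lam s = (ofLex g).1 ∧ F.leafLevel κ p ≤ g

variable {F κ}

theorem eq_of_rel_of_lam_eq {t u : T} (h : F.rel t u) (hl : F.lam u = F.lam t) : u = t :=
  (F.existsUnique_above t (F.lam t) le_rfl).unique ⟨h, hl⟩ ⟨F.rel_refl t, rfl⟩

theorem leafLevel_le_of_lam_lt {p : T × ℕ} {g : L ×ₗ ℕᵒᵈ} (h : F.lam p.1 < (ofLex g).1) :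
    F.leafLevel κ p ≤ g :=
  Prod.Lex.le_iff.2 (Or.inl h)

theorem leafLevel_le_toLex_zero {p : T × ℕ} {ℓ : L} (h : F.lam p.1 ≤ ℓ) :
    F.leafLevel κ p ≤ toLex (ℓ, toDual 0) := by
  rw [leafLevel, Prod.Lex.toLex_le_toLex']
  exact ⟨h, fun _ => OrderDual.toDual_le_toDual.2 (Nat.zero_le _)⟩

theorem exists_joins {g : L ×ₗ ℕᵒᵈ} {p : T × ℕ} (h : F.leafLevel κ p ≤ g) :
    ∃ s, F.Joins κ g p s := by
  obtain ⟨s, ⟨hs, hl⟩, -⟩ := F.existsUnique_above p.1 _ (Prod.Lex.monotone_fst _ _ h)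
  exact ⟨s, hs, hl, h⟩

theorem Joins.unique {g : L ×ₗ ℕᵒᵈ} {p : T × ℕ} {s s' : T} (h : F.Joins κ g p s)
    (h' : F.Joins κ g p s') : s = s' :=
  (F.existsUnique_above p.1 _ (h.2.1 ▸ F.lam_mono _ _ h.1)).unique ⟨h.1, h.2.1⟩ ⟨h'.1, h'.2.1⟩

theorem exists_joins_of_le {g g' : L ×ₗ ℕᵒᵈ} (hg : g ≤ g') {s : T} (hs : F.lam s = (ofLex g).1) :
    ∃ s', ∀ p, F.Joins κ g p s → F.Joins κ g' p s' := by
  obtain ⟨s', ⟨hss', hs'⟩, -⟩ :=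
    F.existsUnique_above s _ (hs.trans_le (Prod.Lex.monotone_fst _ _ hg))
  exact ⟨s', fun p h => ⟨F.rel_trans _ _ _ h.1 hss', hs', h.2.2.trans hg⟩⟩

variable (F κ) in
/-- Leaves agree at a sublevel if they are equal or have both joined the forest below the same
node. -/
def leafAgree (g : L ×ₗ ℕᵒᵈ) : Setoid (T × ℕ) where
  r p q := p = q ∨ ∃ s, F.Joins κ g p s ∧ F.Joins κ g q s
  iseqv :=
    { refl := fun _ => Or.inl rfl
      symm := fun h => h.imp Eq.symm fun ⟨s, hp, hq⟩ => ⟨s, hq, hp⟩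
      trans := by
        rintro p q r (rfl | ⟨s, hp, hq⟩) (rfl | ⟨s', hq', hr⟩)
        · exact Or.inl rfl
        · exact Or.inr ⟨s', hq', hr⟩
        · exact Or.inr ⟨s, hp, hq⟩
        · obtain rfl := hq.unique hq'
          exact Or.inr ⟨s, hp, hr⟩ }

theorem leafAgree_iff {g : L ×ₗ ℕᵒᵈ} {p q : T × ℕ} :
    F.leafAgree κ g p q ↔ p = q ∨ ∃ s, F.Joins κ g p s ∧ F.Joins κ g q s :=
  Iff.rfl

theorem monotone_leafAgree : Monotone (F.leafAgree κ) := by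
  rintro g g' hg p q (rfl | ⟨s, hp, hq⟩)
  · exact Or.inl rfl
  · obtain ⟨s', hs'⟩ := exists_joins_of_le (κ := κ) hg hp.2.1
    exact Or.inr ⟨s', hs' p hp, hs' q hq⟩

theorem leafAgree_iff_of_rel {g : L ×ₗ ℕᵒᵈ} {p q : T × ℕ} (hpq : p ≠ q) (h : F.rel p.1 q.1) :
    F.leafAgree κ g p q ↔ max (F.leafLevel κ p) (F.leafLevel κ q) ≤ g := by
  rw [leafAgree_iff, or_iff_right hpq, max_le_iff]
  refine ⟨fun ⟨s, hp, hq⟩ => ⟨hp.2.2, hq.2.2⟩, fun ⟨hp, hq⟩ => ?_⟩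
  obtain ⟨s, hs⟩ := exists_joins hq
  exact ⟨s, ⟨F.rel_trans _ _ _ h hs.1, hs.2.1, hp⟩, hs⟩

theorem isGreatest_Iio_leafLevel (p : T × ℕ) :
    IsGreatest (Set.Iio (F.leafLevel κ p))
      (toLex (F.lam p.1, toDual (Nat.pair (κ p.1) p.2 + 1))) := by
  constructor
  · exact Prod.Lex.toLex_lt_toLex.2
      (Or.inr ⟨rfl, OrderDual.toDual_lt_toDual.2 (Nat.lt_succ_self _)⟩)
  · intro g hg
    rcases Prod.Lex.lt_iff.1 hg with h | ⟨h, h'⟩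
    · exact Prod.Lex.le_iff.2 (Or.inl h)
    · exact Prod.Lex.le_iff.2 (Or.inr ⟨h, Nat.succ_le_of_lt h'⟩)

theorem exists_isGreatest_not_leafAgree_of_rel {p q : T × ℕ} (hpq : p ≠ q) (h : F.rel p.1 q.1) :
    ∃ g, IsGreatest {g | ¬ F.leafAgree κ g p q} g := by
  have hset : {g | ¬ F.leafAgree κ g p q} = Set.Iio (max (F.leafLevel κ p) (F.leafLevel κ q)) :=
    Set.ext fun g => (not_congr (leafAgree_iff_of_rel hpq h)).trans not_le
  rw [hset]
  rcases max_choice (F.leafLevel κ p) (F.leafLevel κ q) with hmax | hmax <;> rw [hmax]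
  exacts [⟨_, isGreatest_Iio_leafLevel p⟩, ⟨_, isGreatest_Iio_leafLevel q⟩]

theorem exists_isGreatest_not_leafAgree_of_not_rel {p q : T × ℕ} (hpq : ¬ F.rel p.1 q.1)
    (hqp : ¬ F.rel q.1 p.1) : ∃ g, IsGreatest {g | ¬ F.leafAgree κ g p q} g := by
  obtain ⟨m, ⟨hpm, hqm, hm⟩, hmax⟩ := F.exists_isGreatest_disagree _ _ hpq hqp
  refine ⟨toLex (m, toDual 0), ?_, fun g hg => le_of_not_gt fun hlt => hg ?_⟩
  · rintro (rfl | ⟨s, hp, hq⟩)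
    · exact hpq (F.rel_refl _)
    · exact hm ⟨s, hp.1, hq.1, hp.2.1⟩
  · have hmg : m < (ofLex g).1 :=
      (Prod.Lex.lt_iff.1 hlt).resolve_right fun h => Nat.not_lt_zero _ h.2
    obtain ⟨s, hps, hqs, hs⟩ : ∃ s, F.rel p.1 s ∧ F.rel q.1 s ∧ F.lam s = (ofLex g).1 := by
      by_contra hne
      exact (hmax ⟨hpm.trans hmg.le, hqm.trans hmg.le, hne⟩).not_gt hmg
    exact Or.inr ⟨s, ⟨hps, hs, leafLevel_le_of_lam_lt (hpm.trans_lt hmg)⟩,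
      hqs, hs, leafLevel_le_of_lam_lt (hqm.trans_lt hmg)⟩

variable (F κ) in
/-- The agreement scale of the leaves of a coloured forest. -/
def leafScale : AgreementScale (L ×ₗ ℕᵒᵈ) (T × ℕ) where
  agree := F.leafAgree κ
  monotone_agree := monotone_leafAgree
  exists_isGreatest_disagree p q hpq := by
    by_cases h : F.rel p.1 q.1
    · exact exists_isGreatest_not_leafAgree_of_rel hpq h
    by_cases h' : F.rel q.1 p.1
    · have hcomm : {g | ¬ F.leafAgree κ g p q} = {g | ¬ F.leafAgree κ g q p} :=
        Set.ext fun g => not_congr ⟨(F.leafAgree κ g).symm, (F.leafAgree κ g).symm⟩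
      exact hcomm ▸ exists_isGreatest_not_leafAgree_of_rel hpq.symm h'
    exact exists_isGreatest_not_leafAgree_of_not_rel h h'

theorem leafLevel_le_iff {g : L ×ₗ ℕᵒᵈ} {p : T × ℕ} :
    F.leafLevel κ p ≤ g ↔ ∃ q ≠ p, F.leafAgree κ g p q := by
  constructor
  · intro h
    obtain ⟨s, hs⟩ := exists_joins h
    obtain ⟨n, hn, hnp⟩ : ∃ n, OrderDual.ofDual (ofLex g).2 ≤ Nat.pair (κ s) n ∧ n ≠ p.2 :=
      ⟨_, (by omega : _ ≤ p.2 + 1 + OrderDual.ofDual (ofLex g).2).trans (Nat.right_le_pair _ _),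
        by omega⟩
    have hle : F.leafLevel κ (s, n) ≤ g := Prod.Lex.le_iff.2 (Or.inr ⟨hs.2.1, hn⟩)
    exact ⟨(s, n), fun h => hnp (congrArg Prod.snd h),
      Or.inr ⟨s, hs, F.rel_refl s, hs.2.1, hle⟩⟩
  · rintro ⟨q, hq, rfl | ⟨s, hs, -⟩⟩
    exacts [absurd rfl hq, hs.2.2]

theorem rel_iff_leafAgree {p q : T × ℕ} :
    F.rel p.1 q.1 ↔ F.leafAgree κ (toLex (F.lam q.1, toDual 0)) p q := by
  constructor
  · intro h
    exact Or.inr ⟨q.1, ⟨h, rfl, leafLevel_le_toLex_zero (F.lam_mono _ _ h)⟩,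
      F.rel_refl _, rfl, leafLevel_le_toLex_zero le_rfl⟩
  · rintro (rfl | ⟨s, hp, hq⟩)
    · exact F.rel_refl _
    · obtain rfl := eq_of_rel_of_lam_eq hq.1 hq.2.1
      exact hp.1

section LeafAut

variable {f : Equiv.Perm (T × ℕ)}

theorem leafLevel_apply (hf : f ∈ (F.leafScale κ).aut) (p : T × ℕ) :
    F.leafLevel κ (f p) = F.leafLevel κ p := by
  refine eq_of_forall_ge_iff fun g => ?_
  rw [leafLevel_le_iff, leafLevel_le_iff, f.surjective.exists]
  exact exists_congr fun q => and_congr f.injective.ne_iff (hf g p q)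

theorem lam_apply (hf : f ∈ (F.leafScale κ).aut) (p : T × ℕ) : F.lam (f p).1 = F.lam p.1 :=
  congrArg (fun g => (ofLex g).1) (leafLevel_apply hf p)

theorem colour_apply_and_snd_apply (hf : f ∈ (F.leafScale κ).aut) (p : T × ℕ) :
    κ (f p).1 = κ p.1 ∧ (f p).2 = p.2 :=
  Nat.pair_eq_pair.1 <|
    congrArg (fun g => OrderDual.ofDual (ofLex g).2) (leafLevel_apply hf p)

theorem rel_apply_iff (hf : f ∈ (F.leafScale κ).aut) (p q : T × ℕ) :
    F.rel (f p).1 (f q).1 ↔ F.rel p.1 q.1 := by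
  rw [rel_iff_leafAgree (κ := κ), rel_iff_leafAgree (κ := κ), lam_apply hf]
  exact hf _ p q

theorem apply_eq (hf : f ∈ (F.leafScale κ).aut) (p : T × ℕ) : f p = ((f (p.1, 0)).1, p.2) := by
  have hrel : F.rel (f (p.1, 0)).1 (f p).1 := (rel_apply_iff hf (p.1, 0) p).2 (F.rel_refl _)
  refine Prod.ext (eq_of_rel_of_lam_eq hrel ?_) (colour_apply_and_snd_apply hf p).2
  rw [lam_apply hf, lam_apply hf]

end LeafAut

theorem joins_map {f : Equiv.Perm T} (hf : f ∈ F.colouredAut κ) {g : L ×ₗ ℕᵒᵈ} {p : T × ℕ} {s : T}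
    (h : F.Joins κ g p s) : F.Joins κ g (f p.1, p.2) (f s) := by
  refine ⟨(hf.2 _ _).1 h.1, (hf.1 s).1.trans h.2.1, ?_⟩
  rw [leafLevel, (hf.1 p.1).1, (hf.1 p.1).2]
  exact h.2.2

theorem leafAgree_map {f : Equiv.Perm T} (hf : f ∈ F.colouredAut κ) {g : L ×ₗ ℕᵒᵈ} {p q : T × ℕ}
    (h : F.leafAgree κ g p q) : F.leafAgree κ g (f p.1, p.2) (f q.1, q.2) := by
  rcases h with rfl | ⟨s, hp, hq⟩
  exacts [Or.inl rfl, Or.inr ⟨f s, joins_map hf hp, joins_map hf hq⟩]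

variable (F κ) in
/-- The action of the coloured automorphisms on the leaves. -/
def leafHom : F.colouredAut κ →* (F.leafScale κ).aut where
  toFun f := ⟨f.1.prodCongr (Equiv.refl ℕ), fun g p q =>
    ⟨fun h => by
      have := leafAgree_map (inv_mem f.2) h
      change F.leafAgree κ g p q
      simpa using this, leafAgree_map f.2⟩⟩
  map_one' := rfl
  map_mul' _ _ := rfl

theorem leafHom_injective : Function.Injective (F.leafHom κ) := fun _ _ h =>
  Subtype.ext <| Equiv.ext fun t =>
    congrArg (fun k : (F.leafScale κ).aut => (k.1 (t, 0)).1) h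

theorem leafHom_surjective : Function.Surjective (F.leafHom κ) := by
  intro h
  refine ⟨⟨{ toFun := fun t => (h.1 (t, 0)).1
             invFun := fun t => (h.1⁻¹ (t, 0)).1
             left_inv := fun t => ?_
             right_inv := fun t => ?_ },
    fun t => ⟨lam_apply h.2 _, (colour_apply_and_snd_apply h.2 _).1⟩,
    fun t u => (rel_apply_iff h.2 (t, 0) (u, 0)).symm⟩, ?_⟩
  · exact congrArg Prod.fst
      ((apply_eq (inv_mem h.2) (h.1 (t, 0))).symm.trans (h.1.symm_apply_apply (t, 0)))
  · exact congrArg Prod.fst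
      ((apply_eq h.2 (h.1⁻¹ (t, 0))).symm.trans (h.1.apply_symm_apply (t, 0)))
  · exact Subtype.ext (Equiv.ext fun p => (apply_eq h.2 p).symm)

variable (F κ)

theorem nonempty_continuousMulEquiv_leafScale_aut :
    Nonempty (F.colouredAut κ ≃ₜ* (F.leafScale κ).aut) := by
  let φ := MulEquiv.ofBijective (F.leafHom κ) ⟨leafHom_injective, leafHom_surjective⟩
  refine ⟨{ φ with
    continuous_toFun := continuous_perm_subgroup_iff.2 fun p q => ?_
    continuous_invFun := continuous_perm_subgroup_iff.2 fun t u => ?_ }⟩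
  · change IsOpen {f : F.colouredAut κ | (f.1 p.1, p.2) = q}
    simp only [Prod.ext_iff, Set.ofPred_and]
    exact (isOpen_setOf_perm_apply_eq _ p.1 q.1).inter isOpen_const
  · convert isOpen_setOf_perm_apply_eq (F.leafScale κ).aut (t, 0) (u, 0) using 1
    ext h
    obtain ⟨f, rfl⟩ := φ.surjective h
    change (φ.symm (φ f)).1 t = u ↔ (f.1 t, 0) = (u, 0)
    rw [φ.symm_apply_apply, Prod.mk_left_inj]

theorem exists_uniformlyDiscrete [Countable L] [Countable T] [Nonempty T] :
    ∃ (U : Type u) (_ : MetricSpace U), IsPolishUltrametric U ∧ IsUniformlyDiscrete U ∧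
      Nonempty (F.colouredAut κ ≃ₜ* (U ≃ᵢ U)) := by
  have : Countable (L ×ₗ ℕᵒᵈ) := inferInstanceAs (Countable (L × ℕ))
  obtain ⟨φ⟩ := F.nonempty_continuousMulEquiv_leafScale_aut κ
  obtain ⟨_, hP, hD, ⟨ψ⟩⟩ := (F.leafScale κ).exists_uniformlyDiscrete_metricSpace
  exact ⟨T × ℕ, _, hP, hD, ⟨φ.trans ψ⟩⟩

end LevelledForest


/-! ## A rigid perfect compact ultrametric -/

/-- The number of the node `x|n` of the binary tree, where the root has number `1` and the children
of the node `k` have the numbers `2k` and `2k + 1`. -/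
def binaryNode (x : ℕ → Bool) : ℕ → ℕ
  | 0 => 1
  | n + 1 => 2 * binaryNode x n + (x n).toNat

theorem binaryNode_congr {x y : ℕ → Bool} {n : ℕ} (h : ∀ i < n, x i = y i) :
    binaryNode x n = binaryNode y n := by
  induction n with
  | zero => rfl
  | succ n ih => rw [binaryNode, binaryNode, ih fun i hi => h i (by omega), h n (by omega)]

theorem lt_binaryNode (x : ℕ → Bool) (n : ℕ) : n < binaryNode x n := by
  induction n with
  | zero => exact one_pos
  | succ n ih => rw [binaryNode]; omega

theorem binaryNode_cast_pos (x : ℕ → Bool) (n : ℕ) : (0 : ℝ) < binaryNode x n :=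
  Nat.cast_pos.2 (Nat.zero_lt_of_lt (lt_binaryNode x n))

theorem monotone_binaryNode (x : ℕ → Bool) : Monotone (binaryNode x) :=
  monotone_nat_of_le_succ fun n => by rw [binaryNode]; omega

theorem eq_of_binaryNode_eq {x y : ℕ → Bool} {n m : ℕ} (h : binaryNode x n = binaryNode y m) :
    n = m ∧ ∀ i < n, x i = y i := by
  induction n generalizing m with
  | zero =>
    cases m with
    | zero => exact ⟨rfl, fun i hi => absurd hi (Nat.not_lt_zero i)⟩
    | succ m =>
      have := lt_binaryNode y m
      simp only [binaryNode] at h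
      omega
  | succ n ih =>
    cases m with
    | zero =>
      have := lt_binaryNode x n
      simp only [binaryNode] at h
      omega
    | succ m =>
      simp only [binaryNode] at h
      have hx := Bool.toNat_le (x n)
      have hy := Bool.toNat_le (y m)
      obtain ⟨rfl, hlt⟩ := ih (m := m) (by omega)
      have hn : x n = y n := (by decide : Function.Injective Bool.toNat) (by omega)
      exact ⟨rfl, fun i hi => (Nat.lt_succ_iff_lt_or_eq.1 hi).elim (hlt i) fun e => e ▸ hn⟩

open Classical in
/-- An ultrametric of diameter `c` on the Cantor space that takes different values at pairs of
points that split at different nodes of the binary tree. -/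
noncomputable def cantorDist (c : ℝ) (x y : ℕ → Bool) : ℝ :=
  if x = y then 0 else c / binaryNode x (PiNat.firstDiff x y)

section CantorDist

variable {c : ℝ} {x y : ℕ → Bool}

theorem cantorDist_self (x : ℕ → Bool) : cantorDist c x x = 0 := if_pos rfl

theorem cantorDist_of_ne (h : x ≠ y) :
    cantorDist c x y = c / binaryNode x (PiNat.firstDiff x y) := if_neg h

theorem cantorDist_comm (x y : ℕ → Bool) : cantorDist c x y = cantorDist c y x := by
  rcases eq_or_ne x y with rfl | h
  · rfl
  · rw [cantorDist_of_ne h, cantorDist_of_ne h.symm, PiNat.firstDiff_comm y x,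
      binaryNode_congr fun i hi => PiNat.apply_eq_of_lt_firstDiff hi]

theorem cantorDist_pos (hc : 0 < c) (h : x ≠ y) : 0 < cantorDist c x y := by
  rw [cantorDist_of_ne h]
  exact div_pos hc (binaryNode_cast_pos _ _)

theorem cantorDist_nonneg (hc : 0 < c) (x y : ℕ → Bool) : 0 ≤ cantorDist c x y := by
  rcases eq_or_ne x y with rfl | h
  exacts [(cantorDist_self x).ge, (cantorDist_pos hc h).le]

theorem cantorDist_le_of_forall_lt_eq (hc : 0 < c) {n : ℕ} (h : ∀ i < n, x i = y i) :
    cantorDist c x y ≤ c / binaryNode x n := by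
  rcases eq_or_ne x y with rfl | hxy
  · rw [cantorDist_self]
    exact (div_pos hc (binaryNode_cast_pos _ _)).le
  · rw [cantorDist_of_ne hxy]
    refine div_le_div_of_nonneg_left hc.le (binaryNode_cast_pos _ _)
      (Nat.cast_le.2 (monotone_binaryNode x ?_))
    by_contra! hlt
    exact PiNat.apply_firstDiff_ne hxy (h _ hlt)

theorem cantorDist_le (hc : 0 < c) (x y : ℕ → Bool) : cantorDist c x y ≤ c := by
  simpa [binaryNode] using
    cantorDist_le_of_forall_lt_eq hc (x := x) (y := y) (n := 0) (by simp)

theorem cantorDist_triangle_max (hc : 0 < c) (x y z : ℕ → Bool) :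
    cantorDist c x z ≤ max (cantorDist c x y) (cantorDist c y z) := by
  rcases eq_or_ne x y with rfl | hxy
  · exact le_max_right _ _
  rcases eq_or_ne y z with rfl | hyz
  · exact le_max_left _ _
  rcases eq_or_ne x z with rfl | hxz
  · exact (cantorDist_self x).trans_le ((cantorDist_nonneg hc _ _).trans (le_max_left _ _))
  rcases min_le_iff.1 (PiNat.min_firstDiff_le x y z hxz) with h | h
  · refine le_max_of_le_left ?_
    rw [cantorDist_of_ne hxy]
    exact cantorDist_le_of_forall_lt_eq hc fun i hi =>
      PiNat.apply_eq_of_lt_firstDiff (hi.trans_le h)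
  · refine le_max_of_le_right ?_
    rw [cantorDist_comm x, cantorDist_comm y, cantorDist_of_ne hyz.symm, PiNat.firstDiff_comm z y]
    exact cantorDist_le_of_forall_lt_eq hc fun i hi =>
      (PiNat.apply_eq_of_lt_firstDiff (hi.trans_le h)).symm

theorem exists_forall_lt_eq_imp_cantorDist_lt (hc : 0 < c) (x : ℕ → Bool) {ε : ℝ} (hε : 0 < ε) :
    ∃ n, ∀ y, (∀ i < n, x i = y i) → cantorDist c x y < ε := by
  obtain ⟨n, hn⟩ := exists_nat_gt (c / ε)
  refine ⟨n, fun y hy => (cantorDist_le_of_forall_lt_eq hc hy).trans_lt ?_⟩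
  rw [div_lt_comm₀ (binaryNode_cast_pos _ _) hε]
  exact hn.trans (Nat.cast_lt.2 (lt_binaryNode x n))

theorem firstDiff_update_not (x : ℕ → Bool) (n : ℕ) :
    PiNat.firstDiff x (Function.update x n (!x n)) = n := by
  have hn : x n ≠ Function.update x n (!x n) n := by simp
  have hne : x ≠ Function.update x n (!x n) := fun h => hn (congrFun h n)
  refine le_antisymm ?_ ?_
  · by_contra! hlt
    exact hn (PiNat.apply_eq_of_lt_firstDiff hlt)
  · by_contra! hlt
    exact PiNat.apply_firstDiff_ne hne (Function.update_of_ne hlt.ne _ _).symm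

/-- The distance from `x` to a point that splits from `x` at the node `x|(n + 1)` determines this
node. -/
theorem eq_of_forall_cantorDist_eq (hc : 0 < c) {φ : (ℕ → Bool) → ℕ → Bool}
    (h : ∀ x y, cantorDist c (φ x) (φ y) = cantorDist c x y) (x : ℕ → Bool) : φ x = x := by
  funext n
  let y := Function.update x (n + 1) (!x (n + 1))
  have hfd : PiNat.firstDiff x y = n + 1 := firstDiff_update_not x (n + 1)
  have hne : x ≠ y := fun e => by simpa [y] using congrFun e (n + 1)
  have hne' : φ x ≠ φ y := fun e => by
    have := h x y
    rw [e, cantorDist_self] at this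
    exact (cantorDist_pos hc hne).ne this
  have hdist := h x y
  rw [cantorDist_of_ne hne, cantorDist_of_ne hne', div_eq_div_iff_comm, div_left_inj' hc.ne',
    Nat.cast_inj, hfd] at hdist
  obtain ⟨hn, heq⟩ := eq_of_binaryNode_eq hdist
  exact heq n (hn ▸ n.lt_succ_self)

end CantorDist

/-- Different points of `V` have distance at least `r > 0`. -/
class IsSeparatedBy (V : Type*) [MetricSpace V] (r : ℝ) : Prop where
  pos : 0 < r
  pairwise_le_dist : Pairwise fun u v : V => r ≤ dist u v

theorem IsUniformlyDiscrete.exists_isSeparatedBy {V : Type*} [MetricSpace V]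
    (hV : IsUniformlyDiscrete V) : ∃ r, IsSeparatedBy V r :=
  (isUniformlyDiscrete_iff_exists_pairwise_le_dist.1 hV).imp fun _ h => ⟨h.1, h.2⟩

theorem IsSeparatedBy.discreteTopology {V : Type*} [MetricSpace V] (r : ℝ) [h : IsSeparatedBy V r] :
    DiscreteTopology V :=
  DiscreteTopology.of_forall_le_dist h.pos h.pairwise_le_dist

/-- The points of the `r`-separated space `V` are replaced by copies of the Cantor space of
diameter `r / 2`. -/
@[ext]
structure CantorBlowup (V : Type*) (r : ℝ) where
  base : V
  pt : ℕ → Bool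

namespace CantorBlowup

universe u

variable {V : Type u} {r : ℝ}

instance [Nonempty V] : Nonempty (CantorBlowup V r) :=
  ⟨Classical.arbitrary V, fun _ => false⟩

variable [MetricSpace V]

open Classical in
noncomputable instance : Dist (CantorBlowup V r) where
  dist p q := if p.base = q.base then cantorDist (r / 2) p.pt q.pt else dist p.base q.base

theorem dist_of_base_eq {p q : CantorBlowup V r} (h : p.base = q.base) :
    dist p q = cantorDist (r / 2) p.pt q.pt := if_pos h

theorem dist_mk (u : V) (x y : ℕ → Bool) :
    dist (mk (r := r) u x) (mk u y) = cantorDist (r / 2) x y := if_pos rfl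

theorem dist_of_base_ne {p q : CantorBlowup V r} (h : p.base ≠ q.base) :
    dist p q = dist p.base q.base := if_neg h

variable [hV : IsSeparatedBy V r]

theorem dist_lt_iff {p q : CantorBlowup V r} : dist p q < r ↔ p.base = q.base := by
  by_cases h : p.base = q.base
  · rw [dist_of_base_eq h]
    exact iff_of_true ((cantorDist_le (half_pos hV.pos) _ _).trans_lt (half_lt_self hV.pos)) h
  · rw [dist_of_base_ne h]
    exact iff_of_false (hV.pairwise_le_dist h).not_gt h

theorem dist_nonneg' (p q : CantorBlowup V r) : 0 ≤ dist p q := by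
  by_cases h : p.base = q.base
  · exact (cantorDist_nonneg (half_pos hV.pos) _ _).trans_eq (dist_of_base_eq h).symm
  · exact dist_nonneg.trans_eq (dist_of_base_ne h).symm

variable [IsUltrametricDist V]

theorem dist_triangle_max (p q s : CantorBlowup V r) : dist p s ≤ max (dist p q) (dist q s) := by
  by_cases hpq : p.base = q.base <;> by_cases hqs : q.base = s.base
  · rw [dist_of_base_eq hpq, dist_of_base_eq hqs, dist_of_base_eq (hpq.trans hqs)]
    exact cantorDist_triangle_max (half_pos hV.pos) _ _ _
  · rw [dist_of_base_ne hqs, dist_of_base_ne (hpq ▸ hqs), hpq]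
    exact le_max_right _ _
  · rw [dist_of_base_ne hpq, dist_of_base_ne (hqs ▸ hpq), hqs]
    exact le_max_left _ _
  · by_cases hps : p.base = s.base
    · exact (dist_lt_iff.2 hps).le.trans
        ((not_lt.1 fun h => hpq (dist_lt_iff.1 h)).trans (le_max_left _ _))
    · rw [dist_of_base_ne hpq, dist_of_base_ne hqs, dist_of_base_ne hps]
      exact IsUltrametricDist.dist_triangle_max _ _ _

noncomputable instance : MetricSpace (CantorBlowup V r) where
  dist_self p := (dist_of_base_eq rfl).trans (cantorDist_self _)
  dist_comm p q := by
    by_cases h : p.base = q.base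
    · rw [dist_of_base_eq h, dist_of_base_eq h.symm, cantorDist_comm]
    · rw [dist_of_base_ne h, dist_of_base_ne (Ne.symm h), dist_comm]
  dist_triangle p q s := (dist_triangle_max p q s).trans
    (max_le_add_of_nonneg (dist_nonneg' _ _) (dist_nonneg' _ _))
  eq_of_dist_eq_zero {p q} h := by
    have hbase : p.base = q.base := dist_lt_iff.1 (h.trans_lt hV.pos)
    refine CantorBlowup.ext hbase ?_
    by_contra hne
    rw [dist_of_base_eq hbase] at h
    exact (cantorDist_pos (half_pos hV.pos) hne).ne' h

instance : IsUltrametricDist (CantorBlowup V r) := ⟨dist_triangle_max⟩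

theorem continuous_mk (u : V) : Continuous (mk (r := r) u) := by
  refine continuous_iff_continuousAt.2 fun x => Metric.tendsto_nhds.2 fun ε hε => ?_
  obtain ⟨n, hn⟩ := exists_forall_lt_eq_imp_cantorDist_lt (half_pos hV.pos) x hε
  filter_upwards [(PiNat.isOpen_cylinder (fun _ => Bool) x n).mem_nhds
    (PiNat.self_mem_cylinder x n)] with y hy
  rw [dist_comm, dist_mk]
  exact hn y fun i hi => (PiNat.mem_cylinder_iff.1 hy i hi).symm

theorem ball_eq_range (p : CantorBlowup V r) : Metric.ball p r = Set.range (mk p.base) := by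
  ext q
  rw [Metric.mem_ball, dist_lt_iff]
  exact ⟨fun h => ⟨q.pt, CantorBlowup.ext h.symm rfl⟩, by rintro ⟨x, rfl⟩; rfl⟩

theorem isCompact_ball (p : CantorBlowup V r) : IsCompact (Metric.ball p r) :=
  ball_eq_range p ▸ isCompact_range (continuous_mk p.base)

instance : WeaklyLocallyCompactSpace (CantorBlowup V r) :=
  ⟨fun p => ⟨_, isCompact_ball p, Metric.ball_mem_nhds p hV.pos⟩⟩

instance [Countable V] : SigmaCompactSpace (CantorBlowup V r) := by
  refine SigmaCompactSpace.of_countable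
    (Set.range fun u : V => Metric.ball (mk (r := r) u fun _ => false) r) (Set.countable_range _) ?_
    (Set.eq_univ_of_forall fun p => ⟨_, ⟨p.base, rfl⟩, dist_lt_iff.2 rfl⟩)
  rintro _ ⟨u, rfl⟩
  exact isCompact_ball _

instance : CompleteSpace (CantorBlowup V r) := by
  refine Metric.complete_of_cauchySeq_tendsto fun a ha => ?_
  obtain ⟨n, hn⟩ := Metric.cauchySeq_iff'.1 ha r hV.pos
  obtain ⟨p, -, hp⟩ := cauchySeq_tendsto_of_isComplete (isCompact_ball (a n)).isComplete
    (u := fun k => a (k + n)) (fun k => hn _ (Nat.le_add_left _ _))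
    (ha.comp_tendsto (Filter.tendsto_add_atTop_nat n))
  exact ⟨p, (Filter.tendsto_add_atTop_iff_nat n).1 hp⟩

instance : PerfectSpace (CantorBlowup V r) := by
  refine perfectSpace_iff_forall_not_isolated.2 fun p => ?_
  rw [← mem_closure_iff_nhdsWithin_neBot, Metric.mem_closure_iff]
  intro ε hε
  obtain ⟨n, hn⟩ := exists_forall_lt_eq_imp_cantorDist_lt (half_pos hV.pos) p.pt hε
  refine ⟨⟨p.base, Function.update p.pt n (!p.pt n)⟩, fun h => ?_, ?_⟩
  · simpa using congrFun (CantorBlowup.ext_iff.1 h).2 n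
  · exact (dist_mk _ _ _).trans_lt <| hn _ fun i hi =>
      (Function.update_of_ne hi.ne _ _).symm

theorem isOpen_setOf_base_eq (v : V) : IsOpen {q : CantorBlowup V r | q.base = v} := by
  convert Metric.isOpen_ball (x := mk (r := r) v fun _ => false) (ε := r) using 1
  exact Set.ext fun q => (dist_lt_iff (q := mk v _)).symm

section Isometries

variable (f : CantorBlowup V r ≃ᵢ CantorBlowup V r)

theorem base_apply_eq_iff {p q : CantorBlowup V r} :
    (f p).base = (f q).base ↔ p.base = q.base := by
  rw [← dist_lt_iff, ← dist_lt_iff, f.dist_eq]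

theorem pt_apply (p : CantorBlowup V r) : (f p).pt = p.pt := by
  refine eq_of_forall_cantorDist_eq (half_pos hV.pos) (φ := fun x => (f ⟨p.base, x⟩).pt)
    (fun x y => ?_) p.pt
  have hbase : (f ⟨p.base, x⟩).base = (f ⟨p.base, y⟩).base := (base_apply_eq_iff f).2 rfl
  rw [← dist_of_base_eq hbase, f.dist_eq, dist_mk]

theorem apply_eq_mk (p : CantorBlowup V r) (x : ℕ → Bool) : f p = ⟨(f ⟨p.base, x⟩).base, p.pt⟩ :=
  CantorBlowup.ext ((base_apply_eq_iff f).2 rfl) (pt_apply f p)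

theorem dist_base_apply (u v : V) (x : ℕ → Bool) :
    dist (f ⟨u, x⟩).base (f ⟨v, x⟩).base = dist u v := by
  rcases eq_or_ne u v with rfl | h
  · rw [dist_self, dist_self]
  · rw [← dist_of_base_ne (mt (base_apply_eq_iff f).1 h), f.dist_eq, dist_of_base_ne h]

end Isometries

/-- The isometry of the blow-up that moves the copies of the Cantor space along an isometry
of `V`. -/
noncomputable def mapIsometryEquiv (f : V ≃ᵢ V) : CantorBlowup V r ≃ᵢ CantorBlowup V r where
  toFun p := ⟨f p.base, p.pt⟩
  invFun p := ⟨f.symm p.base, p.pt⟩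
  left_inv p := CantorBlowup.ext (f.symm_apply_apply _) rfl
  right_inv p := CantorBlowup.ext (f.apply_symm_apply _) rfl
  isometry_toFun := Isometry.of_dist_eq fun p q => by
    by_cases h : p.base = q.base
    · rw [dist_of_base_eq h, dist_of_base_eq (congrArg f h)]
    · rw [dist_of_base_ne h, dist_of_base_ne (fun e => h (f.injective e)), f.dist_eq]

/-- The isometry of `V` induced by an isometry of its blow-up. -/
noncomputable def baseIsometryEquiv (f : CantorBlowup V r ≃ᵢ CantorBlowup V r) : V ≃ᵢ V where
  toFun u := (f ⟨u, fun _ => false⟩).base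
  invFun u := (f.symm ⟨u, fun _ => false⟩).base
  left_inv u := congrArg base
    ((apply_eq_mk f.symm (f ⟨u, _⟩) _).symm.trans (f.symm_apply_apply ⟨u, _⟩))
  right_inv u := congrArg base
    ((apply_eq_mk f (f.symm ⟨u, _⟩) _).symm.trans (f.apply_symm_apply ⟨u, _⟩))
  isometry_toFun := Isometry.of_dist_eq fun u v => dist_base_apply f u v _

variable (V r) in
theorem nonempty_continuousMulEquiv_isometryEquiv :
    Nonempty ((V ≃ᵢ V) ≃ₜ* (CantorBlowup V r ≃ᵢ CantorBlowup V r)) := by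
  have := IsSeparatedBy.discreteTopology (V := V) r
  refine ⟨{ toFun := mapIsometryEquiv
            invFun := baseIsometryEquiv
            left_inv := fun f => rfl
            right_inv := fun f => IsometryEquiv.ext fun p => (apply_eq_mk f p _).symm
            map_mul' := fun f g => rfl
            continuous_toFun := continuous_induced_rng.2 (continuous_pi fun p => ?_)
            continuous_invFun := continuous_isometryEquiv_iff_of_discrete.2 fun u v =>
              isOpen_setOf_isometryEquiv_apply_mem _ (isOpen_setOf_base_eq v) }⟩
  have hmk : Continuous fun u : V => mk (r := r) u p.pt := continuous_of_discreteTopology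
  exact hmk.comp ((continuous_apply p.base).comp continuous_induced_dom)

end CantorBlowup

theorem exists_perfect_locallyCompact {V : Type*} [MetricSpace V] (hV : IsPolishUltrametric V)
    (hD : IsUniformlyDiscrete V) : ∃ (r : ℝ) (_ : MetricSpace (CantorBlowup V r)),
      IsPolishUltrametric (CantorBlowup V r) ∧ PerfectSpace (CantorBlowup V r) ∧
        LocallyCompactSpace (CantorBlowup V r) ∧
          Nonempty ((V ≃ᵢ V) ≃ₜ* (CantorBlowup V r ≃ᵢ CantorBlowup V r)) := by
  obtain ⟨r, _⟩ := hD.exists_isSeparatedBy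
  have := hV.nonempty
  have := hV.ultrametric
  have := hV.secondCountable
  have := IsSeparatedBy.discreteTopology (V := V) r
  have : Countable V := TopologicalSpace.separableSpace_iff_countable.1 inferInstance
  exact ⟨r, inferInstance, ⟨inferInstance, inferInstance, inferInstance,
    EMetric.secondCountable_of_sigmaCompact _⟩, inferInstance, inferInstance,
    CantorBlowup.nonempty_continuousMulEquiv_isometryEquiv V r⟩

/-! ## Trees of open balls -/

section OrbitDist

variable {U : Type*} [MetricSpace U]

/-- The distance between the orbits of two points under the isometry group. -/
noncomputable def orbitDist (x y : U) : ℝ := ⨅ f : U ≃ᵢ U, dist (f x) y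

theorem orbitDist_lt_iff {x y : U} {r : ℝ} : orbitDist x y < r ↔ ∃ f : U ≃ᵢ U, dist (f x) y < r :=
  ciInf_lt_iff ⟨0, by rintro _ ⟨f, rfl⟩; exact dist_nonneg⟩

theorem orbitDist_comm (x y : U) : orbitDist x y = orbitDist y x := by
  refine eq_of_forall_gt_iff fun r => ?_
  rw [orbitDist_lt_iff, orbitDist_lt_iff, IsometryEquiv.symm_bijective.surjective.exists]
  refine exists_congr fun f => ?_
  rw [← f.dist_eq, f.apply_symm_apply, dist_comm]

theorem dist_eq_of_dist_lt [IsUltrametricDist U] {x y z : U} (h : dist y z < dist x y) :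
    dist x z = dist x y := by
  rw [IsUltrametricDist.dist_eq_max_of_dist_ne_dist x y z h.ne', max_eq_left h.le]

theorem orbitDist_eq_of_dist_lt [IsUltrametricDist U] {x y z : U} (h : dist y z < orbitDist x y) :
    orbitDist x z = orbitDist x y := by
  have lt_of_lt {r : ℝ} {y z : U} (hyz : dist y z < r) (hxy : orbitDist x y < r) :
      orbitDist x z < r := by
    obtain ⟨f, hf⟩ := orbitDist_lt_iff.1 hxy
    exact orbitDist_lt_iff.2 ⟨f, (dist_triangle_max _ _ _).trans_lt (max_lt hf hyz)⟩
  refine eq_of_forall_gt_iff fun r => ⟨fun hr => ?_, fun hr => lt_of_lt (h.trans hr) hr⟩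
  by_contra! hle
  exact lt_irrefl _ (lt_of_lt (by rwa [dist_comm]) (hr.trans_le hle))

theorem countable_setOf_pos_value [SecondCountableTopology U] {s : U → U → ℝ}
    (hcomm : ∀ x y, s x y = s y x) (hs : ∀ x y z, dist y z < s x y → s x z = s x y) :
    {r : ℝ | 0 < r ∧ ∃ x y, s x y = r}.Countable := by
  obtain ⟨D, hD, hdense⟩ := TopologicalSpace.exists_countable_dense U
  refine ((hD.prod hD).image fun p => s p.1 p.2).mono ?_
  rintro r ⟨hr, x, y, rfl⟩
  obtain ⟨y', hyy', hy'⟩ := Metric.dense_iff.1 hdense y _ hr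
  have hxy' : s y' x = s x y := by rw [hcomm, hs x y y' (Metric.mem_ball'.1 hyy')]
  obtain ⟨x', hxx', hx'⟩ := Metric.dense_iff.1 hdense x _ (hxy'.symm ▸ hr)
  exact ⟨(y', x'), ⟨hy', hx'⟩, (hs y' x x' (Metric.mem_ball'.1 hxx')).trans hxy'⟩

variable (U) in
/-- All positive distances between points and between orbits of points of `U`. -/
def distanceSet : Set ℝ :=
  {r | 0 < r ∧ ∃ x y : U, dist x y = r} ∪ {r | 0 < r ∧ ∃ x y : U, orbitDist x y = r}

variable (U) in
theorem countable_distanceSet [IsUltrametricDist U] [SecondCountableTopology U] :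
    (distanceSet U).Countable :=
  (countable_setOf_pos_value dist_comm fun _ _ _ => dist_eq_of_dist_lt).union
    (countable_setOf_pos_value orbitDist_comm fun _ _ _ => orbitDist_eq_of_dist_lt)

theorem pos_of_mem_distanceSet {r : ℝ} (hr : r ∈ distanceSet U) : 0 < r :=
  hr.elim And.left And.left

theorem le_of_mem_distanceSet {r c : ℝ} (hU : Pairwise fun x y : U => r ≤ dist x y)
    (hc : c ∈ distanceSet U) : r ≤ c := by
  rcases hc with ⟨hc, x, y, rfl⟩ | ⟨hc, x, y, rfl⟩
  · exact hU (dist_pos.1 hc)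
  · by_contra! hlt
    obtain ⟨f, hf⟩ := orbitDist_lt_iff.1 hlt
    have hfx : f x = y := by_contra fun hne => (hU hne).not_gt hf
    obtain ⟨ε, hε, hεc⟩ := exists_between hc
    exact hεc.not_gt (orbitDist_lt_iff.2 ⟨f, by rwa [hfx, dist_self]⟩)

end OrbitDist

/-- A node of a tree of balls: an open ball together with the index `ℓ` of its radius `ρ ℓ`. The
index is recorded because the same set may be a ball of several radii. -/
abbrev BallNode {L : Type*} (ρ : L → ℝ) (U : Type*) [MetricSpace U] : Type _ :=
  {p : L × Set U // ∃ x, p.2 = Metric.ball x (ρ p.1)}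

namespace BallNode

variable {L U : Type*} [MetricSpace U] {ρ : L → ℝ}

/-- The ball of radius `ρ ℓ` around `x`. -/
def of (ρ : L → ℝ) (x : U) (ℓ : L) : BallNode ρ U := ⟨(ℓ, Metric.ball x (ρ ℓ)), x, rfl⟩

theorem exists_of_eq (t : BallNode ρ U) : ∃ x ℓ, of ρ x ℓ = t := by
  obtain ⟨x, hx⟩ := t.2
  exact ⟨x, t.1.1, Subtype.ext (Prod.ext rfl hx.symm)⟩

theorem of_le_of_iff [LinearOrder L] [IsUltrametricDist U] (hρ : Monotone ρ) (hpos : ∀ ℓ, 0 < ρ ℓ)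
    {x y : U} {ℓ ℓ' : L} : of ρ x ℓ ≤ of ρ y ℓ' ↔ ℓ ≤ ℓ' ∧ dist x y < ρ ℓ' := by
  refine and_congr_right fun hℓ => ⟨fun h => h (Metric.mem_ball_self (hpos ℓ)), fun h => ?_⟩
  exact (Metric.ball_subset_ball (hρ hℓ)).trans
    (IsUltrametricDist.ball_eq_of_mem (Metric.mem_ball'.2 h)).le

theorem of_eq_of_iff [IsUltrametricDist U] (hpos : ∀ ℓ, 0 < ρ ℓ) {x y : U} {ℓ : L} :
    of ρ x ℓ = of ρ y ℓ ↔ dist x y < ρ ℓ := by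
  rw [← Metric.mem_ball]
  refine ⟨fun h => ?_, fun h => ?_⟩
  · have hball : Metric.ball x (ρ ℓ) = Metric.ball y (ρ ℓ) := congrArg (fun t => t.1.2) h
    exact hball ▸ Metric.mem_ball_self (hpos ℓ)
  · exact Subtype.ext (Prod.ext rfl (IsUltrametricDist.ball_eq_of_mem h).symm)

theorem countable [SecondCountableTopology U] [IsUltrametricDist U] [Countable L]
    (hpos : ∀ ℓ, 0 < ρ ℓ) : Countable (BallNode ρ U) := by
  obtain ⟨D, hD, hdense⟩ := TopologicalSpace.exists_countable_dense U
  have : Countable D := hD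
  refine Function.Surjective.countable (f := fun p : L × D => of ρ p.2.1 p.1) fun t => ?_
  obtain ⟨x, ℓ, rfl⟩ := t.exists_of_eq
  obtain ⟨y, hxy, hy⟩ := Metric.dense_iff.1 hdense x _ (hpos ℓ)
  exact ⟨(ℓ, ⟨y, hy⟩), (of_eq_of_iff hpos).2 hxy⟩

/-- The action of an isometry on balls. -/
def map (f : U ≃ᵢ U) (t : BallNode ρ U) : BallNode ρ U :=
  ⟨(t.1.1, f '' t.1.2), by
    obtain ⟨x, hx⟩ := t.2
    exact ⟨f x, by rw [hx, f.image_ball]⟩⟩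

theorem map_of (f : U ≃ᵢ U) (x : U) (ℓ : L) : map f (of ρ x ℓ) = of ρ (f x) ℓ :=
  Subtype.ext (Prod.ext rfl (f.image_ball x _))

end BallNode

theorem WeakLTree.agreeAt_max_iff {L T : Type*} [LinearOrder L] [PartialOrder T]
    (𝒯 : WeakLTree L T) {t u : T} :
    𝒯.AgreeAt t u (max (𝒯.lam t) (𝒯.lam u)) ↔ t ≤ u ∨ u ≤ t := by
  have top_eq {t s : T} (hts : t ≤ s) (hs : 𝒯.lam s = 𝒯.lam t) : s = t :=
    (𝒯.existsUnique_above t _ le_rfl).unique ⟨hts, hs⟩ ⟨le_rfl, rfl⟩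
  constructor
  · rintro ⟨s, hts, hus, hs⟩
    rcases le_total (𝒯.lam t) (𝒯.lam u) with h | h
    · exact .inl (top_eq hus (hs.trans (max_eq_right h)) ▸ hts)
    · exact .inr (top_eq hts (hs.trans (max_eq_left h)) ▸ hus)
  · rintro (h | h)
    · exact ⟨u, h, le_rfl, (max_eq_right (𝒯.lam_mono h)).symm⟩
    · exact ⟨t, le_rfl, h, (max_eq_left (𝒯.lam_mono h)).symm⟩

/-- The radii `ρ ℓ` are suitable for a special tree of balls with automorphism group `Iso(U)`:
they are unbounded and arbitrarily fine on the distances of `U`, and they comprise all positive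
distances between points (for an `L`-tree) and between orbits (for a special one). -/
structure IsBallScale {L : Type*} [LinearOrder L] (ρ : L → ℝ) (U : Type*) [MetricSpace U] :
    Prop where
  strictMono : StrictMono ρ
  pos : ∀ ℓ, 0 < ρ ℓ
  exists_dist_lt : ∀ x y : U, ∃ ℓ, dist x y < ρ ℓ
  exists_forall_dist_lt : ∀ ε > 0, ∃ ℓ, ∀ x y : U, dist x y < ρ ℓ → dist x y < ε
  distanceSet_subset : distanceSet U ⊆ Set.range ρ

namespace IsBallScale

open BallNode

variable {L U : Type*} [LinearOrder L] [MetricSpace U] {ρ : L → ℝ}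

theorem exists_eq_dist (h : IsBallScale ρ U) (x y : U) (hxy : 0 < dist x y) :
    ∃ ℓ, ρ ℓ = dist x y :=
  h.distanceSet_subset (.inl ⟨hxy, x, y, rfl⟩)

theorem exists_eq_orbitDist (h : IsBallScale ρ U) (x y : U) (hxy : 0 < orbitDist x y) :
    ∃ ℓ, ρ ℓ = orbitDist x y :=
  h.distanceSet_subset (.inr ⟨hxy, x, y, rfl⟩)

theorem dist_le_of_forall_lt (h : IsBallScale ρ U) {x y z w : U}
    (hlt : ∀ ℓ, dist x y < ρ ℓ → dist z w < ρ ℓ) : dist z w ≤ dist x y := by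
  by_contra! hcon
  obtain ⟨ℓ, hℓ⟩ := h.exists_eq_dist z w (dist_nonneg.trans_lt hcon)
  exact (hlt ℓ (hcon.trans_eq hℓ.symm)).ne hℓ.symm

/-- The distance `s` itself is the radius at which two incomparable nodes last disagree: this is
why all distances have to occur among the radii. -/
theorem exists_isGreatest_disagree {T : Type*} [PartialOrder T] {𝒯 : WeakLTree L T}
    (h : IsBallScale ρ U) {t u : T} (htu : ¬ t ≤ u) (hut : ¬ u ≤ t) {s : ℝ}
    (hs : 0 < s → ∃ ℓ, ρ ℓ = s)
    (hagree : ∀ k, 𝒯.lam t ≤ k → 𝒯.lam u ≤ k → (𝒯.AgreeAt t u k ↔ s < ρ k)) :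
    ∃ m, IsGreatest {k | 𝒯.lam t ≤ k ∧ 𝒯.lam u ≤ k ∧ ¬ 𝒯.AgreeAt t u k} m := by
  have hmax : ρ (max (𝒯.lam t) (𝒯.lam u)) ≤ s := by
    rw [← not_lt, ← hagree _ (le_max_left _ _) (le_max_right _ _), 𝒯.agreeAt_max_iff]
    exact not_or_intro htu hut
  obtain ⟨m, rfl⟩ := hs ((h.pos _).trans_le hmax)
  obtain ⟨htm, hum⟩ := max_le_iff.1 (h.strictMono.le_iff_le.1 hmax)
  refine ⟨m, ⟨htm, hum, (hagree m htm hum).not.2 (lt_irrefl _)⟩, ?_⟩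
  rintro k ⟨htk, huk, hne⟩
  rwa [hagree k htk huk, h.strictMono.lt_iff_lt, not_lt] at hne

variable [IsUltrametricDist U]

theorem of_le_of_iff (h : IsBallScale ρ U) {x y : U} {ℓ ℓ' : L} :
    of ρ x ℓ ≤ of ρ y ℓ' ↔ ℓ ≤ ℓ' ∧ dist x y < ρ ℓ' :=
  BallNode.of_le_of_iff h.strictMono.monotone h.pos

theorem of_le_of (h : IsBallScale ρ U) (x : U) {ℓ ℓ' : L} (hℓ : ℓ ≤ ℓ') : of ρ x ℓ ≤ of ρ x ℓ' :=
  h.of_le_of_iff.2 ⟨hℓ, (dist_self x).trans_lt (h.pos ℓ')⟩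

theorem of_eq_of_iff (h : IsBallScale ρ U) {x y : U} {ℓ : L} :
    of ρ x ℓ = of ρ y ℓ ↔ dist x y < ρ ℓ :=
  BallNode.of_eq_of_iff h.pos

theorem eq_of_forall_of_eq (h : IsBallScale ρ U) {x y : U} (hxy : ∀ ℓ, of ρ x ℓ = of ρ y ℓ) :
    x = y := by
  refine eq_of_forall_dist_le fun ε hε => ?_
  obtain ⟨ℓ, hℓ⟩ := h.exists_forall_dist_lt ε hε
  exact (hℓ x y (h.of_eq_of_iff.1 (hxy ℓ))).le

variable [Nonempty U]

/-- The weak tree of all open balls with radii in the range of `ρ`, ordered by inclusion. -/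
def tree (h : IsBallScale ρ U) : WeakLTree L (BallNode ρ U) where
  lam t := t.1.1
  lam_surjective ℓ := ⟨of ρ (Classical.arbitrary U) ℓ, rfl⟩
  lam_lt t u htu := by
    obtain ⟨x, ℓ, rfl⟩ := t.exists_of_eq
    obtain ⟨y, ℓ', rfl⟩ := u.exists_of_eq
    obtain ⟨hℓ, hxy⟩ := h.of_le_of_iff.1 htu.le
    refine hℓ.lt_of_ne fun heq => htu.ne ?_
    subst heq
    exact h.of_eq_of_iff.2 hxy
  existsUnique_above t ℓ' hℓ := by
    obtain ⟨x, ℓ, rfl⟩ := t.exists_of_eq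
    refine ⟨of ρ x ℓ', ⟨h.of_le_of x hℓ, rfl⟩, ?_⟩
    rintro s ⟨hts, rfl⟩
    obtain ⟨y, ℓ', rfl⟩ := s.exists_of_eq
    exact (h.of_eq_of_iff.2 (h.of_le_of_iff.1 hts).2).symm
  exists_common t u := by
    obtain ⟨x, ℓ, rfl⟩ := t.exists_of_eq
    obtain ⟨y, ℓ', rfl⟩ := u.exists_of_eq
    obtain ⟨k, hk⟩ := h.exists_dist_lt x y
    let m := max k (max ℓ ℓ')
    have hℓ : ℓ ≤ m := le_max_of_le_right (le_max_left _ _)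
    have hℓ' : ℓ' ≤ m := le_max_of_le_right (le_max_right _ _)
    have hm : dist x y < ρ m := hk.trans_le (h.strictMono.monotone (le_max_left _ _))
    exact ⟨m, hℓ, hℓ', of ρ y m, h.of_le_of_iff.2 ⟨hℓ, hm⟩, h.of_le_of y hℓ', rfl⟩

theorem tree_isPruned (h : IsBallScale ρ U) : h.tree.IsPruned := fun t => by
  obtain ⟨x, ℓ, rfl⟩ := t.exists_of_eq
  exact ⟨of ρ x, ⟨fun _ => rfl, fun _ _ => h.of_le_of x⟩, rfl⟩

theorem tree_agreeAt_iff (h : IsBallScale ρ U) {x y : U} {ℓ ℓ' k : L} (hk : ℓ ≤ k)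
    (hk' : ℓ' ≤ k) : h.tree.AgreeAt (of ρ x ℓ) (of ρ y ℓ') k ↔ dist x y < ρ k := by
  constructor
  · rintro ⟨s, hxs, hys, rfl⟩
    obtain ⟨z, k, rfl⟩ := s.exists_of_eq
    exact (dist_triangle_max x z y).trans_lt
      (max_lt (h.of_le_of_iff.1 hxs).2 (dist_comm y z ▸ (h.of_le_of_iff.1 hys).2))
  · exact fun hxy => ⟨of ρ y k, h.of_le_of_iff.2 ⟨hk, hxy⟩, h.of_le_of y hk', rfl⟩

theorem tree_isLTree (h : IsBallScale ρ U) : h.tree.IsLTree := fun t u htu hut => by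
  obtain ⟨x, ℓ, rfl⟩ := t.exists_of_eq
  obtain ⟨y, ℓ', rfl⟩ := u.exists_of_eq
  exact h.exists_isGreatest_disagree htu hut (h.exists_eq_dist x y) fun _ => h.tree_agreeAt_iff

/-- The action of the isometry group on the tree of balls. -/
def toAut (h : IsBallScale ρ U) : (U ≃ᵢ U) →* h.tree.aut where
  toFun f := ⟨⟨map f, map f.symm, fun t => by
      obtain ⟨x, ℓ, rfl⟩ := t.exists_of_eq
      rw [map_of, map_of, f.symm_apply_apply], fun t => by
      obtain ⟨x, ℓ, rfl⟩ := t.exists_of_eq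
      rw [map_of, map_of, f.apply_symm_apply]⟩,
    fun _ => rfl, fun t u => by
      obtain ⟨x, ℓ, rfl⟩ := t.exists_of_eq
      obtain ⟨y, ℓ', rfl⟩ := u.exists_of_eq
      change _ ↔ map f _ ≤ map f _
      rw [map_of, map_of, h.of_le_of_iff, h.of_le_of_iff, f.dist_eq]⟩
  map_one' := Subtype.ext <| Equiv.ext fun t => by
    obtain ⟨x, ℓ, rfl⟩ := t.exists_of_eq
    exact map_of 1 x ℓ
  map_mul' f g := Subtype.ext <| Equiv.ext fun t => by
    obtain ⟨x, ℓ, rfl⟩ := t.exists_of_eq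
    change map (f * g) _ = map f (map g _)
    rw [map_of, map_of, map_of]
    rfl

theorem toAut_of (h : IsBallScale ρ U) (f : U ≃ᵢ U) (x : U) (ℓ : L) :
    (h.toAut f).1 (of ρ x ℓ) = of ρ (f x) ℓ :=
  map_of f x ℓ

theorem toAut_injective (h : IsBallScale ρ U) : Function.Injective h.toAut := fun f g hfg => by
  ext x
  refine h.eq_of_forall_of_eq fun ℓ => ?_
  rw [← h.toAut_of, hfg, h.toAut_of]

theorem continuous_toAut (h : IsBallScale ρ U) : Continuous h.toAut := by
  refine continuous_perm_subgroup_iff.2 fun t u => ?_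
  obtain ⟨x, ℓ, rfl⟩ := t.exists_of_eq
  obtain ⟨y, ℓ', rfl⟩ := u.exists_of_eq
  rcases eq_or_ne ℓ ℓ' with rfl | hℓ
  · convert isOpen_setOf_isometryEquiv_apply_mem x (Metric.isOpen_ball (x := y) (ε := ρ ℓ)) using 3
    rw [h.toAut_of, h.of_eq_of_iff]
    rfl
  · convert isOpen_empty
    refine Set.eq_empty_of_forall_notMem fun f hf => hℓ ?_
    exact congrArg h.tree.lam ((h.toAut_of f x ℓ).symm.trans hf)

/-- The images under an automorphism of the balls around `x` shrink to a point by completeness. -/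
theorem exists_forall_apply_of_eq [CompleteSpace U] (h : IsBallScale ρ U) (g : h.tree.aut)
    (x : U) : ∃ y, ∀ ℓ, g.1 (of ρ x ℓ) = of ρ y ℓ := by
  have hL : Nonempty L := ⟨(h.exists_dist_lt x x).choose⟩
  have hcentre (ℓ : L) : ∃ y, g.1 (of ρ x ℓ) = of ρ y ℓ := by
    obtain ⟨y, k, hy⟩ := (g.1 (of ρ x ℓ)).exists_of_eq
    obtain rfl : k = ℓ := (congrArg h.tree.lam hy).trans (g.2.1 _)
    exact ⟨y, hy.symm⟩
  choose b hb using hcentre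
  have hdist {k ℓ : L} (hkℓ : k ≤ ℓ) : dist (b k) (b ℓ) < ρ ℓ := by
    have := (g.2.2 _ _).1 (h.of_le_of x hkℓ)
    rw [hb, hb, h.of_le_of_iff] at this
    exact this.2
  have hcauchy : Cauchy (Filter.map b Filter.atBot) := by
    refine Metric.cauchy_iff.2 ⟨inferInstance, fun ε hε => ?_⟩
    obtain ⟨ℓ, hℓ⟩ := h.exists_forall_dist_lt ε hε
    refine ⟨b '' Set.Iic ℓ, Filter.image_mem_map (Filter.Iic_mem_atBot ℓ), ?_⟩
    rintro _ ⟨k, hk, rfl⟩ _ ⟨k', hk', rfl⟩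
    exact hℓ _ _ ((dist_triangle_max _ (b ℓ) _).trans_lt
      (max_lt (hdist hk) (dist_comm (b ℓ) _ ▸ hdist hk')))
  obtain ⟨y, hy⟩ := CompleteSpace.complete hcauchy
  refine ⟨y, fun ℓ => ?_⟩
  rw [hb, h.of_eq_of_iff, ← Metric.mem_ball']
  refine (IsUltrametricDist.isClosed_ball (b ℓ) (ρ ℓ)).mem_of_tendsto (f := b) hy ?_
  filter_upwards [Filter.Iic_mem_atBot ℓ] with k hk using hdist hk

theorem toAut_surjective [CompleteSpace U] (h : IsBallScale ρ U) :
    Function.Surjective h.toAut := fun g => by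
  choose f hf using h.exists_forall_apply_of_eq g
  choose f' hf' using h.exists_forall_apply_of_eq g⁻¹
  have hff' (x : U) : f (f' x) = x := h.eq_of_forall_of_eq fun ℓ => by
    rw [← hf, ← hf']
    exact g.1.apply_symm_apply _
  have hlt (x y : U) (ℓ : L) : dist (f x) (f y) < ρ ℓ ↔ dist x y < ρ ℓ := by
    rw [← h.of_eq_of_iff, ← hf, ← hf, g.1.apply_eq_iff_eq, h.of_eq_of_iff]
  have hisom : Isometry f := .of_dist_eq fun x y =>
    (h.dist_le_of_forall_lt fun ℓ => (hlt x y ℓ).2).antisymm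
      (h.dist_le_of_forall_lt fun ℓ => (hlt x y ℓ).1)
  refine ⟨.mk' f f' hff' hisom, Subtype.ext <| Equiv.ext fun t => ?_⟩
  obtain ⟨x, ℓ, rfl⟩ := t.exists_of_eq
  rw [h.toAut_of, hf]
  rfl

theorem nonempty_isometryEquiv_continuousMulEquiv_aut [CompleteSpace U] (h : IsBallScale ρ U) :
    Nonempty ((U ≃ᵢ U) ≃ₜ* h.tree.aut) := by
  let e := MulEquiv.ofBijective h.toAut ⟨h.toAut_injective, h.toAut_surjective⟩
  have hof (g : h.tree.aut) (x : U) (ℓ : L) : of ρ (e.symm g x) ℓ = g.1 (of ρ x ℓ) := by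
    rw [← h.toAut_of]
    exact congrArg (fun k : h.tree.aut => k.1 (of ρ x ℓ)) (e.apply_symm_apply g)
  refine ⟨⟨e, h.continuous_toAut, continuous_induced_rng.2 (continuous_pi fun x => ?_)⟩⟩
  refine continuous_iff_continuousAt.2 fun g => Metric.tendsto_nhds.2 fun ε hε => ?_
  obtain ⟨ℓ, hℓ⟩ := h.exists_forall_dist_lt ε hε
  filter_upwards [(isOpen_setOf_perm_apply_eq h.tree.aut (of ρ x ℓ) (g.1 (of ρ x ℓ))).mem_nhds
    rfl] with k hk
  refine hℓ _ _ (h.of_eq_of_iff.1 ?_)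
  exact (hof k x ℓ).trans (hk.trans (hof g x ℓ).symm)

theorem orb_of_eq_iff [CompleteSpace U] (h : IsBallScale ρ U) {x y : U} {ℓ : L} :
    h.tree.orb (of ρ x ℓ) = h.tree.orb (of ρ y ℓ) ↔ orbitDist x y < ρ ℓ := by
  rw [h.tree.orb_eq_iff, orbitDist_lt_iff]
  constructor
  · rintro ⟨g, hg, hxy⟩
    obtain ⟨f, hf⟩ := h.toAut_surjective ⟨g, hg⟩
    refine ⟨f, h.of_eq_of_iff.1 ?_⟩
    rw [← h.toAut_of, hf, hxy]
  · rintro ⟨f, hf⟩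
    exact ⟨_, (h.toAut f).2, (h.toAut_of f x ℓ).trans (h.of_eq_of_iff.2 hf)⟩

theorem tree_isSpecial [CompleteSpace U] (h : IsBallScale ρ U) : h.tree.IsSpecial := by
  intro δ ε hδε hεδ
  obtain ⟨t, rfl⟩ := h.tree.exists_orb δ
  obtain ⟨u, rfl⟩ := h.tree.exists_orb ε
  obtain ⟨x, ℓ, rfl⟩ := t.exists_of_eq
  obtain ⟨y, ℓ', rfl⟩ := u.exists_of_eq
  refine h.exists_isGreatest_disagree hδε hεδ (h.exists_eq_orbitDist x y) fun k hk hk' => ?_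
  have orb_le {x : U} {ℓ : L} (hk : ℓ ≤ k) : h.tree.orb (of ρ x ℓ) ≤ h.tree.orb (of ρ x k) :=
    h.tree.condensedLE_orb.2 ⟨_, rfl, h.of_le_of x hk⟩
  rw [← h.orb_of_eq_iff]
  constructor
  · rintro ⟨s, hxs, hys, hs⟩
    have hsx := (h.tree.condensed.existsUnique_above _ k hk).unique ⟨hxs, hs⟩ ⟨orb_le hk, rfl⟩
    have hsy := (h.tree.condensed.existsUnique_above _ k hk').unique ⟨hys, hs⟩ ⟨orb_le hk', rfl⟩
    exact hsx.symm.trans hsy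
  · exact fun hxy => ⟨_, orb_le hk, hxy ▸ orb_le hk', rfl⟩

end IsBallScale

theorem IsPolishUltrametric.exists_special_tree {L U : Type*} [LinearOrder L] [Countable L]
    [MetricSpace U] (hU : IsPolishUltrametric U) {ρ : L → ℝ} (h : IsBallScale ρ U) :
    ∃ 𝒯 : WeakLTree L (BallNode ρ U), 𝒯.IsLTree ∧ Countable (BallNode ρ U) ∧ 𝒯.IsPruned ∧
      𝒯.IsSpecial ∧ Nonempty ((U ≃ᵢ U) ≃ₜ* 𝒯.aut) := by
  obtain ⟨_, _, _, _⟩ := hU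
  exact ⟨h.tree, h.tree_isLTree, BallNode.countable h.pos, h.tree_isPruned, h.tree_isSpecial,
    h.nonempty_isometryEquiv_continuousMulEquiv_aut⟩

section Radii

variable {U : Type*} [MetricSpace U] [IsUltrametricDist U] [SecondCountableTopology U]

variable (U) in
theorem exists_rat_isBallScale : ∃ ρ : ℚ → ℝ, IsBallScale ρ U := by
  let C : Set ℝ := distanceSet U ∪ (Set.range ((↑) : ℚ → ℝ) ∩ Set.Ioi 0)
  have hpos : ∀ c ∈ C, 0 < c := fun c hc => hc.elim pos_of_mem_distanceSet And.right
  have hbetween {a b : ℝ} (ha : 0 ≤ a) (hab : a < b) : ∃ c : C, a < c ∧ c < b := by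
    obtain ⟨q, haq, hqb⟩ := exists_rat_btwn hab
    exact ⟨⟨q, .inr ⟨⟨q, rfl⟩, ha.trans_lt haq⟩⟩, haq, hqb⟩
  have : Countable C :=
    ((countable_distanceSet U).union ((Set.countable_range _).mono Set.inter_subset_left))
  have : Nonempty C := ⟨(hbetween le_rfl one_pos).choose⟩
  have : DenselyOrdered C := ⟨fun a _ hab => hbetween (hpos a a.2).le hab⟩
  have : NoMinOrder C := ⟨fun a => (hbetween le_rfl (hpos a a.2)).imp fun _ => And.right⟩
  have : NoMaxOrder C :=
    ⟨fun a => (hbetween (hpos a a.2).le (lt_add_one a.1)).imp fun _ => And.left⟩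
  obtain ⟨e⟩ := Order.iso_of_countable_dense ℚ C
  refine ⟨fun q => e q, fun p q hpq => e.lt_iff_lt.2 hpq, fun q => hpos _ (e q).2, fun x y => ?_,
    fun ε hε => ?_, fun c hc => ⟨e.symm ⟨c, .inl hc⟩, by simp⟩⟩
  · obtain ⟨c, hc, -⟩ := hbetween (dist_nonneg (x := x) (y := y)) (lt_add_one _)
    exact ⟨e.symm c, by simpa using hc⟩
  · obtain ⟨c, -, hc⟩ := hbetween le_rfl hε
    exact ⟨e.symm c, fun x y hxy => hxy.trans (by simpa using hc)⟩

theorem IsUniformlyDiscrete.exists_isBot_isBallScale (hD : IsUniformlyDiscrete U) :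
    ∃ C : Set ℝ, C.Countable ∧ (∃ m : C, IsBot m) ∧ IsBallScale ((↑) : C → ℝ) U := by
  obtain ⟨r, hr, hsep⟩ := isUniformlyDiscrete_iff_exists_pairwise_le_dist.1 hD
  let C : Set ℝ := distanceSet U ∪ Set.range fun n : ℕ => r + n
  have hrC : r ∈ C := .inr ⟨0, by simp⟩
  have hle : ∀ c ∈ C, r ≤ c := by
    rintro c (hc | ⟨n, rfl⟩)
    · exact le_of_mem_distanceSet hsep hc
    · simp
  refine ⟨C, (countable_distanceSet U).union (Set.countable_range _),
    ⟨⟨r, hrC⟩, fun c => hle c c.2⟩, fun _ _ hab => hab, fun c => hr.trans_le (hle c c.2),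
    fun x y => ?_, fun ε hε => ⟨⟨r, hrC⟩, fun x y hxy => ?_⟩, fun c hc => ⟨⟨c, .inl hc⟩, rfl⟩⟩
  · obtain ⟨n, hn⟩ := exists_nat_gt (dist x y)
    exact ⟨⟨r + n, .inr ⟨n, rfl⟩⟩, hn.trans (by simpa using hr)⟩
  · obtain rfl : x = y := by_contra fun hne => (hsep hne).not_gt hxy
    rwa [dist_self]

end Radii

section SpecialTrees

universe u

variable {U : Type u} [MetricSpace U]

theorem IsPolishUltrametric.exists_special_rat_tree (hU : IsPolishUltrametric U) :
    ∃ (T : Type u) (_ : PartialOrder T) (𝒯 : WeakLTree ℚ T), 𝒯.IsLTree ∧ Countable T ∧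
      𝒯.IsPruned ∧ 𝒯.IsSpecial ∧ Nonempty ((U ≃ᵢ U) ≃ₜ* 𝒯.aut) := by
  have := hU.ultrametric
  have := hU.secondCountable
  obtain ⟨ρ, hρ⟩ := exists_rat_isBallScale U
  exact ⟨BallNode ρ U, _, hU.exists_special_tree hρ⟩

theorem IsPolishUltrametric.exists_special_tree_isBot (hU : IsPolishUltrametric U)
    (hD : IsUniformlyDiscrete U) :
    ∃ (L : Type) (T : Type u) (_ : LinearOrder L) (_ : PartialOrder T) (𝒯 : WeakLTree L T),
      (∃ m : L, IsBot m) ∧ 𝒯.IsLTree ∧ Countable T ∧ 𝒯.IsPruned ∧ 𝒯.IsSpecial ∧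
        Nonempty ((U ≃ᵢ U) ≃ₜ* 𝒯.aut) := by
  have := hU.ultrametric
  have := hU.secondCountable
  obtain ⟨C, hC, hbot, hρ⟩ := hD.exists_isBot_isBallScale
  have := hC.to_subtype
  obtain ⟨𝒯, h𝒯⟩ := hU.exists_special_tree hρ
  exact ⟨C, _, _, _, 𝒯, hbot, h𝒯⟩

end SpecialTrees

/-! ## Trees and projective wreath products as forests -/

namespace WeakLTree

universe u

variable {L : Type*} {T : Type u} [LinearOrder L] [PartialOrder T] (𝒯 : WeakLTree L T)

theorem le_of_le_of_le {t u v : T} (hu : t ≤ u) (hv : t ≤ v) (h : 𝒯.lam u ≤ 𝒯.lam v) : u ≤ v := by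
  obtain ⟨w, ⟨huw, hw⟩, -⟩ := 𝒯.existsUnique_above u _ h
  rwa [(𝒯.existsUnique_above t (𝒯.lam v) (𝒯.lam_mono hv)).unique ⟨hu.trans huw, hw⟩ ⟨hv, rfl⟩]
    at huw

theorem le_or_ge_of_le_of_le (𝒯 : WeakLTree L T) {t u v : T} (hu : t ≤ u) (hv : t ≤ v) :
    u ≤ v ∨ v ≤ u :=
  (le_total (𝒯.lam u) (𝒯.lam v)).imp (𝒯.le_of_le_of_le hu hv) (𝒯.le_of_le_of_le hv hu)

theorem eq_of_le_of_lam_eq {t u : T} (h : t ≤ u) (hl : 𝒯.lam t = 𝒯.lam u) : t = u :=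
  h.eq_of_not_lt fun hlt => (𝒯.lam_lt _ _ hlt).ne hl

variable {𝒯}

/-- An `L`-tree as a levelled forest. -/
def toForest (h : 𝒯.IsLTree) : LevelledForest L T where
  rel t u := t ≤ u
  lam := 𝒯.lam
  rel_refl := le_refl
  rel_trans _ _ _ := le_trans
  lam_mono _ _ := 𝒯.lam_mono
  existsUnique_above := 𝒯.existsUnique_above
  exists_isGreatest_disagree := h

theorem aut_eq_colouredAut (h : 𝒯.IsLTree) : 𝒯.aut = (toForest h).colouredAut fun _ => 0 :=
  Subgroup.ext fun _ =>
    ⟨fun hf => ⟨fun t => ⟨hf.1 t, rfl⟩, hf.2⟩, fun hf => ⟨fun t => (hf.1 t).1, hf.2⟩⟩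

theorem IsLTree.exists_uniformlyDiscrete (h : 𝒯.IsLTree) [Countable T] :
    ∃ (U : Type u) (_ : MetricSpace U), IsPolishUltrametric U ∧ IsUniformlyDiscrete U ∧
      Nonempty (𝒯.aut ≃ₜ* (U ≃ᵢ U)) := by
  rcases isEmpty_or_nonempty T with hT | hT
  · refine ⟨PUnit, inferInstance, ⟨inferInstance, ⟨fun _ _ _ => by simp⟩, inferInstance,
      inferInstance⟩, ⟨1, one_pos, fun x => ?_⟩, ?_⟩
    · exact Set.eq_singleton_iff_unique_mem.2
        ⟨Metric.mem_ball_self one_pos, fun _ _ => Subsingleton.elim _ _⟩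
    · have : Unique (PUnit ≃ᵢ PUnit) := ⟨⟨1⟩, fun _ => by ext⟩
      have : Unique 𝒯.aut := uniqueOfSubsingleton 1
      exact ⟨ContinuousMulEquiv.ofUnique⟩
  · have : Countable L := 𝒯.lam_surjective.countable
    rw [aut_eq_colouredAut h]
    exact (toForest h).exists_uniformlyDiscrete fun _ => 0

end WeakLTree

section Supports

variable {Δ : Type*} [PartialOrder Δ]

theorem union_mem_suppMax {A B : Set Δ} (hA : A ∈ suppMax Δ) (hB : B ∈ suppMax Δ) :
    A ∪ B ∈ suppMax Δ := by
  intro C hC hne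
  rcases (C ∩ A).eq_empty_or_nonempty with hCA | hCA
  · refine hB C (fun c hc => (hC hc).resolve_left fun hcA => ?_) hne
    exact Set.eq_empty_iff_forall_notMem.1 hCA c ⟨hc, hcA⟩
  obtain ⟨m, hm⟩ := hA _ Set.inter_subset_right hCA
  rcases ({c | c ∈ C ∧ c ∈ B ∧ m ≤ c}).eq_empty_or_nonempty with hD | hD
  · refine ⟨m, hm.prop.1, fun c hc hmc => ?_⟩
    rcases hC hc with hcA | hcB
    · exact hm.le_of_ge ⟨hc, hcA⟩ hmc
    · exact (Set.eq_empty_iff_forall_notMem.1 hD c ⟨hc, hcB, hmc⟩).elim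
  · obtain ⟨k, hk⟩ := hB _ (fun _ hc => hc.2.1) hD
    have hmk : m ≤ k := hk.prop.2.2
    refine ⟨k, hk.prop.1, fun c hc hkc => ?_⟩
    rcases hC hc with hcA | hcB
    · exact (hm.le_of_ge ⟨hc, hcA⟩ (hmk.trans hkc)).trans hmk
    · exact hk.le_of_ge ⟨hc, hcB, hmk.trans hkc⟩ hkc

theorem exists_isGreatest_ne {N : Δ → ℕ∞} {γ : Δ}
    (htot : ∀ α β : {α : Δ // γ ≤ α}, α ≤ β ∨ β ≤ α) {z w : LocSeq N γ}
    (hz : z ∈ admissibleLocal N (suppMax Δ) γ) (hw : w ∈ admissibleLocal N (suppMax Δ) γ)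
    (hne : z ≠ w) : ∃ α, IsGreatest {α | z α ≠ w α} α := by
  obtain ⟨x, hx, hzx⟩ := hz
  obtain ⟨y, hy, hwy⟩ := hw
  obtain ⟨α₀, hα₀⟩ := Function.ne_iff.1 hne
  have hsub : Subtype.val '' {α | z α ≠ w α} ⊆ seqSupport x ∪ seqSupport y := by
    rintro _ ⟨α, hα, rfl⟩
    by_contra! hcon
    simp only [seqSupport, Set.mem_union, Set.mem_ofPred_eq, not_or, not_not] at hcon
    exact hα (Subtype.ext (by rw [hzx, hwy, hcon.1, hcon.2]))
  obtain ⟨-, ⟨α, hα, rfl⟩, hmax⟩ := union_mem_suppMax hx hy _ hsub ⟨_, α₀, hα₀, rfl⟩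
  exact ⟨α, hα, fun β hβ => (htot β α).elim id fun h => hmax ⟨β, hβ, rfl⟩ h⟩

end Supports

namespace ProjSystem

universe u

variable {Δ : Type u} [PartialOrder Δ] {N : Δ → ℕ∞} (P : ProjSystem N)

theorem proj_self {δ : Δ} (h : δ ≤ δ) (z : P.S δ) : P.proj h z = z := by
  obtain ⟨w, rfl⟩ := P.proj_surjective h z
  exact P.proj_comp h h w

theorem up_self (p : P.Point) : P.up p le_rfl = p := congrArg (Sigma.mk p.1) (P.proj_self _ p.2)

theorem up_up (p : P.Point) {γ β : Δ} (h : p.1 ≤ γ) (h' : γ ≤ β) :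
    P.up (P.up p h) (γ := β) h' = P.up p (h.trans h') :=
  congrArg (Sigma.mk β) (P.proj_comp h h' p.2)

theorem pert_injective {δ : Δ} (z : P.S δ) : Function.Injective (P.pert ⟨δ, z⟩) := by
  intro i j h
  have h' : z.1.perturb i = z.1.perturb j :=
    congrArg Subtype.val (eq_of_heq (Sigma.mk.inj h).2)
  simpa only [pert_self] using congrFun h' ⟨δ, le_rfl⟩

variable {P}

theorem PreservesProj.exists_map_pert {g : Equiv.Perm P.Point} (hg : P.PreservesProj g) {δ : Δ}
    {z w : P.S δ} (hzw : g ⟨δ, z⟩ = ⟨δ, w⟩) (i : Label (N δ)) :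
    ∃ j, g (P.pert ⟨δ, z⟩ i) = P.pert ⟨δ, w⟩ j := by
  obtain ⟨v, hv⟩ := P.exists_map_eq hg (P.pert ⟨δ, z⟩ i).2
  change g (P.pert ⟨δ, z⟩ i) = ⟨δ, v⟩ at hv
  refine ⟨v.1 ⟨δ, le_rfl⟩, P.map_pert hg hzw i _ ?_⟩
  rw [hv]
  exact fun _ => rfl

/-- The permutation of labels required by `ActsThrough` comes for free: its inverse is induced by
`g⁻¹`. -/
theorem mem_wrSym_iff {g : Equiv.Perm P.Point} : g ∈ P.wrSym ↔ P.PreservesProj g := by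
  refine ⟨fun h => h.1, fun hg => ⟨hg, ?_⟩⟩
  rintro ⟨δ, z⟩
  obtain ⟨w, hw⟩ := P.exists_map_eq hg z
  have hw' : g⁻¹ ⟨δ, w⟩ = ⟨δ, z⟩ := by rw [← hw]; exact g.symm_apply_apply _
  choose σ hσ using hg.exists_map_pert hw
  choose τ hτ using hg.inv.exists_map_pert hw'
  refine ⟨⟨σ, τ, fun i => P.pert_injective z ?_, fun i => P.pert_injective w ?_⟩, trivial,
    fun i => ?_⟩
  · rw [← hτ, ← hσ]
    exact g.symm_apply_apply _
  · rw [← hσ, ← hτ]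
    exact g.apply_symm_apply _
  · change ∀ h : (g (P.pert ⟨δ, z⟩ i)).1 ≤ δ, (g (P.pert ⟨δ, z⟩ i)).2.1 ⟨δ, h⟩ = σ i
    rw [hσ]
    exact fun _ => pert_self w.1 (σ i)

variable (P) in
/-- The order of the union of the `S δ` given by the projections: `q` is a projection of `p`. -/
def PointLE (p q : P.Point) : Prop := ∃ h : p.1 ≤ q.1, P.up p h = q

theorem pointLE_up (p : P.Point) {γ : Δ} (h : p.1 ≤ γ) : P.PointLE p (P.up p h) := ⟨h, rfl⟩

theorem PointLE.exists_up {p q : P.Point} (h : P.PointLE p q) :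
    ∃ (γ : Δ) (h : p.1 ≤ γ), P.up p h = q :=
  ⟨q.1, h⟩

theorem PreservesProj.pointLE {g : Equiv.Perm P.Point} (hg : P.PreservesProj g) {p q : P.Point}
    (hpq : P.PointLE p q) : P.PointLE (g p) (g q) := by
  obtain ⟨γ, h, rfl⟩ := hpq.exists_up
  rw [hg.2 p _ h ((hg.1 p).trans_le h)]
  exact pointLE_up _ _

theorem preservesProj_iff {g : Equiv.Perm P.Point} : P.PreservesProj g ↔
    (∀ p, (g p).1 = p.1) ∧ ∀ p q, P.PointLE p q ↔ P.PointLE (g p) (g q) := by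
  constructor
  · exact fun hg => ⟨hg.1, fun p q => ⟨hg.pointLE, fun h => by simpa using hg.inv.pointLE h⟩⟩
  · rintro ⟨h₁, h₂⟩
    refine ⟨h₁, fun p γ h h' => ?_⟩
    obtain ⟨h₃, h₄⟩ := (h₂ p (P.up p h)).1 (pointLE_up p h)
    have e : (g (P.up p h)).1 = γ := h₁ _
    rw [← h₄]
    revert h₃
    rw [e]
    exact fun _ _ => rfl

section Forest

variable {L : Type*} [LinearOrder L] (𝒯 : WeakLTree L Δ)

theorem exists_common_pointLE_iff {p q : P.Point} {γ β : Δ} (hp : p.1 ≤ γ) (hq : q.1 ≤ γ)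
    (h : γ ≤ β) :
    (∃ s : P.Point, P.PointLE p s ∧ P.PointLE q s ∧ 𝒯.lam s.1 = 𝒯.lam β) ↔
      (P.proj hp p.2).1.restrict h = (P.proj hq q.2).1.restrict h := by
  rw [← P.proj_eq_iff, P.proj_comp, P.proj_comp]
  constructor
  · rintro ⟨⟨β', s⟩, ⟨h₁, h₂⟩, ⟨h₃, h₄⟩, h₅⟩
    obtain rfl : β' = β := (𝒯.existsUnique_above p.1 (𝒯.lam β) (𝒯.lam_mono (hp.trans h))).unique
      ⟨h₁, h₅⟩ ⟨hp.trans h, rfl⟩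
    exact eq_of_heq (Sigma.mk.inj (h₂.trans h₄.symm)).2
  · intro e
    exact ⟨⟨β, _⟩, pointLE_up p (hp.trans h), ⟨hq.trans h, congrArg (Sigma.mk β) e.symm⟩, rfl⟩

theorem exists_isGreatest_disagree_of_up_ne
    (hS : ∀ δ, P.S δ ⊆ admissibleLocal N (suppMax Δ) δ) {p q : P.Point} {γ : Δ} (hp : p.1 ≤ γ)
    (hq : q.1 ≤ γ) (hne : P.up p hp ≠ P.up q hq) :
    ∃ m, IsGreatest {ℓ | 𝒯.lam p.1 ≤ ℓ ∧ 𝒯.lam q.1 ≤ ℓ ∧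
      ¬ ∃ s, P.PointLE p s ∧ P.PointLE q s ∧ 𝒯.lam s.1 = ℓ} m := by
  obtain ⟨⟨α, hα⟩, hne_α, hmax⟩ := exists_isGreatest_ne
    (fun α β => 𝒯.le_or_ge_of_le_of_le α.2 β.2) (hS γ (P.proj hp p.2).2) (hS γ (P.proj hq q.2).2)
    (fun e => hne (congrArg (Sigma.mk γ) (Subtype.ext e)))
  refine ⟨𝒯.lam α, ⟨𝒯.lam_mono (hp.trans hα), 𝒯.lam_mono (hq.trans hα), ?_⟩, ?_⟩
  · rw [exists_common_pointLE_iff 𝒯 hp hq hα]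
    exact fun e => hne_α (congrFun e ⟨α, le_rfl⟩)
  · rintro ℓ ⟨-, -, hℓ⟩
    by_contra! hlt
    obtain ⟨β, ⟨hβ, rfl⟩, -⟩ := 𝒯.existsUnique_above α ℓ hlt.le
    refine hℓ ((exists_common_pointLE_iff 𝒯 hp hq (hα.trans hβ)).2 (funext fun ε => ?_))
    by_contra hε
    have hεα : ε.1 ≤ α := hmax (a := ⟨ε.1, hα.trans (hβ.trans ε.2)⟩) hε
    exact hlt.not_ge (𝒯.lam_mono (ε.2.trans hεα))

theorem exists_isGreatest_disagree (h𝒯 : 𝒯.IsLTree)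
    (hS : ∀ δ, P.S δ ⊆ admissibleLocal N (suppMax Δ) δ) {p q : P.Point} (hpq : ¬ P.PointLE p q)
    (hqp : ¬ P.PointLE q p) :
    ∃ m, IsGreatest {ℓ | 𝒯.lam p.1 ≤ ℓ ∧ 𝒯.lam q.1 ≤ ℓ ∧
      ¬ ∃ s, P.PointLE p s ∧ P.PointLE q s ∧ 𝒯.lam s.1 = ℓ} m := by
  by_cases h₁ : p.1 ≤ q.1
  · exact exists_isGreatest_disagree_of_up_ne 𝒯 hS h₁ le_rfl
      fun e => hpq ⟨h₁, e.trans (P.up_self q)⟩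
  by_cases h₂ : q.1 ≤ p.1
  · exact exists_isGreatest_disagree_of_up_ne 𝒯 hS le_rfl h₂
      fun e => hqp ⟨h₂, e.symm.trans (P.up_self p)⟩
  by_cases h₃ : ∃ (γ : Δ) (hp : p.1 ≤ γ) (hq : q.1 ≤ γ), P.up p hp ≠ P.up q hq
  · obtain ⟨γ, hp, hq, hne⟩ := h₃
    exact exists_isGreatest_disagree_of_up_ne 𝒯 hS hp hq hne
  -- The projections of `p` and `q` agree wherever both exist: only the skeleton separates them.
  · push Not at h₃
    convert h𝒯 p.1 q.1 h₁ h₂ using 6 with m ℓ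
    refine and_congr_right fun _ => not_congr ⟨?_, ?_⟩
    · rintro ⟨s, hs₁, hs₂, hs₃⟩
      exact ⟨s.1, hs₁.1, hs₂.1, hs₃⟩
    · rintro ⟨γ, hp, hq, rfl⟩
      exact ⟨P.up p hp, pointLE_up p hp, ⟨hq, (h₃ γ hp hq).symm⟩, rfl⟩

variable {𝒯}

/-- The points of a system of projections over an `L`-tree, ordered by the projections, as a
levelled forest. -/
def toForest (h𝒯 : 𝒯.IsLTree) (hS : ∀ δ, P.S δ ⊆ admissibleLocal N (suppMax Δ) δ) :
    LevelledForest L P.Point where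
  rel := P.PointLE
  lam p := 𝒯.lam p.1
  rel_refl p := ⟨le_rfl, P.up_self p⟩
  rel_trans := by
    intro p q r hpq hqr
    obtain ⟨γ, h₁, rfl⟩ := hpq.exists_up
    obtain ⟨β, h₂, rfl⟩ := hqr.exists_up
    rw [P.up_up p h₁ h₂]
    exact pointLE_up p _
  lam_mono p q h := 𝒯.lam_mono h.1
  existsUnique_above p ℓ h := by
    obtain ⟨γ, ⟨hγ, rfl⟩, hu⟩ := 𝒯.existsUnique_above p.1 ℓ h
    refine ⟨P.up p hγ, ⟨pointLE_up p hγ, rfl⟩, ?_⟩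
    rintro ⟨γ', z⟩ ⟨⟨h₁, h₂⟩, h₃⟩
    obtain rfl : γ' = γ := hu γ' ⟨h₁, h₃⟩
    exact h₂.symm
  exists_isGreatest_disagree _ _ := exists_isGreatest_disagree 𝒯 h𝒯 hS

theorem wrSym_eq_colouredAut (h𝒯 : 𝒯.IsLTree)
    (hS : ∀ δ, P.S δ ⊆ admissibleLocal N (suppMax Δ) δ) {κ : Δ → ℕ} (hκ : Function.Injective κ) :
    P.wrSym = (toForest h𝒯 hS).colouredAut fun p => κ p.1 := by
  ext g
  rw [mem_wrSym_iff, preservesProj_iff]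
  exact and_congr_left fun _ => forall_congr' fun p =>
    ⟨fun h => ⟨congrArg 𝒯.lam h, congrArg κ h⟩, fun h => hκ h.2⟩

end Forest

theorem exists_uniformlyDiscrete (hΔ : IsCountableTreeableSkeleton Δ N)
    (hS : ∀ δ, P.S δ ⊆ admissibleLocal N (suppMax Δ) δ) [Countable P.Point] :
    ∃ (U : Type u) (_ : MetricSpace U), IsPolishUltrametric U ∧ IsUniformlyDiscrete U ∧
      Nonempty (P.wrSym ≃ₜ* (U ≃ᵢ U)) := by
  obtain ⟨L, _, 𝒯, h𝒯, -⟩ := hΔ.treeable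
  have := hΔ.countable
  obtain ⟨δ⟩ := hΔ.nonempty
  have : Nonempty P.Point := ⟨⟨δ, _, (P.nonempty δ).some_mem⟩⟩
  have : Countable L := 𝒯.lam_surjective.countable
  obtain ⟨κ, hκ⟩ := exists_injective_nat Δ
  rw [wrSym_eq_colouredAut h𝒯 hS hκ]
  exact (toForest h𝒯 hS).exists_uniformlyDiscrete fun p => κ p.1

end ProjSystem

/-! ## Back and forth -/

section BackAndForth

open Set

variable {C X Y : Type*} [PartialOrder C] {n : C → ℕ∞} {A : X → C → ℕ} {B : Y → C → ℕ}
  {F : Finset (X × Y)}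

/-- A family of sequences, indexed by `X`, that is homogeneous enough for back and forth: the label
at `γ` ranges over the numbers below `n γ` independently of the labels above `γ`, and distinct
members have a greatest coordinate of disagreement. -/
structure IsRichFamily (n : C → ℕ∞) (A : X → C → ℕ) : Prop where
  lt : ∀ x γ, (A x γ : ℕ∞) < n γ
  exists_disagree : ∀ x y, x ≠ y → ∃ γ, A x γ ≠ A y γ ∧ (Ioi γ).EqOn (A x) (A y)
  exists_update : ∀ y γ (i : ℕ), (i : ℕ∞) < n γ → ∃ w, A w γ = i ∧ (Ioi γ).EqOn (A w) (A y)

/-- A finite correspondence between two families of sequences that preserves and reflects agreement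
of sequences from a coordinate on. -/
def IsPartialIso (A : X → C → ℕ) (B : Y → C → ℕ) (F : Finset (X × Y)) : Prop :=
  ∀ p ∈ F, ∀ q ∈ F, ∀ γ, (Ici γ).EqOn (A p.1) (A q.1) ↔ (Ici γ).EqOn (B p.2) (B q.2)

theorem eqOn_Ici_iff_and {α : Type*} {f g : C → α} {γ : C} :
    (Ici γ).EqOn f g ↔ f γ = g γ ∧ (Ioi γ).EqOn f g := by
  rw [← Ioi_insert, insert_eq, eqOn_union, eqOn_singleton]

theorem eqOn_Ioi_iff_forall_Ici {α : Type*} {f g : C → α} {γ : C} :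
    (Ioi γ).EqOn f g ↔ ∀ β, γ < β → (Ici β).EqOn f g :=
  ⟨fun h _ hβ => h.mono (Ici_subset_Ioi.2 hβ), fun h β hβ => h β hβ self_mem_Ici⟩

theorem IsPartialIso.eqOn_Ioi_iff (hF : IsPartialIso A B F) {p q : X × Y} (hp : p ∈ F) (hq : q ∈ F)
    {γ : C} : (Ioi γ).EqOn (A p.1) (A q.1) ↔ (Ioi γ).EqOn (B p.2) (B q.2) := by
  simp only [eqOn_Ioi_iff_forall_Ici, hF p hp q hq]

theorem IsPartialIso.map_swap (hF : IsPartialIso A B F) :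
    IsPartialIso B A (F.map (Equiv.prodComm X Y).toEmbedding) := by
  simp only [IsPartialIso, Finset.forall_mem_map]
  exact fun p hp q hq γ => (hF p hp q hq γ).symm

theorem IsPartialIso.insert [DecidableEq (X × Y)] (hF : IsPartialIso A B F) {p : X × Y}
    (hp : ∀ q ∈ F, ∀ γ, (Ici γ).EqOn (A q.1) (A p.1) ↔ (Ici γ).EqOn (B q.2) (B p.2)) :
    IsPartialIso A B (insert p F) := by
  intro q hq r hr γ
  rw [Finset.mem_insert] at hq hr
  rcases hq with rfl | hq <;> rcases hr with rfl | hr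
  · exact iff_of_true (eqOn_refl _ _) (eqOn_refl _ _)
  · simpa only [eqOn_comm] using hp r hr γ
  · exact hp q hq γ
  · exact hF q hq r hr γ

/-- If all labels were taken, there would be finitely many of them, and the members of `F` taking
them would also take the label of `x` on the other side. -/
theorem IsPartialIso.exists_free_label (hA : ∀ x γ, (A x γ : ℕ∞) < n γ) (hF : IsPartialIso A B F)
    {p₀ : X × Y} (hp₀ : p₀ ∈ F) {x : X} {γ : C} (hx : (Ioi γ).EqOn (A p₀.1) (A x))
    (hne : ∀ p ∈ F, ¬ (Ici γ).EqOn (A p.1) (A x)) :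
    ∃ i : ℕ, (i : ℕ∞) < n γ ∧ ∀ p ∈ F, (Ioi γ).EqOn (B p.2) (B p₀.2) → B p.2 γ ≠ i := by
  by_contra! hcon
  have taken : ∀ i : Label (n γ), ∃ p : F, (Ioi γ).EqOn (B p.1.2) (B p₀.2) ∧ B p.1.2 γ = i.1 := by
    intro i
    obtain ⟨p, hp, h⟩ := hcon i.1 i.2
    exact ⟨⟨p, hp⟩, h⟩
  choose φ hφ hφ_label using taken
  have φ_injective : φ.Injective := fun i j h =>
    Subtype.ext (by rw [← hφ_label i, ← hφ_label j, h])
  have : Finite (Label (n γ)) := Finite.of_injective φ φ_injective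
  have eqOn_p₀ (i) : (Ioi γ).EqOn (A (φ i).1.1) (A p₀.1) :=
    (hF.eqOn_Ioi_iff (φ i).2 hp₀).2 (hφ i)
  let ψ : Label (n γ) → Label (n γ) := fun i => ⟨A (φ i).1.1 γ, hA _ _⟩
  have ψ_injective : ψ.Injective := by
    intro i j h
    have hB := (hF _ (φ i).2 _ (φ j).2 γ).1 <|
      eqOn_Ici_iff_and.2 ⟨congrArg Subtype.val h, (eqOn_p₀ i).trans (eqOn_p₀ j).symm⟩
    exact Subtype.ext (by rw [← hφ_label i, ← hφ_label j, hB self_mem_Ici])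
  obtain ⟨i, hi⟩ := Finite.injective_iff_surjective.1 ψ_injective ⟨A x γ, hA x γ⟩
  exact hne _ (φ i).2 (eqOn_Ici_iff_and.2 ⟨congrArg Subtype.val hi, (eqOn_p₀ i).trans hx⟩)

theorem IsRichFamily.exists_closest (hA : IsRichFamily n A) (htot : ∀ α β : C, α ≤ β ∨ β ≤ α)
    (hne : F.Nonempty) {x : X} (hx : ∀ p ∈ F, p.1 ≠ x) :
    ∃ γ, ∃ p₀ ∈ F, (Ioi γ).EqOn (A p₀.1) (A x) ∧ ∀ p ∈ F, ¬ (Ici γ).EqOn (A p.1) (A x) := by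
  choose m hm_ne hm_eqOn using fun p : F => hA.exists_disagree p.1.1 x (hx p.1 p.2)
  have : Nonempty F := hne.to_subtype
  obtain ⟨p₀, hp₀⟩ := finite_univ.exists_minimalFor m univ univ_nonempty
  refine ⟨m p₀, p₀.1, p₀.2, hm_eqOn p₀, fun p hp h => hm_ne ⟨p, hp⟩ (h ?_)⟩
  exact (htot _ _).elim id fun h' => hp₀.2 (mem_univ _) h'

theorem IsPartialIso.exists_extension [Nonempty Y] (htot : ∀ α β : C, α ≤ β ∨ β ≤ α)
    (hA : IsRichFamily n A) (hB : IsRichFamily n B) (hF : IsPartialIso A B F) (x : X) :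
    ∃ y, ∀ p ∈ F, ∀ γ, (Ici γ).EqOn (A p.1) (A x) ↔ (Ici γ).EqOn (B p.2) (B y) := by
  by_cases hx : ∃ p ∈ F, p.1 = x
  · obtain ⟨p, hp, rfl⟩ := hx
    exact ⟨p.2, fun q hq => hF q hq p hp⟩
  push Not at hx
  rcases F.eq_empty_or_nonempty with rfl | hne
  · exact ⟨Classical.arbitrary Y, fun _ h => absurd h (Finset.notMem_empty _)⟩
  obtain ⟨γ, p₀, hp₀, hx_eqOn, hx_ne⟩ := hA.exists_closest htot hne hx
  obtain ⟨i, hi, hfree⟩ := hF.exists_free_label hA.lt hp₀ hx_eqOn hx_ne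
  obtain ⟨y, hyi, hy_eqOn⟩ := hB.exists_update p₀.2 γ i hi
  refine ⟨y, fun p hp β => ?_⟩
  by_cases hβ : γ < β
  · have hsub : Ici β ⊆ Ioi γ := Ici_subset_Ioi.2 hβ
    exact ⟨fun h => ((hF p hp p₀ hp₀ β).1 (h.trans (hx_eqOn.mono hsub).symm)).trans
        (hy_eqOn.mono hsub).symm,
      fun h => ((hF p hp p₀ hp₀ β).2 (h.trans (hy_eqOn.mono hsub))).trans (hx_eqOn.mono hsub)⟩
  · have hβγ : β ≤ γ := (htot β γ).elim id fun h => (h.eq_of_not_lt hβ).ge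
    have hsub : Ici γ ⊆ Ici β := Ici_subset_Ici.2 hβγ
    refine iff_of_false (fun h => hx_ne p hp (h.mono hsub)) fun h => ?_
    obtain ⟨hγ, hIoi⟩ := eqOn_Ici_iff_and.1 (h.mono hsub)
    exact hfree p hp (hIoi.trans hy_eqOn) (hγ.trans hyi)

theorem IsPartialIso.exists_insert_left [Nonempty Y] (htot : ∀ α β : C, α ≤ β ∨ β ≤ α)
    (hA : IsRichFamily n A) (hB : IsRichFamily n B) (hF : IsPartialIso A B F) (x : X) :
    ∃ F', IsPartialIso A B F' ∧ F ⊆ F' ∧ ∃ y, (x, y) ∈ F' := by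
  classical
  obtain ⟨y, hy⟩ := hF.exists_extension htot hA hB x
  exact ⟨_, hF.insert (p := (x, y)) hy, F.subset_insert _, y, F.mem_insert_self _⟩

theorem IsPartialIso.exists_insert_right [Nonempty X] (htot : ∀ α β : C, α ≤ β ∨ β ≤ α)
    (hA : IsRichFamily n A) (hB : IsRichFamily n B) (hF : IsPartialIso A B F) (y : Y) :
    ∃ F', IsPartialIso A B F' ∧ F ⊆ F' ∧ ∃ x, (x, y) ∈ F' := by
  obtain ⟨F', hF', hsub, x, hx⟩ := hF.map_swap.exists_insert_left htot hB hA y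
  refine ⟨_, hF'.map_swap, fun p hp => ?_, x, Finset.mem_map.2 ⟨_, hx, rfl⟩⟩
  exact Finset.mem_map.2 ⟨p.swap, hsub (Finset.mem_map.2 ⟨p, hp, rfl⟩), rfl⟩

theorem IsRichFamily.eq_of_forall_eqOn (hA : IsRichFamily n A) {x y : X}
    (h : ∀ γ, (Ici γ).EqOn (A x) (A y)) : x = y := by
  by_contra hne
  obtain ⟨γ, hγ, -⟩ := hA.exists_disagree x y hne
  exact hγ (h γ self_mem_Ici)

theorem exists_equiv_of_isRichFamily [Countable X] [Countable Y] [Nonempty X] [Nonempty Y]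
    (htot : ∀ α β : C, α ≤ β ∨ β ≤ α) (hA : IsRichFamily n A) (hB : IsRichFamily n B) :
    ∃ e : X ≃ Y, ∀ x x' γ, (Ici γ).EqOn (A x) (A x') ↔ (Ici γ).EqOn (B (e x)) (B (e x')) := by
  cases nonempty_encodable X
  cases nonempty_encodable Y
  let D : X ⊕ Y → Order.Cofinal {F : Finset (X × Y) // IsPartialIso A B F} := fun s =>
    { carrier := {F | s.elim (fun x => ∃ y, (x, y) ∈ F.1) (fun y => ∃ x, (x, y) ∈ F.1)}
      isCofinal := by
        intro F
        cases s with
        | inl x =>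
          obtain ⟨F', hF', hsub, hx⟩ := F.2.exists_insert_left htot hA hB x
          exact ⟨⟨F', hF'⟩, hx, hsub⟩
        | inr y =>
          obtain ⟨F', hF', hsub, hy⟩ := F.2.exists_insert_right htot hA hB y
          exact ⟨⟨F', hF'⟩, hy, hsub⟩ }
  have isPartialIso_empty : IsPartialIso A B ∅ := fun _ h => absurd h (Finset.notMem_empty _)
  let I := Order.idealOfCofinals ⟨∅, isPartialIso_empty⟩ D
  have left (x) : ∃ y, ∃ F ∈ I, (x, y) ∈ F.1 := by
    obtain ⟨F, ⟨y, hy⟩, hF⟩ :=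
      Order.cofinal_meets_idealOfCofinals ⟨∅, isPartialIso_empty⟩ D (.inl x)
    exact ⟨y, F, hF, hy⟩
  have right (y) : ∃ x, ∃ F ∈ I, (x, y) ∈ F.1 := by
    obtain ⟨F, ⟨x, hx⟩, hF⟩ :=
      Order.cofinal_meets_idealOfCofinals ⟨∅, isPartialIso_empty⟩ D (.inr y)
    exact ⟨x, F, hF, hx⟩
  have compat {p q : X × Y} (hp : ∃ F ∈ I, p ∈ F.1) (hq : ∃ F ∈ I, q ∈ F.1) (γ) :
      (Ici γ).EqOn (A p.1) (A q.1) ↔ (Ici γ).EqOn (B p.2) (B q.2) := by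
    obtain ⟨F, hF, hp⟩ := hp
    obtain ⟨F', hF', hq⟩ := hq
    obtain ⟨M, -, hFM, hF'M⟩ := I.directed _ hF _ hF'
    exact M.2 p (hFM hp) q (hF'M hq) γ
  choose f hf using left
  choose g hg using right
  refine ⟨⟨f, g, fun x => ?_, fun y => ?_⟩, fun x x' => compat (hf x) (hf x')⟩
  · exact hA.eq_of_forall_eqOn fun γ => (compat (hg (f x)) (hf x) γ).2 (eqOn_refl _ _)
  · exact hB.eq_of_forall_eqOn fun γ => (compat (hf (g y)) (hg y) γ).1 (eqOn_refl _ _)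

end BackAndForth

/-! ## Orbits and siblings -/

theorem nonempty_equiv_label (C : Type*) [Countable C] : Nonempty (C ≃ Label (ENat.card C)) := by
  rcases finite_or_infinite C with hC | hC
  · refine ⟨(Finite.equivFin C).trans <| Fin.equivSubtype.trans <|
      Equiv.subtypeEquivRight fun i => ?_⟩
    rw [ENat.card_eq_coe_natCard, Nat.cast_lt]
  · obtain ⟨_⟩ := nonempty_denumerable C
    refine ⟨(Denumerable.eqv C).trans (Equiv.subtypeUnivEquiv fun i => ?_).symm⟩
    rw [ENat.card_eq_top_of_infinite]
    exact ENat.natCast_lt_top i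

theorem exists_bijOn_lt_encard {T : Type*} [Countable T] {C : Set T} {x : T} (hx : x ∈ C) :
    ∃ f : T → ℕ, Set.BijOn f C {i : ℕ | (i : ℕ∞) < C.encard} ∧ f x = 0 := by
  classical
  obtain ⟨e₀⟩ : Nonempty (C ≃ Label C.encard) := nonempty_equiv_label C
  have hpos : ((0 : ℕ) : ℕ∞) < C.encard := Set.encard_pos.2 ⟨x, hx⟩
  let e : C ≃ Label C.encard := e₀.trans (Equiv.swap (e₀ ⟨x, hx⟩) ⟨0, hpos⟩)
  let f : T → ℕ := Function.extend Subtype.val (fun t : C => (e t).1) 0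
  have hf (t : C) : f t = (e t).1 := Subtype.val_injective.extend_apply _ _ _
  refine ⟨f, ⟨fun t ht => ?_, fun t ht u hu h => ?_, fun i hi => ?_⟩, ?_⟩
  · exact (hf ⟨t, ht⟩).symm ▸ (e ⟨t, ht⟩).2
  · rw [hf ⟨t, ht⟩, hf ⟨u, hu⟩] at h
    exact congrArg Subtype.val (e.injective (Subtype.ext h))
  · exact ⟨e.symm ⟨i, hi⟩, (e.symm ⟨i, hi⟩).2, by rw [hf, e.apply_symm_apply]⟩
  · rw [hf ⟨x, hx⟩]
    exact congrArg Subtype.val (Equiv.swap_apply_left (e₀ ⟨x, hx⟩) ⟨0, hpos⟩)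

section LeastIndex

variable {T : Type*} [Preorder T] (idx : T → ℕ)

/-- The least index of an element below `s`. -/
noncomputable def leastIndex (s : T) : ℕ := sInf (idx '' Set.Iic s)

variable {idx}

theorem leastIndex_le {t s : T} (h : t ≤ s) : leastIndex idx s ≤ idx t := Nat.sInf_le ⟨t, h, rfl⟩

theorem exists_le_eq_leastIndex (s : T) : ∃ t ≤ s, idx t = leastIndex idx s :=
  Nat.sInf_mem (s := idx '' Set.Iic s) ⟨_, s, le_rfl, rfl⟩

theorem leastIndex_anti {s t : T} (h : s ≤ t) : leastIndex idx t ≤ leastIndex idx s := by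
  obtain ⟨r, hr, hr_idx⟩ := exists_le_eq_leastIndex (idx := idx) s
  exact hr_idx ▸ leastIndex_le (hr.trans h)

end LeastIndex

namespace WeakLTree

variable {L T : Type*} [LinearOrder L] [PartialOrder T] {𝒯 : WeakLTree L T}

theorem orb_apply {f : Equiv.Perm T} (hf : f ∈ 𝒯.aut) (t : T) : 𝒯.orb (f t) = 𝒯.orb t :=
  (𝒯.orb_eq_iff.2 ⟨f, hf, rfl⟩).symm

theorem lam_eq_of_orb_eq {t u : T} (h : 𝒯.orb t = 𝒯.orb u) : 𝒯.lam t = 𝒯.lam u :=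
  congrArg 𝒯.condensedLam h

theorem orb_mono {t u : T} (h : t ≤ u) : 𝒯.orb t ≤ 𝒯.orb u := 𝒯.condensedLE_orb.2 ⟨u, rfl, h⟩

theorem exists_le_of_orb_le {t : T} {γ : 𝒯.Condensed} (h : 𝒯.orb t ≤ γ) :
    ∃ u, t ≤ u ∧ 𝒯.orb u = γ := by
  obtain ⟨u, hu, htu⟩ := 𝒯.condensedLE_orb.1 h
  exact ⟨u, htu, hu⟩

theorem exists_lt_of_orb_lt {t : T} {γ : 𝒯.Condensed} (h : 𝒯.orb t < γ) :
    ∃ u, t < u ∧ 𝒯.orb u = γ := by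
  obtain ⟨u, htu, rfl⟩ := exists_le_of_orb_le h.le
  exact ⟨u, lt_of_le_of_ne htu fun e => h.ne (congrArg 𝒯.orb e), rfl⟩

theorem exists_ge_of_le_orb {u : T} {δ : 𝒯.Condensed} (h : δ ≤ 𝒯.orb u) :
    ∃ t, t ≤ u ∧ 𝒯.orb t = δ := by
  obtain ⟨t, u', rfl, hu', htu⟩ := h
  obtain ⟨f, hf, rfl⟩ := 𝒯.orb_eq_iff.1 hu'
  exact ⟨f t, (hf.2 _ _).1 htu, orb_apply hf t⟩

theorem eq_of_le_of_orb_eq {t u v : T} (hu : t ≤ u) (hv : t ≤ v) (h : 𝒯.orb u = 𝒯.orb v) :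
    u = v :=
  (𝒯.existsUnique_above t (𝒯.lam v) (𝒯.lam_mono hv)).unique ⟨hu, lam_eq_of_orb_eq h⟩ ⟨hv, rfl⟩

theorem lt_iff_apply_lt {f : Equiv.Perm T} (hf : f ∈ 𝒯.aut) {t u : T} : t < u ↔ f t < f u := by
  rw [lt_iff_le_not_ge, lt_iff_le_not_ge, hf.2, hf.2 u]

variable (𝒯) in
/-- Nodes of the same orbit with the same strict upper bounds: only the labels of siblings, rather
than of whole levels, have to be kept apart in order to tell nodes from each other. -/
def Sibling (s s' : T) : Prop := 𝒯.orb s = 𝒯.orb s' ∧ ∀ u, s < u ↔ s' < u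

namespace Sibling

theorem refl (s : T) : 𝒯.Sibling s s := ⟨rfl, fun _ => Iff.rfl⟩

theorem symm {s s' : T} (h : 𝒯.Sibling s s') : 𝒯.Sibling s' s := ⟨h.1.symm, fun u => (h.2 u).symm⟩

theorem trans {s s' s'' : T} (h : 𝒯.Sibling s s') (h' : 𝒯.Sibling s' s'') : 𝒯.Sibling s s'' :=
  ⟨h.1.trans h'.1, fun u => (h.2 u).trans (h'.2 u)⟩

theorem map {s s' : T} (h : 𝒯.Sibling s s') {f : Equiv.Perm T} (hf : f ∈ 𝒯.aut) :
    𝒯.Sibling (f s) (f s') := by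
  refine ⟨by rw [orb_apply hf, orb_apply hf, h.1], f.surjective.forall.2 fun u => ?_⟩
  rw [← lt_iff_apply_lt hf, ← lt_iff_apply_lt hf, h.2]

end Sibling

variable (𝒯) in
/-- The sibling class of `s`. -/
def siblings (s : T) : Set T := {s' | 𝒯.Sibling s s'}

theorem mem_siblings_self (s : T) : s ∈ 𝒯.siblings s := Sibling.refl s

theorem Sibling.siblings_eq {s s' : T} (h : 𝒯.Sibling s s') : 𝒯.siblings s = 𝒯.siblings s' :=
  Set.ext fun _ => ⟨h.symm.trans, h.trans⟩

theorem siblings_apply {f : Equiv.Perm T} (hf : f ∈ 𝒯.aut) (s : T) :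
    𝒯.siblings (f s) = f '' 𝒯.siblings s := by
  refine Set.Subset.antisymm (fun u hu => ?_) (Set.image_subset_iff.2 fun _ hv => hv.map hf)
  refine ⟨f⁻¹ u, ?_, f.apply_symm_apply u⟩
  simpa [siblings] using hu.map (𝒯.aut.inv_mem hf)

theorem encard_siblings_eq {s t : T} (h : 𝒯.orb s = 𝒯.orb t) :
    (𝒯.siblings s).encard = (𝒯.siblings t).encard := by
  obtain ⟨f, hf, rfl⟩ := 𝒯.orb_eq_iff.1 h
  rw [siblings_apply hf, f.injective.encard_image]

theorem lt_of_lt_of_agreeAt {a b c d u : T} (hac : a ≤ c) (hbd : b ≤ d) (hl : 𝒯.lam c = 𝒯.lam d)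
    (h : ∀ k, 𝒯.lam c < k → 𝒯.AgreeAt a b k) (hu : c < u) : d < u := by
  have hlam : 𝒯.lam c < 𝒯.lam u := 𝒯.lam_lt _ _ hu
  obtain ⟨w, haw, hbw, hw⟩ := h _ hlam
  have hau := hac.trans hu.le
  obtain rfl : w = u :=
    (𝒯.existsUnique_above a (𝒯.lam u) (𝒯.lam_mono hau)).unique ⟨haw, hw⟩ ⟨hau, rfl⟩
  refine (𝒯.le_of_le_of_le hbd hbw (hl ▸ hlam.le)).lt_of_ne ?_
  rintro rfl
  exact hlam.ne hl

theorem IsLTree.exists_sibling (h𝒯 : 𝒯.IsLTree) {t t' : T} (horb : 𝒯.orb t = 𝒯.orb t')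
    (hne : t ≠ t') : ∃ v v', t ≤ v ∧ t' ≤ v' ∧ v ≠ v' ∧ 𝒯.Sibling v v' := by
  have hl := lam_eq_of_orb_eq horb
  obtain ⟨m, ⟨hm, hm', hm_disagree⟩, hmax⟩ := h𝒯 t t'
    (fun h => hne (𝒯.eq_of_le_of_lam_eq h hl))
    (fun h => hne (𝒯.eq_of_le_of_lam_eq h hl.symm).symm)
  obtain ⟨v, ⟨hv, hvm⟩, -⟩ := 𝒯.existsUnique_above t m hm
  obtain ⟨v', ⟨hv', hvm'⟩, -⟩ := 𝒯.existsUnique_above t' m hm'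
  have agree (k) (hk : m < k) : 𝒯.AgreeAt t t' k := by
    by_contra hcon
    exact hk.not_ge (hmax ⟨hm.trans hk.le, hm'.trans hk.le, hcon⟩)
  have agree' (k) (hk : m < k) : 𝒯.AgreeAt t' t k := (agree k hk).imp fun _ h => ⟨h.2.1, h.1, h.2.2⟩
  have hvv' := hvm.trans hvm'.symm
  refine ⟨v, v', hv, hv', ?_, ?_, fun u => ⟨lt_of_lt_of_agreeAt hv hv' hvv' (hvm ▸ agree),
    lt_of_lt_of_agreeAt hv' hv hvv'.symm (hvm' ▸ agree')⟩⟩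
  · rintro rfl
    exact hm_disagree ⟨v, hv, hv', hvm⟩
  · exact (𝒯.condensed.existsUnique_above (𝒯.orb t) m hm).unique ⟨orb_mono hv, hvm⟩
      ⟨horb ▸ orb_mono hv', hvm'⟩

variable (𝒯) in
/-- The number of siblings of the nodes in an orbit. -/
noncomputable def siblingCount (δ : 𝒯.Condensed) : ℕ∞ :=
  (𝒯.siblings (𝒯.exists_orb δ).choose).encard

theorem siblingCount_orb (s : T) : 𝒯.siblingCount (𝒯.orb s) = (𝒯.siblings s).encard :=
  encard_siblings_eq (𝒯.exists_orb (𝒯.orb s)).choose_spec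

theorem siblingCount_ne_zero (δ : 𝒯.Condensed) : 𝒯.siblingCount δ ≠ 0 :=
  Set.encard_ne_zero.2 ⟨_, mem_siblings_self _⟩

variable (𝒯) in
/-- An enumeration of each sibling class by an initial segment of `ω`, such that only finitely many
nonzero labels occur above each node. -/
structure SiblingLabelling where
  label : T → ℕ
  bijOn : ∀ s, Set.BijOn label (𝒯.siblings s) {i : ℕ | (i : ℕ∞) < (𝒯.siblings s).encard}
  finite_support : ∀ t, {s | t ≤ s ∧ label s ≠ 0}.Finite

/-- Distinct nodes `s` above `t` have distinct values `leastIndex idx (σ s)` for the chosen siblings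
`σ s`, and these values are at most `idx t`. -/
theorem finite_setOf_exists_sibling_leastIndex_le {idx : T → ℕ} (hidx : idx.Injective) (t : T) :
    {s | t ≤ s ∧ ∃ s', 𝒯.Sibling s s' ∧ s' ≠ s ∧ leastIndex idx s' ≤ leastIndex idx s}.Finite := by
  set A := {s | t ≤ s ∧ ∃ s', 𝒯.Sibling s s' ∧ s' ≠ s ∧ leastIndex idx s' ≤ leastIndex idx s}
  choose σ hσ hσ_ne hσ_le using fun s : A => s.2.2
  have not_lt (s s' : A) (h : leastIndex idx (σ s) = leastIndex idx (σ s')) : ¬ s.1 < s'.1 := by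
    intro hss
    obtain ⟨b, hb, hb_idx⟩ := exists_le_eq_leastIndex (idx := idx) (σ s)
    obtain ⟨b', hb', hb'_idx⟩ := exists_le_eq_leastIndex (idx := idx) (σ s')
    obtain rfl : b = b' := hidx (by rw [hb_idx, hb'_idx, h])
    exact hσ_ne s' (eq_of_le_of_orb_eq hb' (hb.trans (((hσ s).2 _).1 hss).le) (hσ s').1.symm)
  have bound (s : A) : leastIndex idx (σ s) < idx t + 1 :=
    Nat.lt_succ_of_le ((hσ_le s).trans (leastIndex_le s.2.1))
  refine Set.finite_coe_iff.1 (Finite.of_injective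
    (fun s : A => (⟨leastIndex idx (σ s), bound s⟩ : Fin (idx t + 1))) fun s s' h => ?_)
  have h' : leastIndex idx (σ s) = leastIndex idx (σ s') := congrArg Fin.val h
  rcases 𝒯.le_or_ge_of_le_of_le s.2.1 s'.2.1 with hle | hle
  · exact Subtype.ext (hle.eq_of_not_lt (not_lt s s' h'))
  · exact Subtype.ext (hle.eq_of_not_lt (not_lt s' s h'.symm)).symm

theorem nonempty_siblingLabelling (𝒯 : WeakLTree L T) [Countable T] :
    Nonempty 𝒯.SiblingLabelling := by
  obtain ⟨idx, hidx⟩ := exists_injective_nat T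
  -- Zero labels a member of the class with the least `leastIndex`.
  have enumerate (C : Set T) : ∃ f : T → ℕ, C.Nonempty → Set.BijOn f C {i | (i : ℕ∞) < C.encard} ∧
      ∀ s ∈ C, f s ≠ 0 → ∃ s' ∈ C, s' ≠ s ∧ leastIndex idx s' ≤ leastIndex idx s := by
    rcases C.eq_empty_or_nonempty with rfl | hC
    · exact ⟨0, fun h => absurd h Set.not_nonempty_empty⟩
    obtain ⟨x, hx, hmin⟩ := exists_minimalFor_of_wellFoundedLT (· ∈ C) (leastIndex idx) hC
    obtain ⟨f, hf, hfx⟩ := exists_bijOn_lt_encard hx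
    refine ⟨f, fun _ => ⟨hf, fun s hs hfs => ⟨x, hx, ?_, (le_total _ _).elim id (hmin hs)⟩⟩⟩
    rintro rfl
    exact hfs hfx
  choose F hF using enumerate
  have hF' (s) := hF (𝒯.siblings s) ⟨s, mem_siblings_self s⟩
  refine ⟨⟨fun s => F (𝒯.siblings s) s, fun s => (hF' s).1.congr fun s' hs' => ?_, fun t => ?_⟩⟩
  · rw [Sibling.siblings_eq hs']
  · exact (finite_setOf_exists_sibling_leastIndex_le hidx t).subset fun s hs =>
      ⟨hs.1, (hF' s).2 s (mem_siblings_self s) hs.2⟩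

end WeakLTree

/-! ## Coordinates for the nodes of a tree -/

namespace WeakLTree

variable {L T : Type*} [LinearOrder L] [PartialOrder T] {𝒯 : WeakLTree L T}

variable (𝒯) in
/-- `t` and `t'` have a common upper bound in the orbit `γ`. -/
def AgreeOn (t t' : T) (γ : 𝒯.Condensed) : Prop := ∃ u, 𝒯.orb u = γ ∧ t ≤ u ∧ t' ≤ u

theorem agreeOn_congr {s t s' t' : T} {γ : 𝒯.Condensed} (hs : s ≤ t) (hs' : s' ≤ t')
    (h : 𝒯.orb t ≤ γ) (h' : 𝒯.orb t' ≤ γ) : 𝒯.AgreeOn s s' γ ↔ 𝒯.AgreeOn t t' γ := by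
  refine ⟨?_, fun ⟨u, hu, htu, htu'⟩ => ⟨u, hu, hs.trans htu, hs'.trans htu'⟩⟩
  rintro ⟨u, rfl, hu, hu'⟩
  obtain ⟨v, hv, e⟩ := exists_le_of_orb_le h
  obtain ⟨v', hv', e'⟩ := exists_le_of_orb_le h'
  obtain rfl := eq_of_le_of_orb_eq (hs.trans hv) hu e
  obtain rfl := eq_of_le_of_orb_eq (hs'.trans hv') hu' e'
  exact ⟨v', rfl, hv, hv'⟩

variable (𝒯) in
/-- Coordinates, indexed by the orbits, for the nodes of a tree. Within an orbit they determine
which upper bounds two nodes share, and the coordinate of a node at its own orbit may be changed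
freely. Nothing is required of the coordinates of `t` below `orb t`, and those of two nodes `t ≤ u`
need not be related: this is what makes projections other than restrictions necessary. -/
structure Coordinates (N : 𝒯.Condensed → ℕ∞) where
  coord : T → 𝒯.Condensed → ℕ
  coord_lt : ∀ t γ, (coord t γ : ℕ∞) < N γ
  coord_eqOn_iff : ∀ t t' γ, 𝒯.orb t = 𝒯.orb t' → 𝒯.orb t ≤ γ →
    ((Set.Ici γ).EqOn (coord t) (coord t') ↔ 𝒯.AgreeOn t t' γ)
  exists_perturb : ∀ t (i : ℕ), (i : ℕ∞) < N (𝒯.orb t) → ∃ t', 𝒯.orb t' = 𝒯.orb t ∧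
    coord t' (𝒯.orb t) = i ∧ (Set.Ioi (𝒯.orb t)).EqOn (coord t') (coord t)

namespace Coordinates

variable {N : 𝒯.Condensed → ℕ∞} (Z : 𝒯.Coordinates N)

/-- The coordinates of `t` on the cone above `δ`, which is `orb t` in the applications. -/
def loc (t : T) (δ : 𝒯.Condensed) : LocSeq N δ := fun γ => ⟨Z.coord t γ.1, Z.coord_lt t γ.1⟩

theorem loc_eq_iff {t t' : T} {γ : 𝒯.Condensed} (h : 𝒯.orb t = 𝒯.orb t') (hγ : 𝒯.orb t ≤ γ) :
    Z.loc t γ = Z.loc t' γ ↔ 𝒯.AgreeOn t t' γ := by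
  rw [← Z.coord_eqOn_iff t t' γ h hγ]
  exact ⟨fun e β hβ => congrArg Subtype.val (congrFun e ⟨β, hβ⟩),
    fun e => funext fun β => Subtype.ext (e β.2)⟩

theorem loc_injective {t t' : T} (h : 𝒯.orb t = 𝒯.orb t')
    (e : Z.loc t (𝒯.orb t) = Z.loc t' (𝒯.orb t)) : t = t' := by
  obtain ⟨u, hu, htu, htu'⟩ := (Z.loc_eq_iff h le_rfl).1 e
  rw [eq_of_le_of_orb_eq le_rfl htu hu.symm, eq_of_le_of_orb_eq le_rfl htu' (h.symm.trans hu.symm)]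

/-- The coordinate sequences of the nodes in an orbit. -/
def seqs (δ : 𝒯.Condensed) : Set (LocSeq N δ) := {z | ∃ t, 𝒯.orb t = δ ∧ z = Z.loc t δ}

theorem seqs_nonempty (δ : 𝒯.Condensed) : (Z.seqs δ).Nonempty := by
  obtain ⟨t, rfl⟩ := 𝒯.exists_orb δ
  exact ⟨_, t, rfl, rfl⟩

theorem perturb_mem_seqs (δ : 𝒯.Condensed) (z : LocSeq N δ) (hz : z ∈ Z.seqs δ)
    (i : Label (N δ)) : z.perturb i ∈ Z.seqs δ := by
  obtain ⟨t, rfl, rfl⟩ := hz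
  obtain ⟨t', ht', ht'_self, ht'_above⟩ := Z.exists_perturb t i.1 i.2
  refine ⟨t', ht', funext fun ⟨γ, hγ⟩ => ?_⟩
  rcases (show 𝒯.orb t ≤ γ from hγ).eq_or_lt with rfl | hlt
  · rw [ProjSystem.pert_self]
    exact Subtype.ext ht'_self.symm
  · exact (congrFun (ProjSystem.pert_restrict (Z.loc t (𝒯.orb t)) i hlt) ⟨γ, le_rfl⟩).trans
      (Subtype.ext (ht'_above hlt).symm)

theorem exists_proj {δ γ : 𝒯.Condensed} (h : δ ≤ γ) (z : Z.seqs δ) :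
    ∃ w : Z.seqs γ, ∃ t u, 𝒯.orb t = δ ∧ z.1 = Z.loc t δ ∧ t ≤ u ∧ 𝒯.orb u = γ ∧
      w.1 = Z.loc u γ := by
  obtain ⟨_, t, rfl, rfl⟩ := z
  obtain ⟨u, htu, rfl⟩ := exists_le_of_orb_le h
  exact ⟨⟨_, u, rfl, rfl⟩, t, u, rfl, rfl, htu, rfl, rfl⟩

/-- The projection that corresponds to passing from a node to the larger node in the orbit `γ`. -/
noncomputable def proj {δ γ : 𝒯.Condensed} (h : δ ≤ γ) (z : Z.seqs δ) : Z.seqs γ :=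
  (Z.exists_proj h z).choose

theorem proj_loc {t u : T} (h : t ≤ u) {δ γ : 𝒯.Condensed} (ht : 𝒯.orb t = δ) (hu : 𝒯.orb u = γ)
    (hle : δ ≤ γ) : Z.proj hle ⟨Z.loc t δ, t, ht, rfl⟩ = ⟨Z.loc u γ, u, hu, rfl⟩ := by
  subst ht hu
  obtain ⟨t', u', ht', he, htu', hu', hw⟩ :=
    (Z.exists_proj hle ⟨Z.loc t _, t, rfl, rfl⟩).choose_spec
  obtain rfl := Z.loc_injective ht'.symm he
  obtain rfl := eq_of_le_of_orb_eq htu' h hu'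
  exact Subtype.ext hw

/-- The system of projections given by coordinates. -/
noncomputable def toProjSystem : ProjSystem N where
  S := Z.seqs
  nonempty := Z.seqs_nonempty
  perturb_mem := Z.perturb_mem_seqs
  proj h z := Z.proj h z
  proj_surjective {δ γ} h w := by
    obtain ⟨_, u, rfl, rfl⟩ := w
    obtain ⟨t, htu, rfl⟩ := exists_ge_of_le_orb h
    exact ⟨⟨_, t, rfl, rfl⟩, Z.proj_loc htu rfl rfl h⟩
  proj_eq_iff {δ γ} h z w := by
    obtain ⟨_, t, rfl, rfl⟩ := z
    obtain ⟨_, t', ht', rfl⟩ := w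
    obtain ⟨u, htu, hu⟩ := exists_le_of_orb_le h
    obtain ⟨u', htu', hu'⟩ := exists_le_of_orb_le (ht'.trans_le h)
    rw [Z.proj_loc htu rfl hu h, Z.proj_loc htu' ht' hu' h, Subtype.ext_iff]
    change Z.loc u γ = Z.loc u' γ ↔ Z.loc t γ = Z.loc t' γ
    rw [Z.loc_eq_iff (hu.trans hu'.symm) hu.le, Z.loc_eq_iff ht'.symm h,
      agreeOn_congr htu htu' hu.le hu'.le]
  proj_comp {δ γ β} h₁ h₂ z := by
    obtain ⟨_, t, rfl, rfl⟩ := z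
    obtain ⟨u, htu, rfl⟩ := exists_le_of_orb_le h₁
    obtain ⟨v, huv, rfl⟩ := exists_le_of_orb_le h₂
    rw [Z.proj_loc htu rfl rfl h₁, Z.proj_loc huv rfl rfl h₂, Z.proj_loc (htu.trans huv) rfl rfl _]

/-- The node `t` as a point of the system of projections. -/
noncomputable def point (t : T) : Z.toProjSystem.Point :=
  ⟨𝒯.orb t, Z.loc t (𝒯.orb t), t, rfl, rfl⟩

theorem up_point {t u : T} (h : t ≤ u) :
    Z.toProjSystem.up (Z.point t) (orb_mono h) = Z.point u :=
  congrArg (Sigma.mk (𝒯.orb u)) (Z.proj_loc h rfl rfl (orb_mono h))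

theorem point_injective : Function.Injective Z.point := by
  intro t t' h
  have fst_eq : 𝒯.orb t = 𝒯.orb t' := congrArg Sigma.fst h
  refine Z.loc_injective fst_eq ?_
  have loc_eq (δ) (hδ : 𝒯.orb t' = δ) (w : Z.toProjSystem.S δ)
      (hw : (⟨δ, w⟩ : Z.toProjSystem.Point) = Z.point t') : w.1 = Z.loc t' δ := by
    subst hδ
    exact congrArg Subtype.val (eq_of_heq (Sigma.mk.inj hw).2)
  exact loc_eq _ fst_eq.symm _ h

theorem pointLE_point_iff {t u : T} :
    Z.toProjSystem.PointLE (Z.point t) (Z.point u) ↔ t ≤ u := by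
  refine ⟨fun ⟨h, e⟩ => ?_, fun h => ⟨orb_mono h, Z.up_point h⟩⟩
  obtain ⟨v, htv, hv⟩ := exists_le_of_orb_le (t := t) (γ := 𝒯.orb u) h
  have up_eq : Z.toProjSystem.up (Z.point t) h = Z.point v := by
    rw [← Z.up_point htv]
    congr 1
    exact hv.symm
  exact Z.point_injective (up_eq.symm.trans e) ▸ htv

/-- The nodes of the tree as the points of the system of projections. -/
noncomputable def equivPoint : T ≃ Z.toProjSystem.Point :=
  Equiv.ofBijective Z.point
    ⟨Z.point_injective, fun ⟨_, _, t, ht, hz⟩ => ⟨t, by subst ht hz; rfl⟩⟩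

theorem permCongr_equivPoint_mem_wrSym_iff (f : Equiv.Perm T) :
    Z.equivPoint.permCongr f ∈ Z.toProjSystem.wrSym ↔ f ∈ 𝒯.aut := by
  have equivPoint_le (t u) :
      Z.toProjSystem.PointLE (Z.equivPoint t) (Z.equivPoint u) ↔ t ≤ u := Z.pointLE_point_iff
  rw [ProjSystem.mem_wrSym_iff, ProjSystem.preservesProj_iff]
  simp only [Z.equivPoint.surjective.forall, Equiv.permCongr_apply, Equiv.symm_apply_apply,
    equivPoint_le]
  exact ⟨fun h => ⟨fun t => lam_eq_of_orb_eq (h.1 t), h.2⟩, fun h => ⟨fun t => orb_apply h t, h.2⟩⟩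

theorem nonempty_aut_continuousMulEquiv_wrSym : Nonempty (𝒯.aut ≃ₜ* Z.toProjSystem.wrSym) :=
  nonempty_continuousMulEquiv_of_permCongr Z.equivPoint Z.permCongr_equivPoint_mem_wrSym_iff

theorem isLocallyHomogeneous_toProjSystem : Z.toProjSystem.IsLocallyHomogeneous := by
  intro δ z w
  obtain ⟨t, ht⟩ := Z.equivPoint.surjective ⟨δ, z⟩
  obtain ⟨u, hu⟩ := Z.equivPoint.surjective ⟨δ, w⟩
  have horb : 𝒯.orb t = 𝒯.orb u := (congrArg Sigma.fst ht).trans (congrArg Sigma.fst hu).symm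
  obtain ⟨f, hf, rfl⟩ := 𝒯.orb_eq_iff.1 horb
  exact ⟨_, (Z.permCongr_equivPoint_mem_wrSym_iff f).2 hf,
    by rw [← ht, ← hu, Equiv.permCongr_apply, Equiv.symm_apply_apply]⟩

end Coordinates

theorem IsPruned.condensed (h : 𝒯.IsPruned) : 𝒯.condensed.IsPruned := by
  intro δ
  obtain ⟨t, rfl⟩ := 𝒯.exists_orb δ
  obtain ⟨b, hb, hbt⟩ := h t
  exact ⟨fun ℓ => 𝒯.orb (b ℓ), ⟨fun ℓ => hb.1 ℓ, fun ℓ ℓ' hℓ => orb_mono (hb.2 ℓ ℓ' hℓ)⟩,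
    congrArg 𝒯.orb hbt⟩

instance [Countable T] : Countable 𝒯.Condensed :=
  Function.Surjective.countable (f := 𝒯.orb) 𝒯.exists_orb

theorem isCountableTreeableSkeleton_condensed {L : Type} {T : Type*} [LinearOrder L]
    [PartialOrder T] {𝒯 : WeakLTree L T} [Nonempty L] [Countable T] (hp : 𝒯.IsPruned)
    (hs : 𝒯.IsSpecial) {N : 𝒯.Condensed → ℕ∞} (hN : ∀ δ, N δ ≠ 0) :
    IsCountableTreeableSkeleton 𝒯.Condensed N where
  nonempty := 𝒯.condensed.lam_surjective.nonempty
  countable := inferInstance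
  label_ne_zero := hN
  treeable := ⟨L, inferInstance, 𝒯.condensed, hs, hp.condensed⟩

end WeakLTree

/-! ## Sibling labels as coordinates -/

theorem suppLF_subset_suppMax (Δ : Type*) [PartialOrder Δ] : suppLF Δ ⊆ suppMax Δ := by
  intro A hA B hB ⟨b, hb⟩
  obtain ⟨m, hbm, hm⟩ := ((hA b).subset (Set.inter_subset_inter_left _ hB)).exists_le_maximal
    ⟨hb, le_refl b⟩
  exact ⟨m, hm.prop.1, fun c hc hmc => hm.le_of_ge ⟨hc, hbm.trans hmc⟩ hmc⟩

theorem admissibleLocal_mono {Δ : Type*} [PartialOrder Δ] (N : Δ → ℕ∞) {A B : Set (Set Δ)}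
    (h : A ⊆ B) (δ : Δ) : admissibleLocal N A δ ⊆ admissibleLocal N B δ :=
  fun _ ⟨x, hx, hz⟩ => ⟨x, h hx, hz⟩

theorem ProjSystem.ext_val_proj {Δ : Type*} [PartialOrder Δ] {N : Δ → ℕ∞} {P Q : ProjSystem N}
    (hS : P.S = Q.S) (hproj : ∀ {δ γ} (h : δ ≤ γ) z hzP hzQ,
      (P.proj h ⟨z, hzP⟩).1 = (Q.proj h ⟨z, hzQ⟩).1) : P = Q := by
  obtain ⟨S, _, _, projP, _, _, _⟩ := P
  obtain ⟨_, _, _, projQ, _, _, _⟩ := Q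
  obtain rfl : S = _ := hS
  obtain rfl : @projP = @projQ := by
    funext δ γ h z
    exact Subtype.ext (hproj h z.1 z.2 z.2)
  rfl

namespace WeakLTree

universe u

variable {L T : Type*} [LinearOrder L] [PartialOrder T] {𝒯 : WeakLTree L T}

namespace SiblingLabelling

variable (A : 𝒯.SiblingLabelling)

open Classical in
/-- The coordinate of `t` at an orbit `γ ≥ orb t` is the label of the node of `γ` above `t`; it is
`0` at the other orbits. -/
noncomputable def coord (t : T) (γ : 𝒯.Condensed) : ℕ :=
  if h : ∃ u, t ≤ u ∧ 𝒯.orb u = γ then A.label h.choose else 0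

theorem coord_orb {t u : T} (h : t ≤ u) : A.coord t (𝒯.orb u) = A.label u := by
  have ex : ∃ v, t ≤ v ∧ 𝒯.orb v = 𝒯.orb u := ⟨u, h, rfl⟩
  rw [coord, dif_pos ex, eq_of_le_of_orb_eq ex.choose_spec.1 h ex.choose_spec.2]

theorem exists_of_coord_ne_zero {t : T} {γ : 𝒯.Condensed} (h : A.coord t γ ≠ 0) :
    ∃ u, t ≤ u ∧ 𝒯.orb u = γ :=
  by_contra fun hcon => h (dif_neg hcon)

theorem coord_lt (t : T) (γ : 𝒯.Condensed) : (A.coord t γ : ℕ∞) < 𝒯.siblingCount γ := by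
  by_cases h : A.coord t γ = 0
  · rw [h]
    exact pos_iff_ne_zero.2 (siblingCount_ne_zero γ)
  · obtain ⟨u, htu, rfl⟩ := A.exists_of_coord_ne_zero h
    rw [A.coord_orb htu, siblingCount_orb]
    exact (A.bijOn u).mapsTo (mem_siblings_self u)

theorem finite_setOf_coord_ne_zero (t : T) : {γ | A.coord t γ ≠ 0}.Finite := by
  refine ((A.finite_support t).image 𝒯.orb).subset fun γ h => ?_
  obtain ⟨u, htu, rfl⟩ := A.exists_of_coord_ne_zero h
  exact ⟨u, ⟨htu, A.coord_orb htu ▸ h⟩, rfl⟩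

theorem coord_eqOn_of_le {t u : T} (h : t ≤ u) :
    (Set.Ici (𝒯.orb u)).EqOn (A.coord t) (A.coord u) := by
  intro γ hγ
  obtain ⟨v, huv, rfl⟩ := exists_le_of_orb_le (Set.mem_Ici.1 hγ)
  rw [A.coord_orb huv, A.coord_orb (h.trans huv)]

theorem coord_eqOn_of_sibling {u u' t t' : T} (h : 𝒯.Sibling u u') (ht : t ≤ u) (ht' : t' ≤ u') :
    (Set.Ioi (𝒯.orb u)).EqOn (A.coord t) (A.coord t') := by
  intro γ hγ
  obtain ⟨v, huv, rfl⟩ := exists_lt_of_orb_lt (Set.mem_Ioi.1 hγ)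
  rw [A.coord_orb (ht.trans huv.le), A.coord_orb (ht'.trans ((h.2 v).1 huv).le)]

theorem exists_coord_ne (h𝒯 : 𝒯.IsLTree) {t t' : T} (h : 𝒯.orb t = 𝒯.orb t') (hne : t ≠ t') :
    ∃ γ, 𝒯.orb t ≤ γ ∧ A.coord t γ ≠ A.coord t' γ ∧
      (Set.Ioi γ).EqOn (A.coord t) (A.coord t') := by
  obtain ⟨v, v', hv, hv', hvv', hs⟩ := h𝒯.exists_sibling h hne
  refine ⟨𝒯.orb v, orb_mono hv, fun e => hvv' ?_, A.coord_eqOn_of_sibling hs hv hv'⟩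
  rw [A.coord_orb hv, hs.1, A.coord_orb hv'] at e
  exact (A.bijOn v).injOn (mem_siblings_self v) hs e

theorem exists_coord_eq (t : T) {γ : 𝒯.Condensed} (hγ : 𝒯.orb t ≤ γ) {i : ℕ}
    (hi : (i : ℕ∞) < 𝒯.siblingCount γ) : ∃ t', 𝒯.orb t' = 𝒯.orb t ∧ A.coord t' γ = i ∧
      (Set.Ioi γ).EqOn (A.coord t') (A.coord t) := by
  obtain ⟨u, htu, rfl⟩ := exists_le_of_orb_le hγ
  rw [siblingCount_orb] at hi
  obtain ⟨u', hu', rfl⟩ := (A.bijOn u).surjOn hi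
  obtain ⟨t', htu', ht'⟩ := exists_ge_of_le_orb (hu'.1 ▸ hγ)
  exact ⟨t', ht', by rw [hu'.1, A.coord_orb htu'],
    (A.coord_eqOn_of_sibling hu' htu htu').symm⟩

theorem coord_eqOn_iff (h𝒯 : 𝒯.IsLTree) (t t' : T) (γ : 𝒯.Condensed) (h : 𝒯.orb t = 𝒯.orb t')
    (hγ : 𝒯.orb t ≤ γ) :
    (Set.Ici γ).EqOn (A.coord t) (A.coord t') ↔ 𝒯.AgreeOn t t' γ := by
  constructor
  · intro e
    obtain ⟨u, htu, rfl⟩ := exists_le_of_orb_le hγ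
    obtain ⟨u', htu', hu'⟩ := exists_le_of_orb_le (h ▸ hγ)
    have e' : (Set.Ici (𝒯.orb u)).EqOn (A.coord u) (A.coord u') :=
      ((A.coord_eqOn_of_le htu).symm.trans e).trans (hu' ▸ A.coord_eqOn_of_le htu')
    obtain rfl : u = u' := by
      by_contra hne
      obtain ⟨β, hβ, hβ_ne, -⟩ := A.exists_coord_ne h𝒯 hu'.symm hne
      exact hβ_ne (e' hβ)
    exact ⟨u, rfl, htu, htu'⟩
  · rintro ⟨u, rfl, htu, htu'⟩
    exact (A.coord_eqOn_of_le htu).trans (A.coord_eqOn_of_le htu').symm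

/-- The labels of the nodes above `t` as coordinates of `t`. -/
noncomputable def toCoordinates (h𝒯 : 𝒯.IsLTree) : 𝒯.Coordinates 𝒯.siblingCount where
  coord := A.coord
  coord_lt := A.coord_lt
  coord_eqOn_iff := A.coord_eqOn_iff h𝒯
  exists_perturb t _ hi := A.exists_coord_eq t le_rfl hi

variable (h𝒯 : 𝒯.IsLTree)

theorem loc_eq_of_le {t u : T} (h : t ≤ u) :
    (A.toCoordinates h𝒯).loc t (𝒯.orb u) = (A.toCoordinates h𝒯).loc u (𝒯.orb u) :=
  funext fun γ => Subtype.ext (A.coord_eqOn_of_le h γ.2)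

/-- The coordinate sequences form a family of local domains, because the coordinates of a node
restrict to those of the larger nodes. -/
noncomputable def localDomains : LocalDomains 𝒯.siblingCount where
  S := (A.toCoordinates h𝒯).seqs
  nonempty := (A.toCoordinates h𝒯).seqs_nonempty
  restrict_image {δ γ} h := by
    ext z
    constructor
    · rintro ⟨u, rfl, rfl⟩
      obtain ⟨t, htu, rfl⟩ := exists_ge_of_le_orb h
      exact ⟨_, ⟨t, rfl, rfl⟩, A.loc_eq_of_le h𝒯 htu⟩
    · rintro ⟨_, ⟨t, rfl, rfl⟩, rfl⟩
      obtain ⟨u, htu, rfl⟩ := exists_le_of_orb_le h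
      exact ⟨u, rfl, A.loc_eq_of_le h𝒯 htu⟩
  perturb_mem := (A.toCoordinates h𝒯).perturb_mem_seqs

theorem toProjSystem_localDomains :
    (A.localDomains h𝒯).toProjSystem = (A.toCoordinates h𝒯).toProjSystem := by
  refine ProjSystem.ext_val_proj rfl ?_
  rintro δ γ h _ hz ⟨t, rfl, rfl⟩
  obtain ⟨u, htu, rfl⟩ := exists_le_of_orb_le h
  exact (A.loc_eq_of_le h𝒯 htu).trans
    (congrArg Subtype.val ((A.toCoordinates h𝒯).proj_loc htu rfl rfl h)).symm

theorem localDomains_subset_admissibleLocal (δ : 𝒯.Condensed) :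
    (A.localDomains h𝒯).S δ ⊆ admissibleLocal 𝒯.siblingCount (suppMax 𝒯.Condensed) δ := by
  rintro _ ⟨t, -, rfl⟩
  refine admissibleLocal_mono _ (suppLF_subset_suppMax _) δ ?_
  exact ⟨fun γ => ⟨A.coord t γ, A.coord_lt t γ⟩,
    fun β => (A.finite_setOf_coord_ne_zero t).subset Set.inter_subset_left, fun _ => rfl⟩

end SiblingLabelling

theorem exists_localDomains {L : Type} {T : Type u} [LinearOrder L] [PartialOrder T]
    {𝒯 : WeakLTree L T} [Nonempty L] [Countable T] (h𝒯 : 𝒯.IsLTree)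
    (hp : 𝒯.IsPruned) (hs : 𝒯.IsSpecial) :
    ∃ (Δ : Type u) (_ : PartialOrder Δ) (N : Δ → ℕ∞), IsCountableTreeableSkeleton Δ N ∧
      ∃ D : LocalDomains N, (∀ δ, D.S δ ⊆ admissibleLocal N (suppMax Δ) δ) ∧
        Countable ((δ : Δ) × D.S δ) ∧ Nonempty (𝒯.aut ≃ₜ* D.wrSym) := by
  obtain ⟨A⟩ := 𝒯.nonempty_siblingLabelling
  let Z := A.toCoordinates h𝒯
  refine ⟨𝒯.Condensed, inferInstance, 𝒯.siblingCount,
    isCountableTreeableSkeleton_condensed hp hs siblingCount_ne_zero, A.localDomains h𝒯,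
    A.localDomains_subset_admissibleLocal h𝒯, Z.equivPoint.symm.injective.countable, ?_⟩
  change Nonempty (𝒯.aut ≃ₜ* (A.localDomains h𝒯).toProjSystem.wrSym)
  rw [A.toProjSystem_localDomains]
  exact Z.nonempty_aut_continuousMulEquiv_wrSym

end WeakLTree

/-! ## Finitely supported sequences as coordinates -/

section FinSeq

variable {Δ : Type*} [PartialOrder Δ] {N : Δ → ℕ∞} {δ : Δ}

/-- The finitely supported sequences `y` with `y γ < N γ` that vanish outside the cone above `δ`. -/
abbrev FinSeq (N : Δ → ℕ∞) (δ : Δ) : Type _ :=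
  {y : Δ →₀ ℕ // (∀ γ, (y γ : ℕ∞) < N γ) ∧ ∀ γ, y γ ≠ 0 → δ ≤ γ}

theorem nonempty_finSeq (hN : ∀ γ, N γ ≠ 0) (δ : Δ) : Nonempty (FinSeq N δ) :=
  ⟨0, fun γ => pos_iff_ne_zero.2 (hN γ), fun _ h => absurd rfl h⟩

theorem exists_finSeq_update (y : FinSeq N δ) {γ : Δ} (hγ : δ ≤ γ) {i : ℕ} (hi : (i : ℕ∞) < N γ) :
    ∃ w : FinSeq N δ, w.1 γ = i ∧ (Set.Ioi γ).EqOn w.1 y.1 := by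
  classical
  refine ⟨⟨y.1.update γ i, fun β => ?_, fun β hβ => ?_⟩, by simp, fun β hβ => ?_⟩
  · rcases eq_or_ne β γ with rfl | h
    · simpa using hi
    · simpa [h] using y.2.1 β
  · rcases eq_or_ne β γ with rfl | h
    · exact hγ
    · exact y.2.2 β (by simpa [h] using hβ)
  · simp [(Set.mem_Ioi.1 hβ).ne']

theorem exists_finSeq_eqOn (y : Δ →₀ ℕ) (hy : ∀ γ, (y γ : ℕ∞) < N γ) (δ : Δ) :
    ∃ w : FinSeq N δ, (Set.Ici δ).EqOn w.1 y := by
  classical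
  refine ⟨⟨y.filter (δ ≤ ·), fun γ => ?_, fun γ hγ => ?_⟩, fun γ hγ => y.filter_apply_pos _ hγ⟩
  · by_cases h : δ ≤ γ
    · rw [Finsupp.filter_apply_pos (δ ≤ ·) y h]
      exact hy γ
    · rw [Finsupp.filter_apply_neg (δ ≤ ·) y h]
      exact zero_le.trans_lt (hy γ)
  · by_contra h
    exact hγ (Finsupp.filter_apply_neg (δ ≤ ·) y h)

theorem finSeq_ext {y w : FinSeq N δ} (h : (Set.Ici δ).EqOn y.1 w.1) : y.1 = w.1 := by
  ext γ
  by_cases hγ : δ ≤ γ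
  · exact h hγ
  · rw [not_not.1 (mt (y.2.2 γ) hγ), not_not.1 (mt (w.2.2 γ) hγ)]

theorem mem_admissibleLocal_suppLF_iff {z : LocSeq N δ} :
    z ∈ admissibleLocal N (suppLF Δ) δ ↔ ∃ w : FinSeq N δ, ∀ γ, (z γ).1 = w.1 γ.1 := by
  classical
  constructor
  · rintro ⟨x, hx, hzx⟩
    let y : Δ →₀ ℕ := Finsupp.ofSupportFinite (fun γ => if δ ≤ γ then (x γ).1 else 0)
      ((hx δ).subset fun γ hγ => by simpa [seqSupport, and_comm] using hγ)
    have y_apply (γ) : y γ = if δ ≤ γ then (x γ).1 else 0 := rfl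
    refine ⟨⟨y, fun γ => ?_, fun γ hγ => ?_⟩, fun γ => ?_⟩
    · rw [y_apply]
      split_ifs
      exacts [(x γ).2, zero_le.trans_lt (x γ).2]
    · by_contra h
      exact hγ (if_neg h)
    · rw [hzx, y_apply, if_pos γ.2]
  · rintro ⟨w, hw⟩
    refine ⟨fun γ => ⟨w.1 γ, w.2.1 γ⟩, fun β => ?_, fun γ => Subtype.ext (hw γ)⟩
    exact w.1.support.finite_toSet.subset fun γ hγ => Finsupp.mem_support_iff.2 hγ.1

theorem countable_admissibleLocal_suppLF [Countable Δ] (N : Δ → ℕ∞) (δ : Δ) :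
    Countable (admissibleLocal N (suppLF Δ) δ) := by
  choose w hw using fun z : admissibleLocal N (suppLF Δ) δ => mem_admissibleLocal_suppLF_iff.1 z.2
  refine Function.Injective.countable (f := w) fun z z' h => ?_
  exact Subtype.ext (funext fun γ => Subtype.ext (by rw [hw, hw, h]))

theorem ProjSystem.countable_point_of_eq_suppLF [Countable Δ] {P : ProjSystem N}
    (h : ∀ δ, P.S δ = admissibleLocal N (suppLF Δ) δ) : Countable P.Point := by
  have (δ : Δ) : Countable (P.S δ) := h δ ▸ countable_admissibleLocal_suppLF N δ
  infer_instance

theorem isRichFamily_finSeq (N : Δ → ℕ∞) (δ : Δ) :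
    IsRichFamily (fun γ : {γ // δ ≤ γ} => N γ.1) fun (y : FinSeq N δ) γ => y.1 γ.1 where
  lt y γ := y.2.1 γ.1
  exists_disagree y w hne := by
    classical
    obtain ⟨γ, hγ⟩ := (y.1.neLocus w.1).exists_maximal
      (Finsupp.nonempty_neLocus_iff.2 (Subtype.coe_injective.ne hne))
    have hδγ : δ ≤ γ := by
      by_contra h
      exact Finsupp.mem_neLocus.1 hγ.prop
        ((not_not.1 (mt (y.2.2 γ) h)).trans (not_not.1 (mt (w.2.2 γ) h)).symm)
    refine ⟨⟨γ, hδγ⟩, Finsupp.mem_neLocus.1 hγ.prop, fun β hβ => ?_⟩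
    by_contra h
    exact hγ.not_gt (Finsupp.mem_neLocus.2 h) hβ
  exists_update y γ i hi := by
    obtain ⟨w, hw, hwy⟩ := exists_finSeq_update y γ.2 hi
    exact ⟨w, hw, fun β hβ => hwy (Subtype.coe_lt_coe.2 hβ)⟩

theorem eqOn_Ici_cone_iff {f g : Δ → ℕ} (γ : {γ // δ ≤ γ}) :
    (Set.Ici γ).EqOn (fun β => f β.1) (fun β => g β.1) ↔ (Set.Ici γ.1).EqOn f g :=
  ⟨fun h β hβ => h (x := ⟨β, γ.2.trans hβ⟩) hβ, fun h _ hβ => h hβ⟩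

end FinSeq

namespace WeakLTree

universe u

variable {L T : Type*} [LinearOrder L] [PartialOrder T] {𝒯 : WeakLTree L T}

theorem SiblingLabelling.isRichFamily_coord (A : 𝒯.SiblingLabelling) (h𝒯 : 𝒯.IsLTree)
    (δ : 𝒯.Condensed) : IsRichFamily (fun γ : {γ // δ ≤ γ} => 𝒯.siblingCount γ.1)
      fun (t : {t // 𝒯.orb t = δ}) γ => A.coord t.1 γ.1 where
  lt t γ := A.coord_lt t.1 γ.1
  exists_disagree := by
    rintro ⟨t, rfl⟩ ⟨t', ht'⟩ hne
    obtain ⟨γ, hγ, hγ_ne, heq⟩ := A.exists_coord_ne h𝒯 ht'.symm fun e => hne (Subtype.ext e)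
    exact ⟨⟨γ, hγ⟩, hγ_ne, fun β hβ => heq (show γ < β.1 from hβ)⟩
  exists_update := by
    rintro ⟨t, rfl⟩ ⟨γ, hγ⟩ i hi
    obtain ⟨t', ht', ht'_eq, heq⟩ := A.exists_coord_eq t hγ hi
    exact ⟨⟨t', ht'⟩, ht'_eq, fun β hβ => heq (show γ < β.1 from hβ)⟩

variable (𝒯) in
/-- Coordinates that identify each orbit `δ` with the set of all finitely supported sequences on the
cone above `δ`. -/
structure FinSeqCoordinates (N : 𝒯.Condensed → ℕ∞) where
  seq : (t : T) → FinSeq N (𝒯.orb t)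
  eqOn_iff : ∀ t t' γ, 𝒯.orb t = 𝒯.orb t' → 𝒯.orb t ≤ γ →
    ((Set.Ici γ).EqOn (seq t).1 (seq t').1 ↔ 𝒯.AgreeOn t t' γ)
  exists_seq_eq : ∀ δ (w : FinSeq N δ), ∃ t, 𝒯.orb t = δ ∧ (seq t).1 = w.1

theorem nonempty_finSeqCoordinates [Countable T] (h𝒯 : 𝒯.IsLTree) :
    Nonempty (𝒯.FinSeqCoordinates 𝒯.siblingCount) := by
  obtain ⟨A⟩ := 𝒯.nonempty_siblingLabelling
  have key (δ : 𝒯.Condensed) : ∃ e : {t // 𝒯.orb t = δ} ≃ FinSeq 𝒯.siblingCount δ,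
      ∀ t t' (γ : {γ // δ ≤ γ}), (Set.Ici γ.1).EqOn (A.coord t.1) (A.coord t'.1) ↔
        (Set.Ici γ.1).EqOn (e t).1 (e t').1 := by
    have : Nonempty {t // 𝒯.orb t = δ} := nonempty_subtype.2 (𝒯.exists_orb δ)
    have := nonempty_finSeq (siblingCount_ne_zero (𝒯 := 𝒯)) δ
    obtain ⟨e, he⟩ := exists_equiv_of_isRichFamily
      (fun α β : {γ // δ ≤ γ} => 𝒯.condensed.le_or_ge_of_le_of_le α.2 β.2)
      (A.isRichFamily_coord h𝒯 δ) (isRichFamily_finSeq _ δ)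
    refine ⟨e, fun t t' γ => ?_⟩
    rw [← eqOn_Ici_cone_iff, he, eqOn_Ici_cone_iff]
  choose e he using key
  have cast_eq {t δ} (h : 𝒯.orb t = δ) : (e δ ⟨t, h⟩).1 = (e (𝒯.orb t) ⟨t, rfl⟩).1 := by
    subst h
    rfl
  refine ⟨⟨fun t => e (𝒯.orb t) ⟨t, rfl⟩, fun t t' γ h hγ => ?_, fun δ w => ?_⟩⟩
  · rw [← A.coord_eqOn_iff h𝒯 t t' γ h hγ, he (𝒯.orb t) ⟨t, rfl⟩ ⟨t', h.symm⟩ ⟨γ, hγ⟩,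
      cast_eq h.symm]
  · refine ⟨((e δ).symm w).1, ((e δ).symm w).2, (cast_eq ((e δ).symm w).2).symm.trans ?_⟩
    exact congrArg Subtype.val ((e δ).apply_symm_apply w)

namespace FinSeqCoordinates

variable {N : 𝒯.Condensed → ℕ∞} (Y : 𝒯.FinSeqCoordinates N)

/-- The underlying coordinates. -/
def toCoordinates : 𝒯.Coordinates N where
  coord t := (Y.seq t).1
  coord_lt t := (Y.seq t).2.1
  coord_eqOn_iff := Y.eqOn_iff
  exists_perturb t i hi := by
    obtain ⟨w, hw, hwt⟩ := exists_finSeq_update (Y.seq t) le_rfl hi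
    obtain ⟨t', ht', e⟩ := Y.exists_seq_eq (𝒯.orb t) w
    exact ⟨t', ht', by rw [e, hw], by rwa [e]⟩

theorem seqs_eq_admissibleLocal (δ : 𝒯.Condensed) :
    Y.toCoordinates.seqs δ = admissibleLocal N (suppLF 𝒯.Condensed) δ := by
  ext z
  rw [mem_admissibleLocal_suppLF_iff]
  constructor
  · rintro ⟨t, rfl, rfl⟩
    exact ⟨Y.seq t, fun _ => rfl⟩
  · rintro ⟨w, hw⟩
    obtain ⟨t, ht, e⟩ := Y.exists_seq_eq δ w
    exact ⟨t, ht, funext fun γ => Subtype.ext ((hw γ).trans (DFunLike.congr_fun e γ.1).symm)⟩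

variable {idx : 𝒯.Condensed → ℕ}

theorem exists_eqOn_of_leastIndex_eq (Y : 𝒯.FinSeqCoordinates N) (hidx : idx.Injective) :
    ∃ Y' : 𝒯.FinSeqCoordinates N, ∀ {t u}, t ≤ u →
      leastIndex idx (𝒯.orb t) = leastIndex idx (𝒯.orb u) →
        (Set.Ici (𝒯.orb u)).EqOn (Y'.seq u).1 (Y'.seq t).1 := by
  -- Each `t` inherits its sequence from a node `root t` below it, whose orbit has the least index
  -- among all orbits below that of `t`.
  have exists_root (t : T) : ∃ s ≤ t, idx (𝒯.orb s) = leastIndex idx (𝒯.orb t) := by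
    obtain ⟨δ, hδ, hδ_idx⟩ := exists_le_eq_leastIndex (idx := idx) (𝒯.orb t)
    obtain ⟨s, hst, rfl⟩ := exists_ge_of_le_orb hδ
    exact ⟨s, hst, hδ_idx⟩
  choose root root_le idx_root using exists_root
  choose c hc using fun t => exists_finSeq_eqOn (Y.seq (root t)).1 (Y.seq (root t)).2.1 (𝒯.orb t)
  have c_eqOn {s t} (hst : s ≤ t) (hs : idx (𝒯.orb s) = leastIndex idx (𝒯.orb t)) :
      (Set.Ici (𝒯.orb t)).EqOn (c t).1 (Y.seq s).1 := by
    refine (hc t).trans ((Y.eqOn_iff _ _ _ (hidx ((idx_root t).trans hs.symm)) ?_).2 ?_)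
    exacts [orb_mono (root_le t), ⟨t, rfl, root_le t, hst⟩]
  refine ⟨⟨c, fun t t' γ h hγ => ?_, fun δ w => ?_⟩, fun {t u} htu h => ?_⟩
  · have orb_root : 𝒯.orb (root t) = 𝒯.orb (root t') := hidx (by rw [idx_root, idx_root, h])
    rw [← agreeOn_congr (root_le t) (root_le t') hγ (h ▸ hγ),
      ← Y.eqOn_iff _ _ γ orb_root ((orb_mono (root_le t)).trans hγ)]
    have ht := (hc t).mono (Set.Ici_subset_Ici.2 hγ)
    have ht' := (hc t').mono (Set.Ici_subset_Ici.2 (h ▸ hγ))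
    exact ⟨fun e => (ht.symm.trans e).trans ht', fun e => (ht.trans e).trans ht'.symm⟩
  · obtain ⟨ε, hε, hε_idx⟩ := exists_le_eq_leastIndex (idx := idx) δ
    obtain ⟨s, rfl, hs⟩ := Y.exists_seq_eq ε ⟨w.1, w.2.1, fun γ h => hε.trans (w.2.2 γ h)⟩
    obtain ⟨t, hst, rfl⟩ := exists_le_of_orb_le hε
    exact ⟨t, rfl, finSeq_ext (hs ▸ c_eqOn hst hε_idx)⟩
  · exact (c_eqOn ((root_le t).trans htu) ((idx_root t).trans h)).trans
      ((hc t).mono (Set.Ici_subset_Ici.2 (orb_mono htu))).symm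

theorem hasFiniteCharacter (hY : ∀ {t u}, t ≤ u →
    leastIndex idx (𝒯.orb t) = leastIndex idx (𝒯.orb u) →
      (Set.Ici (𝒯.orb u)).EqOn (Y.seq u).1 (Y.seq t).1) :
    Y.toCoordinates.toProjSystem.HasFiniteCharacter := by
  intro δ
  refine ⟨idx δ + 1, fun k => {γ | δ ≤ γ ∧ leastIndex idx γ = k}, ?_, ?_, fun k => ⟨⟨?_⟩, ?_⟩⟩
  · ext γ
    simp only [Set.mem_iUnion, Set.mem_ofPred_eq, Set.mem_Ici]
    exact ⟨fun ⟨_, h, _⟩ => h,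
      fun h => ⟨⟨leastIndex idx γ, Nat.lt_succ_of_le (leastIndex_le h)⟩, h, rfl⟩⟩
  · exact fun k k' hk => Set.disjoint_left.2 fun γ h h' => hk (Fin.ext (h.2.symm.trans h'.2))
  · rintro α ⟨hα, hα_idx⟩ β ⟨-, hβ_idx⟩ γ ⟨hαγ, hγβ⟩
    refine ⟨hα.trans hαγ, le_antisymm ?_ ?_⟩
    · exact (leastIndex_anti hαγ).trans hα_idx.le
    · exact hβ_idx.ge.trans (leastIndex_anti hγβ)
  · rintro γ ⟨-, hγ⟩ β ⟨-, hβ⟩ h ⟨_, t, rfl, rfl⟩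
    obtain ⟨u, htu, rfl⟩ := exists_le_of_orb_le h
    refine (congrArg Subtype.val (Y.toCoordinates.proj_loc htu rfl rfl h)).trans ?_
    exact funext fun ε => Subtype.ext (hY htu (hγ.trans hβ.symm) ε.2)

end FinSeqCoordinates

theorem exists_projSystem_suppLF {L : Type} {T : Type u} [LinearOrder L] [PartialOrder T]
    {𝒯 : WeakLTree L T} [Nonempty L] [Countable T] (h𝒯 : 𝒯.IsLTree)
    (hp : 𝒯.IsPruned) (hs : 𝒯.IsSpecial) :
    ∃ (Δ : Type u) (_ : PartialOrder Δ) (N : Δ → ℕ∞), IsCountableTreeableSkeleton Δ N ∧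
      ∃ P : ProjSystem N, (∀ δ, P.S δ = admissibleLocal N (suppLF Δ) δ) ∧
        P.IsLocallyHomogeneous ∧ P.HasFiniteCharacter ∧ Nonempty (𝒯.aut ≃ₜ* P.wrSym) := by
  obtain ⟨Y₀⟩ := nonempty_finSeqCoordinates h𝒯
  obtain ⟨idx, hidx⟩ := exists_injective_nat 𝒯.Condensed
  obtain ⟨Y, hY⟩ := Y₀.exists_eqOn_of_leastIndex_eq hidx
  let Z := Y.toCoordinates
  exact ⟨𝒯.Condensed, inferInstance, 𝒯.siblingCount,
    isCountableTreeableSkeleton_condensed hp hs siblingCount_ne_zero, Z.toProjSystem,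
    Y.seqs_eq_admissibleLocal, Z.isLocallyHomogeneous_toProjSystem, Y.hasFiniteCharacter hY,
    Z.nonempty_aut_continuousMulEquiv_wrSym⟩

end WeakLTree

theorem mainTheorem1 {G : Type*} [Group G] [TopologicalSpace G] [IsTopologicalGroup G] :
    List.TFAE [
      ∃ (U : Type) (_ : MetricSpace U), IsPolishUltrametric U ∧ Nonempty (G ≃ₜ* (U ≃ᵢ U)),
      ∃ (U : Type) (_ : MetricSpace U), IsPolishUltrametric U ∧ PerfectSpace U ∧
        LocallyCompactSpace U ∧ Nonempty (G ≃ₜ* (U ≃ᵢ U)),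
      ∃ (U : Type) (_ : MetricSpace U), IsPolishUltrametric U ∧ IsUniformlyDiscrete U ∧
        Nonempty (G ≃ₜ* (U ≃ᵢ U)),
      ∃ (L T : Type) (_ : LinearOrder L) (_ : PartialOrder T) (𝒯 : WeakLTree L T),
        𝒯.IsLTree ∧ Countable T ∧ 𝒯.IsPruned ∧ Nonempty (G ≃ₜ* 𝒯.aut),
      ∃ (L T : Type) (_ : LinearOrder L) (_ : PartialOrder T) (𝒯 : WeakLTree L T),
        (∃ m : L, IsBot m) ∧ 𝒯.IsLTree ∧ Countable T ∧ 𝒯.IsPruned ∧ 𝒯.IsSpecial ∧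
        Nonempty (G ≃ₜ* 𝒯.aut),
      ∃ (T : Type) (_ : PartialOrder T) (𝒯 : WeakLTree ℚ T),
        𝒯.IsLTree ∧ Countable T ∧ 𝒯.IsPruned ∧ 𝒯.IsSpecial ∧ Nonempty (G ≃ₜ* 𝒯.aut),
      ∃ (Δ : Type) (_ : PartialOrder Δ) (N : Δ → ℕ∞), IsCountableTreeableSkeleton Δ N ∧
        ∃ P : ProjSystem N, (∀ δ, P.S δ = admissibleLocal N (suppLF Δ) δ) ∧
          P.IsLocallyHomogeneous ∧ P.HasFiniteCharacter ∧ Nonempty (G ≃ₜ* P.wrSym),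
      ∃ (Δ : Type) (_ : PartialOrder Δ) (N : Δ → ℕ∞), IsCountableTreeableSkeleton Δ N ∧
        ∃ D : LocalDomains N, (∀ δ, D.S δ ⊆ admissibleLocal N (suppMax Δ) δ) ∧
          Countable ((δ : Δ) × D.S δ) ∧ Nonempty (G ≃ₜ* D.wrSym),
      ∃ (Δ : Type) (_ : PartialOrder Δ) (N : Δ → ℕ∞), IsCountableTreeableSkeleton Δ N ∧
        ∃ P : ProjSystem N, (∀ δ, P.S δ ⊆ admissibleLocal N (suppMax Δ) δ) ∧
          Countable ((δ : Δ) × P.S δ) ∧ Nonempty (G ≃ₜ* P.wrSym)] := by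
  tfae_have 2 → 1 := fun ⟨U, i, hU, _, _, e⟩ => ⟨U, i, hU, e⟩
  tfae_have 3 → 1 := fun ⟨U, i, hU, _, e⟩ => ⟨U, i, hU, e⟩
  tfae_have 5 → 4 := fun ⟨L, T, i, j, 𝒯, _, h, hT, hp, _, e⟩ => ⟨L, T, i, j, 𝒯, h, hT, hp, e⟩
  tfae_have 6 → 4 := fun ⟨T, i, 𝒯, h, hT, hp, _, e⟩ => ⟨ℚ, T, _, i, 𝒯, h, hT, hp, e⟩
  tfae_have 8 → 9 := fun ⟨Δ, i, N, hΔ, D, hS, hD, e⟩ => ⟨Δ, i, N, hΔ, D.toProjSystem, hS, hD, e⟩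
  tfae_have 7 → 9 := fun ⟨Δ, i, N, hΔ, P, hS, _, _, e⟩ =>
    have := hΔ.countable
    ⟨Δ, i, N, hΔ, P,
      fun δ => (hS δ).trans_subset (admissibleLocal_mono N (suppLF_subset_suppMax Δ) δ),
      ProjSystem.countable_point_of_eq_suppLF hS, e⟩
  tfae_have 3 → 2 := fun ⟨V, _, hV, hD, ⟨e⟩⟩ =>
    have ⟨r, i, hU, hperf, hlc, ⟨φ⟩⟩ := exists_perfect_locallyCompact hV hD
    ⟨CantorBlowup V r, i, hU, hperf, hlc, ⟨e.trans φ⟩⟩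
  tfae_have 4 → 3 := fun ⟨_, _, _, _, _, h, _, _, ⟨e⟩⟩ =>
    have ⟨U, i, hU, hD, ⟨φ⟩⟩ := h.exists_uniformlyDiscrete
    ⟨U, i, hU, hD, ⟨e.trans φ⟩⟩
  tfae_have 9 → 3 := fun ⟨_, _, _, hΔ, _, hS, _, ⟨e⟩⟩ =>
    have ⟨U, i, hU, hD, ⟨φ⟩⟩ := ProjSystem.exists_uniformlyDiscrete hΔ hS
    ⟨U, i, hU, hD, ⟨e.trans φ⟩⟩
  tfae_have 1 → 6 := fun ⟨_, _, hU, ⟨e⟩⟩ =>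
    have ⟨T, i, 𝒯, h, hT, hp, hs, ⟨φ⟩⟩ := hU.exists_special_rat_tree
    ⟨T, i, 𝒯, h, hT, hp, hs, ⟨e.trans φ⟩⟩
  tfae_have 3 → 5 := fun ⟨_, _, hU, hD, ⟨e⟩⟩ =>
    have ⟨L, T, i, j, 𝒯, hL, h, hT, hp, hs, ⟨φ⟩⟩ := hU.exists_special_tree_isBot hD
    ⟨L, T, i, j, 𝒯, hL, h, hT, hp, hs, ⟨e.trans φ⟩⟩
  tfae_have 6 → 7 := fun ⟨_, _, _, h, _, hp, hs, ⟨e⟩⟩ =>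
    have ⟨Δ, i, N, hΔ, P, hS, hlh, hfc, ⟨φ⟩⟩ := WeakLTree.exists_projSystem_suppLF h hp hs
    ⟨Δ, i, N, hΔ, P, hS, hlh, hfc, ⟨e.trans φ⟩⟩
  tfae_have 6 → 8 := fun ⟨_, _, _, h, _, hp, hs, ⟨e⟩⟩ =>
    have ⟨Δ, i, N, hΔ, D, hS, hD, ⟨φ⟩⟩ := WeakLTree.exists_localDomains h hp hs
    ⟨Δ, i, N, hΔ, D, hS, hD, ⟨e.trans φ⟩⟩
  tfae_finish
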